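/- Let $K$ be a field of characteristic zero and let $S=\operatorname{Spec}R$ be a smooth affine curve over $K$ such that $\Omega^1_S=\Omega^1_{R/K}$ is a free $R$-module with basis $dt$. For $h\in R$ define $h'\in R$ by $dh=h'\,dt$. Let $g_2,g_3\in R$ with $\Delta:=g_2^3-27g_3^2\in R^\times$, and let $f:U\to S$ be the smooth projective family of elliptic curves $y^2=4x^3-g_2x-g_3$, i.e. the gluing of $$U_0=\operatorname{Spec}R[x,y]/(y^2-4x^3+g_2x+g_3),\qquad U_\infty=\operatorname{Spec}R[z,u]/(u^2-4z+g_2z^3+g_3z^4)$$ along $z=1/x$, $u=y/x^2$. Let $H^1_{\mathrm{dR}}(U/S)$ be the first cohomology of the total Čech complex of $\mathcal O_U\xrightarrow{d}\Omega^1_{U/S}$ for the cover $\{U_0,U_\infty\}$: its elements are represented by cocycles $(\alpha)\times(w_0,w_\infty)$ with $\alpha\in\Gamma(U_0\cap U_\infty,\mathcal O_U)$, $w_0\in\Gamma(U_0,\Omega^1_{U/S})$, $w_\infty\in\Gamma(U_\infty,\Omega^1_{U/S})$ and $d\alpha=w_0-w_\infty$ on $U_0\cap U_\infty$, modulo the coboundaries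 $(s_0-s_\infty)\times(ds_0,ds_\infty)$. Let $$\nabla:H^1_{\mathrm{dR}}(U/S)\to\Omega^1_S\otimes_R H^1_{\mathrm{dR}}(U/S)$$ be the Gauss–Manin connection, i.e. the connecting homomorphism of $$0\to f^*\Omega^1_S\otimes\Omega^{\bullet-1}_{U/S}\to\Omega^\bullet_U/\operatorname{Im}(f^*\Omega^2_S\otimes\Omega^{\bullet-2}_U)\to\Omega^\bullet_{U/S}\to0$$ followed by the identification of $H^2(U,f^*\Omega^1_S\otimes\Omega^{\bullet-1}_{U/S})$ with $\Omega^1_S\otimes_R H^1_{\mathrm{dR}}(U/S)$ given on Čech cocycles by $(g\,dt)\times(dt\wedge w_0,dt\wedge w_\infty)\mapsto dt\otimes[(-g)\times(w_0,w_\infty)]$; here the differential of the absolute Čech complex is $(\alpha)\times(\beta_0,\beta_\infty)\mapsto(-d\alpha+\beta_0-\beta_\infty)\times(d\beta_0,d\beta_\infty)$. Put $$\omega:=(0)\times\Bigl(\frac{dx}{y},-\frac{dz}{u}\Bigr),\qquad \omega^*:=\Bigl(\frac yx\Bigr)\times\Bigl(\frac{2x\,dx}{y},\frac{(g_2z+2g_3z^2)\,dz}{2u}\Bigr).$$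 Then $\omega,\omega^*$ form an $R$-basis of $H^1_{\mathrm{dR}}(U/S)$; the map $\nabla$ is well defined and $K$-linear and satisfies $\nabla(h\xi)=dh\otimes\xi+h\nabla(\xi)$ for $h\in R$; and $$\nabla(\omega)=\frac{3(2g_2g_3'-3g_2'g_3)}{4\Delta}\,dt\otimes\omega^*-\frac{\Delta'}{12\Delta}\,dt\otimes\omega,$$ $$\nabla(\omega^*)=\frac{\Delta'}{12\Delta}\,dt\otimes\omega^*-\frac{g_2(2g_2g_3'-3g_2'g_3)}{4\Delta}\,dt\otimes\omega.$$ -/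

import Mathlib

open scoped TensorProduct Polynomial KaehlerDifferential

universe u

namespace EllipticGM

/-! ## Differential forms on affine schemes -/

section Forms

/-- The wedge product `M × M → ⋀² M`. -/
noncomputable def wedge (A : Type u) {M : Type u} [CommRing A] [AddCommGroup M] [Module A M] :
    M →ₗ[A] M →ₗ[A] ⋀[A]^2 M :=
  LinearMap.mk₂ A (fun m n => exteriorPower.ιMulti A 2 ![m, n])
    (fun m m' n => Subtype.ext (by simp [ExteriorAlgebra.ιMulti_apply, add_mul]))
    (fun c m n => Subtype.ext (by simp [ExteriorAlgebra.ιMulti_apply]))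
    (fun m n n' => Subtype.ext (by simp [ExteriorAlgebra.ιMulti_apply, mul_add]))
    (fun c m n => Subtype.ext (by simp [ExteriorAlgebra.ιMulti_apply]))

theorem wedge_self (A : Type u) {M : Type u} [CommRing A] [AddCommGroup M] [Module A M] (m : M) :
    wedge A m m = 0 :=
  (exteriorPower.ιMulti A 2 (M := M)).map_eq_zero_of_eq ![m, m] (i := 0) (j := 1) rfl (by decide)

theorem wedge_swap (A : Type u) {M : Type u} [CommRing A] [AddCommGroup M] [Module A M]
    (m n : M) : wedge A m n = - wedge A n m := by
  have h := wedge_self A (m + n)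
  simp only [map_add, LinearMap.add_apply, wedge_self, zero_add, add_zero] at h
  exact eq_neg_of_add_eq_zero_right h

variable (K A : Type u) [CommRing K] [CommRing A] [Algebra K A]

/-- `Σ aᵢ [bᵢ] ↦ Σ daᵢ ∧ dbᵢ` on formal sums. -/
noncomputable def extDerivAux : (A →₀ A) →ₗ[K] ⋀[A]^2 Ω[A⁄K] :=
  Finsupp.lsum K fun b : A =>
    (((wedge A).flip (KaehlerDifferential.D K A b)).restrictScalars K).comp
      (KaehlerDifferential.D K A).toLinearMap

theorem extDerivAux_single (a b : A) : extDerivAux K A (Finsupp.single b a) =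
    wedge A (KaehlerDifferential.D K A a) (KaehlerDifferential.D K A b) := by
  simp [extDerivAux]

/-- `Σ aᵢ [bᵢ] ↦ Σ aᵢ dbᵢ` on formal sums. -/
noncomputable def formalSum : (A →₀ A) →ₗ[K] Ω[A⁄K] :=
  (Finsupp.linearCombination A (KaehlerDifferential.D K A)).restrictScalars K

theorem formalSum_surjective : Function.Surjective (formalSum K A) :=
  KaehlerDifferential.linearCombination_surjective K A

theorem extDerivAux_ker : LinearMap.ker (formalSum K A) ≤ LinearMap.ker (extDerivAux K A) := by
  intro x hx
  have key : ∀ c : A, extDerivAux K A (c • x) = 0 := by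
    have hx' : x ∈ KaehlerDifferential.kerTotal K A := by
      rw [← KaehlerDifferential.kerTotal_eq]; exact hx
    clear hx
    unfold KaehlerDifferential.kerTotal at hx'
    induction hx' using Submodule.span_induction with
    | mem x h =>
      intro c
      rcases h with (⟨⟨a, b⟩, rfl⟩ | ⟨⟨a, b⟩, rfl⟩) | ⟨r, rfl⟩
      · simp [smul_sub, smul_add, extDerivAux_single]
      · simp only [smul_sub, smul_add, Finsupp.smul_single, smul_eq_mul, map_sub, map_add,
          extDerivAux_single, Derivation.leibniz, LinearMap.add_apply, LinearMap.map_smul,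
          LinearMap.smul_apply, mul_one]
        rw [wedge_swap A (KaehlerDifferential.D K A b) (KaehlerDifferential.D K A a)]
        module
      · simp [extDerivAux_single]
    | zero => intro c; simp
    | add x y _ _ h₁ h₂ => intro c; rw [smul_add, map_add, h₁, h₂, add_zero]
    | smul a x _ h₁ => intro c; rw [smul_smul]; exact h₁ _
  have := key 1
  rwa [one_smul] at this

/-- The exterior derivative `d : Ω¹ → Ω²`, `d(Σ aᵢ dbᵢ) = Σ daᵢ ∧ dbᵢ`. -/
noncomputable def extDeriv : Ω[A⁄K] →ₗ[K] ⋀[A]^2 Ω[A⁄K] :=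
  ((LinearMap.ker (formalSum K A)).liftQ (extDerivAux K A) (extDerivAux_ker K A)).comp
    ((formalSum K A).quotKerEquivOfSurjective
      (formalSum_surjective K A)).symm.toLinearMap

theorem extDeriv_smul_D (a b : A) :
    extDeriv K A (a • KaehlerDifferential.D K A b) =
      wedge A (KaehlerDifferential.D K A a) (KaehlerDifferential.D K A b) := by
  have h : ((formalSum K A).quotKerEquivOfSurjective
      (formalSum_surjective K A)).symm
        (a • KaehlerDifferential.D K A b) =
      (LinearMap.ker (formalSum K A)).mkQ (Finsupp.single b a) := by
    rw [LinearEquiv.symm_apply_eq, Submodule.mkQ_apply,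
      LinearMap.quotKerEquivOfSurjective_apply_mk]
    simp [formalSum]
  rw [extDeriv, LinearMap.comp_apply, LinearEquiv.coe_coe, h, Submodule.mkQ_apply,
    Submodule.liftQ_apply, extDerivAux_single]

variable (R : Type u) [CommRing R] [Algebra K R] [Algebra R A] [IsScalarTower K R A]

/-- Pull-back of differentials `Ω¹_{R/K} → Ω¹_{A/K}`. -/
noncomputable abbrev pullback : Ω[R⁄K] →ₗ[R] Ω[A⁄K] := KaehlerDifferential.map K K R A

/-- The image of `A ⊗ Ω²_{R/K}` in `Ω²_{A/K}`. -/
noncomputable def baseTwoForms : Submodule A (⋀[A]^2 Ω[A⁄K]) :=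
  Submodule.span A (Set.range fun p : Ω[R⁄K] × Ω[R⁄K] =>
    wedge A (pullback K A R p.1) (pullback K A R p.2))

/-- `Ω²_{A/K}` modulo the image of `A ⊗ Ω²_{R/K}`. -/
abbrev OmegaBar2 : Type u := (⋀[A]^2 Ω[A⁄K]) ⧸ baseTwoForms K A R

/-- The differential `Ω¹_{A/K} → Ω²_{A/K} / Im (A ⊗ Ω²_{R/K})`. -/
noncomputable def dBar : Ω[A⁄K] →ₗ[K] OmegaBar2 K A R :=
  ((baseTwoForms K A R).mkQ.restrictScalars K).comp (extDeriv K A)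

/-- For a form `τ` on the base, the additive map `a ↦ τ ∧ da`. -/
noncomputable def wedgeD (τ : Ω[R⁄K]) : A →+ OmegaBar2 K A R :=
  ((baseTwoForms K A R).mkQ.comp (wedge A (pullback K A R τ))).toAddMonoidHom.comp
    (KaehlerDifferential.D K A).toLinearMap.toAddMonoidHom

theorem wedgeD_apply (τ : Ω[R⁄K]) (a : A) : wedgeD K A R τ a = (baseTwoForms K A R).mkQ
    (wedge A (pullback K A R τ) (KaehlerDifferential.D K A a)) := rfl

theorem wedgeD_mul (τ : Ω[R⁄K]) (a b : A) :
    wedgeD K A R τ (a * b) = a • wedgeD K A R τ b + b • wedgeD K A R τ a := by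
  simp only [wedgeD_apply, Derivation.leibniz, map_add, map_smul]

theorem wedgeD_algebraMap (τ : Ω[R⁄K]) (r : R) : wedgeD K A R τ (algebraMap R A r) = 0 := by
  rw [wedgeD_apply, Submodule.mkQ_apply, Submodule.Quotient.mk_eq_zero]
  exact Submodule.subset_span ⟨(τ, KaehlerDifferential.D K R r), by simp [pullback]⟩

/-- For a form `τ` on the base, the derivation `a ↦ τ ∧ da` over `R`. -/
noncomputable def wedgeBarDer (τ : Ω[R⁄K]) : Derivation R A (OmegaBar2 K A R) :=
  Derivation.mk'
    { toFun := wedgeD K A R τ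
      map_add' := map_add _
      map_smul' := fun r a => by
        rw [Algebra.smul_def, wedgeD_mul, wedgeD_algebraMap, smul_zero, add_zero,
          RingHom.id_apply, algebraMap_smul] }
    (wedgeD_mul K A R τ)

/-- For a form `τ` on the base, the map `Ω¹_{A/R} → Ω²_{A/K} / Im (A ⊗ Ω²_{R/K})`, `w ↦ τ ∧ ŵ`,
where `ŵ` is any lift of `w` to `Ω¹_{A/K}`. -/
noncomputable def wedgeBarAux (τ : Ω[R⁄K]) : Ω[A⁄R] →ₗ[A] OmegaBar2 K A R :=
  (wedgeBarDer K A R τ).liftKaehlerDifferential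

theorem wedgeBarAux_map (τ : Ω[R⁄K]) (w : Ω[A⁄K]) :
    wedgeBarAux K A R τ (KaehlerDifferential.map K R A A w) =
      (baseTwoForms K A R).mkQ (wedge A (pullback K A R τ) w) := by
  have h : (wedgeBarAux K A R τ).comp (KaehlerDifferential.map K R A A) =
      (baseTwoForms K A R).mkQ.comp (wedge A (pullback K A R τ)) := by
    apply Derivation.liftKaehlerDifferential_unique
    ext a
    change (wedgeBarDer K A R τ).liftKaehlerDifferential
      (KaehlerDifferential.map K R A A (KaehlerDifferential.D K A a)) = wedgeD K A R τ a
    rw [KaehlerDifferential.map_D, Derivation.liftKaehlerDifferential_comp_D]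
    rfl
  exact LinearMap.congr_fun h w

/-- The pairing `Ω¹_{R/K} × Ω¹_{A/R} → Ω²_{A/K} / Im (A ⊗ Ω²_{R/K})`, `(τ, w) ↦ τ ∧ ŵ`. -/
noncomputable def wedgeBar : Ω[R⁄K] →ₗ[R] Ω[A⁄R] →ₗ[R] OmegaBar2 K A R :=
  LinearMap.mk₂ R (fun τ w => wedgeBarAux K A R τ w)
    (fun τ τ' w => by
      obtain ⟨v, rfl⟩ := KaehlerDifferential.map_surjective K R A w
      simp only [wedgeBarAux_map, map_add, LinearMap.add_apply])
    (fun r τ w => by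
      obtain ⟨v, rfl⟩ := KaehlerDifferential.map_surjective K R A w
      simp only [wedgeBarAux_map]
      rw [map_smul, ← algebraMap_smul A r (pullback K A R τ), map_smul, LinearMap.smul_apply,
        map_smul, algebraMap_smul])
    (fun τ w w' => map_add _ w w')
    (fun r τ w => by
      rw [← algebraMap_smul A r w, map_smul, algebraMap_smul])

end Forms

/-! ## The Čech–de Rham complex of a two-chart cover

`U = Spec A₀ ∪ Spec A₁` is a smooth curve over `Spec R`, with `Spec A₀ ∩ Spec A₁ = Spec B`. -/

section Cech

variable (K R A₀ A₁ B : Type u) [CommRing K] [CommRing R] [CommRing A₀] [CommRing A₁] [CommRing B]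
  [Algebra K R] [Algebra K A₀] [Algebra K A₁] [Algebra K B]
  [Algebra R A₀] [Algebra R A₁] [Algebra R B] [Algebra A₀ B] [Algebra A₁ B]
  [IsScalarTower K R A₀] [IsScalarTower K R A₁] [IsScalarTower K R B]
  [IsScalarTower R A₀ B] [IsScalarTower R A₁ B] [IsScalarTower K A₀ B] [IsScalarTower K A₁ B]

/-- Degree one of the relative total complex, `Č¹(𝒪_U) × Č⁰(Ω¹_{U/S})`. -/
abbrev RelC1 : Type u := B × (Ω[A₀⁄R] × Ω[A₁⁄R])

/-- Degree one of the absolute total complex, `Č¹(𝒪_U) × Č⁰(Ω¹_U)`. -/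
abbrev AbsC1 : Type u := B × (Ω[A₀⁄K] × Ω[A₁⁄K])

/-- Degree two of the absolute total complex modulo two-forms of the base,
`Č¹(Ω¹_U) × Č⁰(Ω²_U / Im f^*Ω²_S)`. -/
abbrev AbsC2 : Type u := Ω[B⁄K] × (OmegaBar2 K A₀ R × OmegaBar2 K A₁ R)

/-- `(s₀, s₁) ↦ (s₀ - s₁) × (ds₀, ds₁)`. -/
noncomputable def relD0 : (A₀ × A₁) →ₗ[R] RelC1 R A₀ A₁ B :=
  ((Algebra.linearMap A₀ B).restrictScalars R ∘ₗ LinearMap.fst R A₀ A₁ -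
      (Algebra.linearMap A₁ B).restrictScalars R ∘ₗ LinearMap.snd R A₀ A₁).prod
    (((KaehlerDifferential.D R A₀).toLinearMap).prodMap (KaehlerDifferential.D R A₁).toLinearMap)

/-- `(α) × (w₀, w₁) ↦ -dα + w₀ - w₁`. -/
noncomputable def relD1 : RelC1 R A₀ A₁ B →ₗ[R] Ω[B⁄R] :=
  LinearMap.coprod (-(KaehlerDifferential.D R B).toLinearMap)
    (LinearMap.coprod ((KaehlerDifferential.map R R A₀ B).restrictScalars R)
      (-(KaehlerDifferential.map R R A₁ B).restrictScalars R))

/-- One-cocycles: `(α) × (w₀, w₁)` with `dα = w₀ - w₁` on the overlap. -/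
noncomputable abbrev RelZ1 : Submodule R (RelC1 R A₀ A₁ B) := LinearMap.ker (relD1 R A₀ A₁ B)

theorem mem_relZ1 {α : B} {w₀ : Ω[A₀⁄R]} {w₁ : Ω[A₁⁄R]}
    (h : KaehlerDifferential.D R B α =
      KaehlerDifferential.map R R A₀ B w₀ - KaehlerDifferential.map R R A₁ B w₁) :
    (α, w₀, w₁) ∈ RelZ1 R A₀ A₁ B := by
  rw [LinearMap.mem_ker]
  simp only [relD1, LinearMap.coprod_apply, LinearMap.neg_apply, LinearMap.coe_restrictScalars]
  change -(KaehlerDifferential.D R B α) + _ = 0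
  rw [h, sub_eq_add_neg]
  exact neg_add_cancel _

/-- The relative de Rham cohomology `H¹_dR(U/S)`: one-cocycles modulo one-coboundaries. -/
abbrev H1dR : Type u :=
  RelZ1 R A₀ A₁ B ⧸ (LinearMap.range (relD0 R A₀ A₁ B)).submoduleOf (RelZ1 R A₀ A₁ B)

/-- The class of a one-cocycle. -/
noncomputable def classOf : RelZ1 R A₀ A₁ B →ₗ[R] H1dR R A₀ A₁ B := Submodule.mkQ _

/-- `(α) × (β₀, β₁) ↦ (-dα + β₀ - β₁) × (dβ₀, dβ₁)` on the absolute complex. -/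
noncomputable def absD1 : AbsC1 K A₀ A₁ B →ₗ[K] AbsC2 K R A₀ A₁ B :=
  (LinearMap.coprod (-(KaehlerDifferential.D K B).toLinearMap)
    (LinearMap.coprod ((KaehlerDifferential.map K K A₀ B).restrictScalars K)
      (-(KaehlerDifferential.map K K A₁ B).restrictScalars K))).prod
    (((dBar K A₀ R).prodMap (dBar K A₁ R)) ∘ₗ LinearMap.snd K B (Ω[A₀⁄K] × Ω[A₁⁄K]))

/-- The projection from absolute to relative one-cochains. -/
noncomputable def absToRel : AbsC1 K A₀ A₁ B →ₗ[R] RelC1 R A₀ A₁ B :=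
  LinearMap.id.prodMap
    (((KaehlerDifferential.map K R A₀ A₀).restrictScalars R).prodMap
      ((KaehlerDifferential.map K R A₁ A₁).restrictScalars R))

/-- The map `Ω¹_S ⊗ C¹(U/S) → C²(U)`, `τ ⊗ (g) × (w₀, w₁) ↦ (-g τ) × (τ ∧ w₀, τ ∧ w₁)`: the
identification of `Ω¹_S ⊗ C^{•-1}(U/S)` with the subcomplex `C^•(f^*Ω¹_S ⊗ Ω^{•-1}_{U/S})`,
including its sign. -/
noncomputable def baseWedge : Ω[R⁄K] ⊗[R] RelC1 R A₀ A₁ B →ₗ[R] AbsC2 K R A₀ A₁ B :=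
  TensorProduct.lift <| LinearMap.mk₂ R
    (fun τ c => (-(c.1 • pullback K B R τ), wedgeBar K A₀ R τ c.2.1, wedgeBar K A₁ R τ c.2.2))
    (fun τ τ' c => by
      simp only [map_add, smul_add, neg_add, LinearMap.add_apply, Prod.mk_add_mk])
    (fun r τ c => by
      simp only [map_smul, LinearMap.smul_apply, Prod.smul_mk, smul_neg]
      rw [smul_comm])
    (fun τ c c' => by
      simp only [Prod.fst_add, Prod.snd_add, map_add, add_smul, neg_add, Prod.mk_add_mk])
    (fun r τ c => by
      simp only [Prod.smul_fst, Prod.smul_snd, map_smul, smul_assoc, Prod.smul_mk, smul_neg])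

/-- `η ∈ Ω¹_S ⊗ H¹_dR(U/S)` is the image of `ξ ∈ H¹_dR(U/S)` under the connecting homomorphism
of `0 → f^*Ω¹_S ⊗ Ω^{•-1}_{U/S} → Ω^•_U / Im (f^*Ω²_S ⊗ Ω^{•-2}_U) → Ω^•_{U/S} → 0`, followed by
`H²(U, f^*Ω¹_S ⊗ Ω^{•-1}_{U/S}) ≅ Ω¹_S ⊗ H¹_dR(U/S)`: some cocycle representing `ξ` has a lift `β`
to the absolute complex whose differential comes from some representative `m` of `η`. (A coboundary
in the subcomplex is the differential of a change of the lift.) -/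
def IsConnectingImage (ξ : H1dR R A₀ A₁ B) (η : Ω[R⁄K] ⊗[R] H1dR R A₀ A₁ B) : Prop :=
  ∃ (c : RelZ1 R A₀ A₁ B) (β : AbsC1 K A₀ A₁ B) (m : Ω[R⁄K] ⊗[R] RelZ1 R A₀ A₁ B),
    classOf R A₀ A₁ B c = ξ ∧ absToRel K R A₀ A₁ B β = (c : RelC1 R A₀ A₁ B) ∧
    (classOf R A₀ A₁ B).lTensor Ω[R⁄K] m = η ∧
    absD1 K R A₀ A₁ B β =
      baseWedge K R A₀ A₁ B ((RelZ1 R A₀ A₁ B).subtype.lTensor Ω[R⁄K] m)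

/-- `∇` is the Gauss–Manin connection: the map whose graph is the connecting relation. -/
def IsGaussManin (nabla : H1dR R A₀ A₁ B →ₗ[K] Ω[R⁄K] ⊗[R] H1dR R A₀ A₁ B) : Prop :=
  ∀ ξ η, IsConnectingImage K R A₀ A₁ B ξ η ↔ nabla ξ = η

end Cech

/-! ## The Weierstrass family `y² = 4x³ - g₂x - g₃` -/

section Weierstrass

variable {R : Type u} [CommRing R] (g₂ g₃ : R)

open Polynomial in
/-- The cubic `4x³ - g₂x - g₃`. -/
noncomputable def cubic : R[X] := 4 * X ^ 3 - C g₂ * X - C g₃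

open Polynomial in
/-- The quartic `z⁴ (4z⁻³ - g₂z⁻¹ - g₃) = 4z - g₂z³ - g₃z⁴`. -/
noncomputable def quartic : R[X] := 4 * X - C g₂ * X ^ 3 - C g₃ * X ^ 4

theorem map_cubic {A : Type u} [CommRing A] (φ : Polynomial R →+* A) :
    φ (cubic g₂ g₃) = 4 * φ Polynomial.X ^ 3 - φ (Polynomial.C g₂) * φ Polynomial.X -
      φ (Polynomial.C g₃) := by
  simp only [cubic, map_sub, map_mul, map_pow, map_ofNat]

theorem map_quartic {A : Type u} [CommRing A] (φ : Polynomial R →+* A) :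
    φ (quartic g₂ g₃) = 4 * φ Polynomial.X - φ (Polynomial.C g₂) * φ Polynomial.X ^ 3 -
      φ (Polynomial.C g₃) * φ Polynomial.X ^ 4 := by
  simp only [quartic, map_sub, map_mul, map_pow, map_ofNat]

open Polynomial in
/-- Coordinate ring of `U₀ : y² = 4x³ - g₂x - g₃`. -/
abbrev Chart0 : Type u := AdjoinRoot (X ^ 2 - C (cubic g₂ g₃) : R[X][X])

open Polynomial in
/-- Coordinate ring of `U_∞ : u² = 4z - g₂z³ - g₃z⁴`. -/
abbrev ChartInf : Type u := AdjoinRoot (X ^ 2 - C (quartic g₂ g₃) : R[X][X])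

/-- The coordinate `x` on `U₀`. -/
noncomputable def x₀ : Chart0 g₂ g₃ := AdjoinRoot.of _ Polynomial.X
/-- The coordinate `y` on `U₀`. -/
noncomputable def y₀ : Chart0 g₂ g₃ := AdjoinRoot.root _
/-- The coordinate `z` on `U_∞`. -/
noncomputable def zInf : ChartInf g₂ g₃ := AdjoinRoot.of _ Polynomial.X
/-- The coordinate `u` on `U_∞`. -/
noncomputable def uInf : ChartInf g₂ g₃ := AdjoinRoot.root _

/-- Coordinate ring of `U₀ ∩ U_∞`, the locus in `U₀` where `x` is invertible. It is also the locus
in `U_∞` where `z` is invertible, through the gluing `z = 1/x`, `u = y/x²` below. -/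
abbrev Overlap : Type u := Localization.Away (x₀ g₂ g₃)

theorem y₀_sq : y₀ g₂ g₃ ^ 2 = 4 * x₀ g₂ g₃ ^ 3 - algebraMap R _ g₂ * x₀ g₂ g₃ -
    algebraMap R _ g₃ := by
  have h := AdjoinRoot.eval₂_root
    (Polynomial.X ^ 2 - Polynomial.C (cubic g₂ g₃) : Polynomial (Polynomial R))
  simp only [Polynomial.eval₂_sub, Polynomial.eval₂_pow, Polynomial.eval₂_X,
    Polynomial.eval₂_C] at h
  exact (sub_eq_zero.mp h).trans (map_cubic g₂ g₃ _)

theorem uInf_sq : uInf g₂ g₃ ^ 2 = 4 * zInf g₂ g₃ - algebraMap R _ g₂ * zInf g₂ g₃ ^ 3 -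
    algebraMap R _ g₃ * zInf g₂ g₃ ^ 4 := by
  have h := AdjoinRoot.eval₂_root
    (Polynomial.X ^ 2 - Polynomial.C (quartic g₂ g₃) : Polynomial (Polynomial R))
  simp only [Polynomial.eval₂_sub, Polynomial.eval₂_pow, Polynomial.eval₂_X,
    Polynomial.eval₂_C] at h
  exact (sub_eq_zero.mp h).trans (map_quartic g₂ g₃ _)

/-- The function `x` on the overlap. -/
noncomputable def xB : Overlap g₂ g₃ := algebraMap (Chart0 g₂ g₃) _ (x₀ g₂ g₃)
/-- The function `y` on the overlap. -/
noncomputable def yB : Overlap g₂ g₃ := algebraMap (Chart0 g₂ g₃) _ (y₀ g₂ g₃)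
/-- The function `x⁻¹` on the overlap. -/
noncomputable def xInvB : Overlap g₂ g₃ := IsLocalization.Away.invSelf (x₀ g₂ g₃)

theorem xB_mul_xInvB : xB g₂ g₃ * xInvB g₂ g₃ = 1 :=
  IsLocalization.Away.mul_invSelf (x₀ g₂ g₃)

theorem yB_sq : yB g₂ g₃ ^ 2 = 4 * xB g₂ g₃ ^ 3 - algebraMap R _ g₂ * xB g₂ g₃ -
    algebraMap R _ g₃ := by
  have h := congrArg (algebraMap (Chart0 g₂ g₃) (Overlap g₂ g₃)) (y₀_sq g₂ g₃)
  simp only [map_sub, map_mul, map_pow, map_ofNat,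
    ← IsScalarTower.algebraMap_apply R (Chart0 g₂ g₃) (Overlap g₂ g₃)] at h
  exact h

/-- The gluing map `z ↦ 1/x`, `u ↦ y/x²`. -/
noncomputable def glue : ChartInf g₂ g₃ →+* Overlap g₂ g₃ :=
  AdjoinRoot.lift (Polynomial.eval₂RingHom (algebraMap R (Overlap g₂ g₃)) (xInvB g₂ g₃))
    (yB g₂ g₃ * xInvB g₂ g₃ ^ 2) (by
      have h₁ := xB_mul_xInvB g₂ g₃
      have h₂ := yB_sq g₂ g₃
      simp only [Polynomial.eval₂_sub, Polynomial.eval₂_pow, Polynomial.eval₂_X,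
        Polynomial.eval₂_C]
      simp only [quartic, map_sub, map_mul, map_pow, map_ofNat, Polynomial.coe_eval₂RingHom,
        Polynomial.eval₂_X, Polynomial.eval₂_C]
      generalize xB g₂ g₃ = x at *
      generalize xInvB g₂ g₃ = v at *
      generalize yB g₂ g₃ = y at *
      linear_combination v ^ 4 * h₂ +
        (4 * v * (x ^ 2 * v ^ 2 + x * v + 1) - algebraMap R (Overlap g₂ g₃) g₂ * v ^ 3) * h₁)

noncomputable instance : Algebra (ChartInf g₂ g₃) (Overlap g₂ g₃) := (glue g₂ g₃).toAlgebra

theorem algebraMap_zInf : algebraMap (ChartInf g₂ g₃) (Overlap g₂ g₃) (zInf g₂ g₃) =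
    xInvB g₂ g₃ := by
  change glue g₂ g₃ (AdjoinRoot.of _ Polynomial.X) = _
  rw [glue, AdjoinRoot.lift_of]
  simp

theorem algebraMap_uInf : algebraMap (ChartInf g₂ g₃) (Overlap g₂ g₃) (uInf g₂ g₃) =
    yB g₂ g₃ * xInvB g₂ g₃ ^ 2 := by
  change glue g₂ g₃ (AdjoinRoot.root _) = _
  rw [glue, AdjoinRoot.lift_root]

theorem glue_algebraMap (r : R) : glue g₂ g₃ (algebraMap R (ChartInf g₂ g₃) r) =
    algebraMap R (Overlap g₂ g₃) r := by
  change glue g₂ g₃ (AdjoinRoot.of _ (Polynomial.C r)) = _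
  rw [glue, AdjoinRoot.lift_of]
  simp

instance : IsScalarTower R (ChartInf g₂ g₃) (Overlap g₂ g₃) :=
  IsScalarTower.of_algebraMap_eq fun r => (glue_algebraMap g₂ g₃ r).symm

instance (K : Type u) [CommRing K] [Algebra K R] :
    IsScalarTower K (ChartInf g₂ g₃) (Overlap g₂ g₃) :=
  IsScalarTower.of_algebraMap_eq fun k => by
    rw [IsScalarTower.algebraMap_apply K R (Overlap g₂ g₃),
      IsScalarTower.algebraMap_apply K R (ChartInf g₂ g₃)]
    exact (glue_algebraMap g₂ g₃ _).symm

/-! ### The forms `dx/y`, `dz/u` and the classes `ω`, `ω*` -/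

/-- The discriminant `g₂³ - 27 g₃²`. -/
def disc : R := g₂ ^ 3 - 27 * g₃ ^ 2

/-- The form `dx/y` on `U₀`, written without denominators in `y` as `A y dx + 2 B dy`, where
`A f + B f' = 1` for `f = 4x³ - g₂x - g₃`. -/
noncomputable def dxOverY : Ω[Chart0 g₂ g₃⁄R] :=
  Ring.inverse (disc g₂ g₃) •
    ((-9 * (2 * algebraMap R _ g₂ * x₀ g₂ g₃ - 3 * algebraMap R _ g₃) * y₀ g₂ g₃) •
        KaehlerDifferential.D R (Chart0 g₂ g₃) (x₀ g₂ g₃) +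
      (2 * (6 * algebraMap R _ g₂ * x₀ g₂ g₃ ^ 2 - 9 * algebraMap R _ g₃ * x₀ g₂ g₃ -
          algebraMap R _ g₂ ^ 2)) •
        KaehlerDifferential.D R (Chart0 g₂ g₃) (y₀ g₂ g₃))

/-- The form `dz/u` on `U_∞`, written without denominators in `u` as `C u dz + 2 D du`, where
`C g + D g' = 1` for `g = 4z - g₂z³ - g₃z⁴`. -/
noncomputable def dzOverU : Ω[ChartInf g₂ g₃⁄R] :=
  Ring.inverse (32 * disc g₂ g₃) •
    (((algebraMap R _ (-2 * g₂ ^ 2 * g₃) +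
          algebraMap R _ (9 * g₂ ^ 4 - 240 * g₂ * g₃ ^ 2) * zInf g₂ g₃ +
          algebraMap R _ (12 * g₂ ^ 3 * g₃ - 288 * g₃ ^ 3) * zInf g₂ g₃ ^ 2) * uInf g₂ g₃) •
        KaehlerDifferential.D R (ChartInf g₂ g₃) (zInf g₂ g₃) +
      (2 * (algebraMap R _ (8 * disc g₂ g₃) + algebraMap R _ (2 * g₂ ^ 2 * g₃) * zInf g₂ g₃ +
          algebraMap R _ (-3 * g₂ ^ 4 + 78 * g₂ * g₃ ^ 2) * zInf g₂ g₃ ^ 2 +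
          algebraMap R _ (-3 * g₂ ^ 3 * g₃ + 72 * g₃ ^ 3) * zInf g₂ g₃ ^ 3)) •
        KaehlerDifferential.D R (ChartInf g₂ g₃) (uInf g₂ g₃))

section Identities

variable {A M : Type u} [CommRing A] [AddCommGroup M] [Module A M]

theorem dxOverY_aux {p q x y δ : A} {X Y w : M} (hδ : δ * (p ^ 3 - 27 * q ^ 2) = 1)
    (hy : y ^ 2 = 4 * x ^ 3 - p * x - q) (hd : (2 * y) • Y = (12 * x ^ 2 - p) • X)
    (hw : w = δ • ((-9 * (2 * p * x - 3 * q) * y) • X +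
      (2 * (6 * p * x ^ 2 - 9 * q * x - p ^ 2)) • Y)) :
    y • w = X ∧ (12 * x ^ 2 - p) • w = (2 : A) • Y := by
  subst hw
  have e : δ * (-9 * (2 * p * x - 3 * q) * y ^ 2 +
      (6 * p * x ^ 2 - 9 * q * x - p ^ 2) * (12 * x ^ 2 - p)) = 1 := by
    linear_combination hδ + δ * (-9 * (2 * p * x - 3 * q)) * hy
  constructor
  · have h : y • δ • ((-9 * (2 * p * x - 3 * q) * y) • X +
        (2 * (6 * p * x ^ 2 - 9 * q * x - p ^ 2)) • Y) =
        (δ * (-9 * (2 * p * x - 3 * q) * y ^ 2 +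
          (6 * p * x ^ 2 - 9 * q * x - p ^ 2) * (12 * x ^ 2 - p))) • X := by
      linear_combination (norm := module) (δ * (6 * p * x ^ 2 - 9 * q * x - p ^ 2)) • hd
    rw [h, e, one_smul]
  · have h : (12 * x ^ 2 - p) • δ • ((-9 * (2 * p * x - 3 * q) * y) • X +
        (2 * (6 * p * x ^ 2 - 9 * q * x - p ^ 2)) • Y) =
        (δ * (-9 * (2 * p * x - 3 * q) * y ^ 2 +
          (6 * p * x ^ 2 - 9 * q * x - p ^ 2) * (12 * x ^ 2 - p))) • (2 : A) • Y := by
      linear_combination (norm := module) (-δ * (-9 * (2 * p * x - 3 * q) * y)) • hd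
    rw [h, e, one_smul]

theorem dzOverU_aux {p q z u δ : A} {Z V w : M} (hδ : δ * (32 * (p ^ 3 - 27 * q ^ 2)) = 1)
    (hu : u ^ 2 = 4 * z - p * z ^ 3 - q * z ^ 4)
    (hd : (2 * u) • V = (4 - 3 * p * z ^ 2 - 4 * q * z ^ 3) • Z)
    (hw : w = δ • (((-2 * p ^ 2 * q + (9 * p ^ 4 - 240 * p * q ^ 2) * z +
        (12 * p ^ 3 * q - 288 * q ^ 3) * z ^ 2) * u) • Z +
      (2 * (8 * (p ^ 3 - 27 * q ^ 2) + 2 * p ^ 2 * q * z + (-3 * p ^ 4 + 78 * p * q ^ 2) * z ^ 2 +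
        (-3 * p ^ 3 * q + 72 * q ^ 3) * z ^ 3)) • V)) :
    u • w = Z ∧ (4 - 3 * p * z ^ 2 - 4 * q * z ^ 3) • w = (2 : A) • V := by
  obtain ⟨c, hc⟩ : ∃ c, c = -2 * p ^ 2 * q + (9 * p ^ 4 - 240 * p * q ^ 2) * z +
        (12 * p ^ 3 * q - 288 * q ^ 3) * z ^ 2 := ⟨_, rfl⟩
  obtain ⟨d, hd'⟩ : ∃ d, d = 8 * (p ^ 3 - 27 * q ^ 2) + 2 * p ^ 2 * q * z +
      (-3 * p ^ 4 + 78 * p * q ^ 2) * z ^ 2 + (-3 * p ^ 3 * q + 72 * q ^ 3) * z ^ 3 := ⟨_, rfl⟩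
  rw [← hc, ← hd'] at hw
  have e : δ * (c * u ^ 2 + d * (4 - 3 * p * z ^ 2 - 4 * q * z ^ 3)) = 1 := by
    rw [hc, hd', ← hδ, hu]; ring
  clear hc hd'
  subst hw
  constructor
  · have h : u • δ • ((c * u) • Z + (2 * d) • V) =
        (δ * (c * u ^ 2 + d * (4 - 3 * p * z ^ 2 - 4 * q * z ^ 3))) • Z := by
      linear_combination (norm := module) (δ * d) • hd
    rw [h, e, one_smul]
  · have h : (4 - 3 * p * z ^ 2 - 4 * q * z ^ 3) • δ • ((c * u) • Z + (2 * d) • V) =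
        (δ * (c * u ^ 2 + d * (4 - 3 * p * z ^ 2 - 4 * q * z ^ 3))) • (2 : A) • V := by
      linear_combination (norm := module) (-δ * c * u) • hd
    rw [h, e, one_smul]

/-- Comparison of `dx/y` and `dz/u` where `z = 1/x = v`, `u = y/x²`. -/
theorem forms_agree_aux {p q x y v δ : A} {X Y w w' : M} (hδ : δ * (p ^ 3 - 27 * q ^ 2) = 1)
    (hv : x * v = 1) (hy : y ^ 2 = 4 * x ^ 3 - p * x - q)
    (h₁ : y • w = X) (h₂ : (12 * x ^ 2 - p) • w = (2 : A) • Y)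
    (h₃ : (y * v ^ 2) • w' = -(v ^ 2 • X))
    (h₄ : (4 - 3 * p * v ^ 2 - 4 * q * v ^ 3) • w' =
      (2 : A) • (v ^ 2 • Y - (2 * y * v ^ 3) • X)) : w + w' = 0 := by
  have k : ∀ m : M, m = x ^ 2 • v ^ 2 • m := fun m => by
    rw [smul_smul, ← mul_pow, hv, one_pow, one_smul]
  have h₅ : y • (w + w') = 0 := by
    have : y • w' = -X := by
      rw [k (y • w'), k X, ← smul_neg, ← h₃]; module
    rw [smul_add, h₁, this, add_neg_cancel]
  have e : 4 - 3 * p * v ^ 2 - 4 * q * v ^ 3 = v ^ 2 * (4 * v * y ^ 2 - (12 * x ^ 2 - p)) := by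
    rw [hy]
    linear_combination (-4 - 4 * x * v + 4 * p * v ^ 2 - 16 * (x ^ 2 * v ^ 2 + x * v + 1) +
      12 * (x * v + 1) + 4 + 4 * x * v) * hv
  have h₆ : (12 * x ^ 2 - p) • (w + w') = 0 := by
    have : (12 * x ^ 2 - p) • w' = -(2 : A) • Y := by
      have h : (12 * x ^ 2 - p) • w' + (2 : A) • Y = x ^ 2 • (v ^ 2 * (12 * x ^ 2 - p)) • w' +
          x ^ 2 • v ^ 2 • (2 : A) • Y := by
        rw [mul_smul, ← k, ← k]
      have h' : (v ^ 2 * (12 * x ^ 2 - p)) • w' + v ^ 2 • (2 : A) • Y = 0 := by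
        rw [e] at h₄
        have h₇ : y • w' = -y • w := by rw [neg_smul, eq_neg_iff_add_eq_zero, ← smul_add, add_comm,
          h₅]
        linear_combination (norm := module) -h₄ + (4 * v ^ 3 * y) • h₇ - (4 * v ^ 3 * y) • h₁
      rw [neg_smul, eq_neg_iff_add_eq_zero, h, ← smul_add, h', smul_zero]
    rw [smul_add, h₂, this, ← add_smul, add_neg_cancel, zero_smul]
  have e' : δ * (-9 * (2 * p * x - 3 * q) * y ^ 2 +
      (6 * p * x ^ 2 - 9 * q * x - p ^ 2) * (12 * x ^ 2 - p)) = 1 := by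
    linear_combination hδ + δ * (-9 * (2 * p * x - 3 * q)) * hy
  calc w + w' = (δ * (-9 * (2 * p * x - 3 * q) * y ^ 2 +
      (6 * p * x ^ 2 - 9 * q * x - p ^ 2) * (12 * x ^ 2 - p))) • (w + w') := by
        rw [e', one_smul]
    _ = (δ * (-9 * (2 * p * x - 3 * q) * y)) • y • (w + w') +
        (δ * (6 * p * x ^ 2 - 9 * q * x - p ^ 2)) • (12 * x ^ 2 - p) • (w + w') := by module
    _ = 0 := by rw [h₅, h₆, smul_zero, smul_zero, add_zero]

end Identities

variable {g₂ g₃}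

theorem inverse_disc (hΔ : IsUnit (disc g₂ g₃)) (A : Type u) [CommRing A] [Algebra R A] :
    algebraMap R A (Ring.inverse (disc g₂ g₃)) *
      (algebraMap R A g₂ ^ 3 - 27 * algebraMap R A g₃ ^ 2) = 1 := by
  have h := congrArg (algebraMap R A) (Ring.inverse_mul_cancel _ hΔ)
  simpa only [disc, map_mul, map_sub, map_pow, map_ofNat, map_one] using h

theorem two_y_dy : (2 * y₀ g₂ g₃) • KaehlerDifferential.D R (Chart0 g₂ g₃) (y₀ g₂ g₃) =
    (12 * x₀ g₂ g₃ ^ 2 - algebraMap R _ g₂) •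
      KaehlerDifferential.D R (Chart0 g₂ g₃) (x₀ g₂ g₃) := by
  have h := congrArg (KaehlerDifferential.D R (Chart0 g₂ g₃)) (y₀_sq g₂ g₃)
  generalize x₀ g₂ g₃ = x at *
  generalize y₀ g₂ g₃ = y at *
  have h4 : KaehlerDifferential.D R (Chart0 g₂ g₃) 4 = 0 := by
    rw [← map_ofNat (algebraMap R (Chart0 g₂ g₃)) 4]
    exact Derivation.map_algebraMap _ _
  simp only [map_sub, Derivation.leibniz, Derivation.leibniz_pow, Derivation.map_algebraMap, h4,
    smul_zero, add_zero, sub_zero] at h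
  simp only [Nat.add_one_sub_one, pow_one] at h
  linear_combination (norm := module) h

theorem two_u_du : (2 * uInf g₂ g₃) • KaehlerDifferential.D R (ChartInf g₂ g₃) (uInf g₂ g₃) =
    (4 - 3 * algebraMap R _ g₂ * zInf g₂ g₃ ^ 2 - 4 * algebraMap R _ g₃ * zInf g₂ g₃ ^ 3) •
      KaehlerDifferential.D R (ChartInf g₂ g₃) (zInf g₂ g₃) := by
  have h := congrArg (KaehlerDifferential.D R (ChartInf g₂ g₃)) (uInf_sq g₂ g₃)
  generalize zInf g₂ g₃ = z at *
  generalize uInf g₂ g₃ = u at *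
  have h4 : KaehlerDifferential.D R (ChartInf g₂ g₃) 4 = 0 := by
    rw [← map_ofNat (algebraMap R (ChartInf g₂ g₃)) 4]
    exact Derivation.map_algebraMap _ _
  simp only [map_sub, Derivation.leibniz, Derivation.leibniz_pow, Derivation.map_algebraMap, h4,
    smul_zero, add_zero] at h
  simp only [Nat.add_one_sub_one, pow_one] at h
  linear_combination (norm := module) h

/-- `dx/y` is characterized by `y (dx/y) = dx` and `(12x² - g₂) (dx/y) = 2 dy`. -/
theorem dxOverY_spec (hΔ : IsUnit (disc g₂ g₃)) :
    y₀ g₂ g₃ • dxOverY g₂ g₃ = KaehlerDifferential.D R _ (x₀ g₂ g₃) ∧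
    (12 * x₀ g₂ g₃ ^ 2 - algebraMap R _ g₂) • dxOverY g₂ g₃ =
      (2 : Chart0 g₂ g₃) • KaehlerDifferential.D R _ (y₀ g₂ g₃) :=
  dxOverY_aux (inverse_disc hΔ _) (y₀_sq g₂ g₃) two_y_dy
    (by rw [dxOverY, ← algebraMap_smul (Chart0 g₂ g₃) (Ring.inverse (disc g₂ g₃))])

/-- `dz/u` is characterized by `u (dz/u) = dz` and `(4 - 3g₂z² - 4g₃z³) (dz/u) = 2 du`. -/
theorem dzOverU_spec (hΔ : IsUnit (32 * disc g₂ g₃)) :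
    uInf g₂ g₃ • dzOverU g₂ g₃ = KaehlerDifferential.D R _ (zInf g₂ g₃) ∧
    (4 - 3 * algebraMap R _ g₂ * zInf g₂ g₃ ^ 2 - 4 * algebraMap R _ g₃ * zInf g₂ g₃ ^ 3) •
        dzOverU g₂ g₃ =
      (2 : ChartInf g₂ g₃) • KaehlerDifferential.D R _ (uInf g₂ g₃) :=
  dzOverU_aux (δ := algebraMap R _ (Ring.inverse (32 * disc g₂ g₃)))
    (by
      have h := congrArg (algebraMap R (ChartInf g₂ g₃)) (Ring.inverse_mul_cancel _ hΔ)
      simpa only [disc, map_mul, map_sub, map_pow, map_ofNat, map_one] using h)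
    (uInf_sq g₂ g₃) two_u_du
    (by
      rw [dzOverU, ← algebraMap_smul (ChartInf g₂ g₃) (Ring.inverse (32 * disc g₂ g₃))]
      simp only [disc, map_mul, map_add, map_sub, map_neg, map_pow, map_ofNat])

section Overlap

/- Two charts with coordinates `x`, `y` and `z`, `u`, and the gluing `z = v = 1/x`, `u = y/x²`. -/
variable {A₀ A₁ B : Type u} [CommRing A₀] [CommRing A₁] [CommRing B] [Algebra R A₀] [Algebra R A₁]
  [Algebra R B] [Algebra A₀ B] [Algebra A₁ B] [IsScalarTower R A₀ B] [IsScalarTower R A₁ B]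

theorem dx_inv {x v : B} (h₁ : x * v = 1) :
    KaehlerDifferential.D R B v = -(v ^ 2 • KaehlerDifferential.D R B x) := by
  have h := congrArg (KaehlerDifferential.D R B) h₁
  rw [Derivation.leibniz, Derivation.map_one_eq_zero] at h
  have e : KaehlerDifferential.D R B v = (x * v) • KaehlerDifferential.D R B v := by
    rw [h₁, one_smul]
  rw [e]
  linear_combination (norm := module) v • h

theorem forms_agree_of {δ : B} {x y : A₀} {z u : A₁} {v : B} {w : Ω[A₀⁄R]} {w' : Ω[A₁⁄R]}
    (hδ : δ * (algebraMap R B g₂ ^ 3 - 27 * algebraMap R B g₃ ^ 2) = 1)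
    (hv : algebraMap A₀ B x * v = 1) (hz : algebraMap A₁ B z = v)
    (hu : algebraMap A₁ B u = algebraMap A₀ B y * v ^ 2)
    (hy : algebraMap A₀ B y ^ 2 = 4 * algebraMap A₀ B x ^ 3 -
      algebraMap R B g₂ * algebraMap A₀ B x - algebraMap R B g₃)
    (a₁ : y • w = KaehlerDifferential.D R A₀ x)
    (a₂ : (12 * x ^ 2 - algebraMap R A₀ g₂) • w = (2 : A₀) • KaehlerDifferential.D R A₀ y)
    (a₃ : u • w' = KaehlerDifferential.D R A₁ z)
    (a₄ : (4 - 3 * algebraMap R A₁ g₂ * z ^ 2 - 4 * algebraMap R A₁ g₃ * z ^ 3) • w' =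
      (2 : A₁) • KaehlerDifferential.D R A₁ u) :
    KaehlerDifferential.map R R A₀ B w + KaehlerDifferential.map R R A₁ B w' = 0 := by
  replace a₁ := congrArg (KaehlerDifferential.map R R A₀ B) a₁
  replace a₂ := congrArg (KaehlerDifferential.map R R A₀ B) a₂
  replace a₃ := congrArg (KaehlerDifferential.map R R A₁ B) a₃
  replace a₄ := congrArg (KaehlerDifferential.map R R A₁ B) a₄
  rw [map_smul, KaehlerDifferential.map_D, ← algebraMap_smul B y] at a₁
  rw [map_smul, map_smul, KaehlerDifferential.map_D,
    ← algebraMap_smul B (12 * x ^ 2 - algebraMap R _ g₂), ← algebraMap_smul B (2 : A₀)] at a₂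
  rw [map_smul, KaehlerDifferential.map_D, ← algebraMap_smul B u, hu, hz, dx_inv hv] at a₃
  rw [map_smul, map_smul, KaehlerDifferential.map_D,
    ← algebraMap_smul B (4 - 3 * algebraMap R A₁ g₂ * z ^ 2 - 4 * algebraMap R A₁ g₃ * z ^ 3),
    ← algebraMap_smul B (2 : A₁), hu] at a₄
  simp only [map_sub, map_mul, map_pow, map_ofNat, hz,
    ← IsScalarTower.algebraMap_apply R A₀ B,
    ← IsScalarTower.algebraMap_apply R A₁ B] at a₂ a₄
  refine forms_agree_aux hδ hv hy a₁ a₂ a₃ (a₄.trans ?_)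
  rw [Derivation.leibniz, Derivation.leibniz_pow, dx_inv hv]
  simp only [Nat.add_one_sub_one, pow_one, ← Nat.cast_smul_eq_nsmul B]
  module

theorem d_y_over_x_of {c : R} {x y : A₀} {z : A₁} {v : B} {w : Ω[A₀⁄R]} {w' : Ω[A₁⁄R]}
    (hc : c * 2 = 1) (hv : algebraMap A₀ B x * v = 1) (hz : algebraMap A₁ B z = v)
    (hy : algebraMap A₀ B y ^ 2 = 4 * algebraMap A₀ B x ^ 3 -
      algebraMap R B g₂ * algebraMap A₀ B x - algebraMap R B g₃)
    (a₁ : y • w = KaehlerDifferential.D R A₀ x)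
    (a₂ : (12 * x ^ 2 - algebraMap R A₀ g₂) • w = (2 : A₀) • KaehlerDifferential.D R A₀ y)
    (a₃ : KaehlerDifferential.map R R A₀ B w + KaehlerDifferential.map R R A₁ B w' = 0) :
    KaehlerDifferential.D R B (algebraMap A₀ B y * v) =
      KaehlerDifferential.map R R A₀ B ((2 * x) • w) -
      KaehlerDifferential.map R R A₁ B
        (c • (algebraMap R A₁ g₂ * z + 2 * algebraMap R A₁ g₃ * z ^ 2) • w') := by
  replace a₁ := congrArg (KaehlerDifferential.map R R A₀ B) a₁
  replace a₂ := congrArg (KaehlerDifferential.map R R A₀ B) a₂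
  rw [map_smul, KaehlerDifferential.map_D, ← algebraMap_smul B y] at a₁
  rw [map_smul, map_smul, KaehlerDifferential.map_D,
    ← algebraMap_smul B (12 * x ^ 2 - algebraMap R _ g₂), ← algebraMap_smul B (2 : A₀)] at a₂
  have e : algebraMap R B c * 2 = 1 := by
    have h := congrArg (algebraMap R B) hc
    simpa only [map_mul, map_ofNat, map_one] using h
  rw [map_smul, ← algebraMap_smul A₁ c, map_smul, map_smul,
    ← algebraMap_smul B (2 * x), ← algebraMap_smul B (algebraMap R A₁ c),
    ← algebraMap_smul B (algebraMap R A₁ g₂ * z + 2 * algebraMap R A₁ g₃ * z ^ 2),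
    Derivation.leibniz, dx_inv hv]
  simp only [map_sub, map_add, map_mul, map_pow, map_ofNat, hz,
    ← IsScalarTower.algebraMap_apply R A₀ B,
    ← IsScalarTower.algebraMap_apply R A₁ B] at a₂ ⊢
  generalize KaehlerDifferential.map R R A₀ B w = W at *
  generalize KaehlerDifferential.map R R A₁ B w' = W' at *
  generalize KaehlerDifferential.D R B (algebraMap A₀ B x) = X at *
  generalize KaehlerDifferential.D R B (algebraMap A₀ B y) = Y at *
  generalize algebraMap A₀ B x = x at *
  generalize algebraMap A₀ B y = y at *
  generalize algebraMap R B c = c at *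
  generalize algebraMap R B g₂ = p at *
  generalize algebraMap R B g₃ = q at *
  obtain rfl : W' = -W := (neg_eq_of_add_eq_zero_right a₃).symm
  have hY : Y = (c * (12 * x ^ 2 - p)) • W := by
    rw [mul_smul, a₂, smul_smul, e, one_smul]
  have key : -(y ^ 2 * v ^ 2) + v * (c * (12 * x ^ 2 - p)) =
      2 * x + c * (p * v + 2 * q * v ^ 2) := by
    rw [hy]
    linear_combination (6 * x ^ 2 * v - p * v - q * v ^ 2) * e +
      (6 * x - 4 * x * (x * v + 1) + p * v) * hv
  rw [hY, ← a₁]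
  linear_combination (norm := module) congrArg (· • W) key

end Overlap

/-- `dx/y + dz/u = 0` on the overlap. -/
theorem forms_agree (h2 : IsUnit (2 : R)) (hΔ : IsUnit (disc g₂ g₃)) :
    KaehlerDifferential.map R R (Chart0 g₂ g₃) (Overlap g₂ g₃) (dxOverY g₂ g₃) +
      KaehlerDifferential.map R R (ChartInf g₂ g₃) (Overlap g₂ g₃) (dzOverU g₂ g₃) = 0 := by
  have h32 : IsUnit (32 * disc g₂ g₃) := by
    have : (32 : R) = 2 ^ 5 := by norm_num
    rw [this]; exact (h2.pow 5).mul hΔ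
  exact forms_agree_of (inverse_disc hΔ (Overlap g₂ g₃)) (xB_mul_xInvB g₂ g₃)
    (algebraMap_zInf g₂ g₃) (algebraMap_uInf g₂ g₃) (yB_sq g₂ g₃)
    (dxOverY_spec hΔ).1 (dxOverY_spec hΔ).2 (dzOverU_spec h32).1 (dzOverU_spec h32).2

/-- `d(y/x) = 2x dx/y - ½(g₂z + 2g₃z²) dz/u` on the overlap. -/
theorem d_y_over_x (h2 : IsUnit (2 : R)) (hΔ : IsUnit (disc g₂ g₃)) :
    KaehlerDifferential.D R (Overlap g₂ g₃) (yB g₂ g₃ * xInvB g₂ g₃) =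
      KaehlerDifferential.map R R (Chart0 g₂ g₃) (Overlap g₂ g₃)
        ((2 * x₀ g₂ g₃) • dxOverY g₂ g₃) -
      KaehlerDifferential.map R R (ChartInf g₂ g₃) (Overlap g₂ g₃)
        (Ring.inverse (2 : R) •
          (algebraMap R _ g₂ * zInf g₂ g₃ + 2 * algebraMap R _ g₃ * zInf g₂ g₃ ^ 2) •
            dzOverU g₂ g₃) :=
  d_y_over_x_of (Ring.inverse_mul_cancel _ h2) (xB_mul_xInvB g₂ g₃) (algebraMap_zInf g₂ g₃)
    (yB_sq g₂ g₃) (dxOverY_spec hΔ).1 (dxOverY_spec hΔ).2 (forms_agree h2 hΔ)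

/-- `H¹_dR(U/S)` of the family `U → S = Spec R` glued from `U₀` and `U_∞`. -/
abbrev WH1 (g₂ g₃ : R) : Type u := H1dR R (Chart0 g₂ g₃) (ChartInf g₂ g₃) (Overlap g₂ g₃)

/-- The class `ω` of `(0) × (dx/y, -dz/u)`. -/
noncomputable def omega (h2 : IsUnit (2 : R)) (hΔ : IsUnit (disc g₂ g₃)) : WH1 g₂ g₃ :=
  classOf R (Chart0 g₂ g₃) (ChartInf g₂ g₃) (Overlap g₂ g₃)
    ⟨(0, dxOverY g₂ g₃, -dzOverU g₂ g₃), mem_relZ1 _ _ _ _ (by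
      rw [map_neg, sub_neg_eq_add, forms_agree h2 hΔ, map_zero])⟩

/-- The class `ω*` of `(y/x) × (2x dx/y, ½(g₂z + 2g₃z²) dz/u)`. -/
noncomputable def omegaStar (h2 : IsUnit (2 : R)) (hΔ : IsUnit (disc g₂ g₃)) : WH1 g₂ g₃ :=
  classOf R (Chart0 g₂ g₃) (ChartInf g₂ g₃) (Overlap g₂ g₃)
    ⟨(yB g₂ g₃ * xInvB g₂ g₃, (2 * x₀ g₂ g₃) • dxOverY g₂ g₃,
      Ring.inverse (2 : R) •
        (algebraMap R _ g₂ * zInf g₂ g₃ + 2 * algebraMap R _ g₃ * zInf g₂ g₃ ^ 2) •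
          dzOverU g₂ g₃), mem_relZ1 _ _ _ _ (d_y_over_x h2 hΔ)⟩

theorem isUnit_two (K R : Type u) [Field K] [CharZero K] [CommRing R] [Algebra K R] :
    IsUnit (2 : R) := by
  have h : IsUnit (2 : K) := isUnit_iff_ne_zero.mpr two_ne_zero
  rw [← map_ofNat (algebraMap K R) 2]
  exact h.map _

/-- If `dt` is a basis of `Ω¹_{R/K}`, the element `f' ∈ R` with `df = f' dt`. -/
noncomputable def derivAlong {K R : Type u} [CommRing K] [CommRing R] [Algebra K R]
    (dt : Module.Basis Unit R Ω[R⁄K]) (f : R) : R :=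
  dt.repr (KaehlerDifferential.D K R f) ()

theorem D_eq_derivAlong {K R : Type u} [CommRing K] [CommRing R] [Algebra K R]
    (dt : Module.Basis Unit R Ω[R⁄K]) (f : R) :
    KaehlerDifferential.D K R f = derivAlong dt f • dt () := by
  simpa [derivAlong] using (dt.sum_repr (KaehlerDifferential.D K R f)).symm

end Weierstrass

end EllipticGM

/-!
Let `τ = dt` and let `δ = d/dt` be the dual derivation of the base.

*The relative forms and their lifts.* On a plane curve `y² = P(x)` over `R` with `a P + b P' = 1`,
the form `y a dx + 2 b dy` (`curveForm`) makes sense both relatively, where it is `dx/y`, and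
absolutely, where it is a lift `θ` of `dx/y`. It satisfies `y θ = dx + b (δP) τ` and
`P' θ = 2 dy - a (δP) y τ`, where `δP` is `P` with `δ` applied to its coefficients. Differentiating
both relations gives `dθ = κ τ ∧ θ` with an explicit polynomial `κ` in `x` (`dBar_curveForm`). The
derivations of the coordinate ring dual to `θ` and to `τ` (`exists_vertical_derivation`,
`exists_horizontal_derivation`) show that `dx/y` is a basis of the relative forms and that `τ ∧ ·`
is injective on them (`eq_zero_of_smul_wedgeBar_eq_zero`).

*The connection exists.* Because of this injectivity, the connecting relation relates `0` only to
`0` (`IsConnectingImage.eq_zero`). It is additive and satisfies the Leibniz rule, hence it is the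
graph of a connection as soon as it is defined on generators (`exists_isGaussManin`).

*The basis.* Functions on the overlap are `p + q y` with Laurent polynomials `p`, `q` in `x`.
Splitting these into powers that are regular on one of the two charts leaves exactly the line of
`y/x` (`exists_eq_sub_add_smul`, `eq_zero_and_exists_algebraMap_eq`). So `ω*` generates the part of
`H¹_dR` coming from `H¹(U, 𝒪_U)` and `ω` generates the global relative one-forms
(`span_omega_omegaStar`, `linearIndependent_omega_omegaStar`).

*The matrix.* The cocycles of `ω` and `ω*` lift through the two forms `θ₀`, `θ_∞`. On the overlap
`θ₀ + θ_∞` is an explicit multiple of `τ` (`curveForm_add_curveForm`), and the differentials on the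
charts are known from `κ`. Subtracting the coboundary of a suitable pair `(σ₀(x) y, σ_∞(z) u)`
reduces the differential of the lift to `τ ∧` a combination of `ω*` and `ω`; each of the three
components becomes a polynomial identity (`isConnectingImage_of_identities`,
`isConnectingImage_omega`, `isConnectingImage_omegaStar`).
-/

namespace EllipticGM

open KaehlerDifferential (D)

/-! ### Two-forms modulo two-forms of the base -/

section TwoForms

variable (K R A : Type u) [CommRing K] [CommRing R] [CommRing A] [Algebra K R] [Algebra K A]
  [Algebra R A] [IsScalarTower K R A]

/-- The wedge product of one-forms on `A`, read in `Ω²_{A/K}` modulo two-forms of the base. -/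
noncomputable def wedgeQ : Ω[A⁄K] →ₗ[A] Ω[A⁄K] →ₗ[A] OmegaBar2 K A R :=
  (wedge A).compr₂ (baseTwoForms K A R).mkQ

variable {A}

theorem wedgeQ_self (v : Ω[A⁄K]) : wedgeQ K R A v v = 0 := by
  simp [wedgeQ, wedge_self]

theorem wedgeQ_swap (v w : Ω[A⁄K]) : wedgeQ K R A v w = -wedgeQ K R A w v := by
  simp only [wedgeQ, LinearMap.compr₂_apply]
  rw [wedge_swap, map_neg]

theorem wedgeQ_pullback (τ τ' : Ω[R⁄K]) :
    wedgeQ K R A (pullback K A R τ) (pullback K A R τ') = 0 := by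
  simp only [wedgeQ, LinearMap.compr₂_apply]
  rw [Submodule.mkQ_apply, Submodule.Quotient.mk_eq_zero]
  exact Submodule.subset_span ⟨(τ, τ'), rfl⟩

theorem wedgeBar_map (τ : Ω[R⁄K]) (w : Ω[A⁄K]) :
    wedgeBar K A R τ (KaehlerDifferential.map K R A A w) =
      wedgeQ K R A (pullback K A R τ) w :=
  wedgeBarAux_map K A R τ w

theorem wedgeBar_smul (τ : Ω[R⁄K]) (a : A) (w : Ω[A⁄R]) :
    wedgeBar K A R τ (a • w) = a • wedgeBar K A R τ w :=
  map_smul (wedgeBarAux K A R τ) a w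

theorem extDeriv_smul (f : A) (w : Ω[A⁄K]) :
    extDeriv K A (f • w) = wedge A (D K A f) w + f • extDeriv K A w := by
  obtain ⟨x, rfl⟩ := formalSum_surjective K A w
  induction x using Finsupp.induction_linear with
  | zero => simp
  | add x y hx hy => simp only [map_add, smul_add, hx, hy]; abel
  | single b a =>
    have e : formalSum K A (Finsupp.single b a) = a • D K A b := by simp [formalSum]
    rw [e, smul_smul, extDeriv_smul_D, extDeriv_smul_D, Derivation.leibniz]
    simp only [map_add, map_smul, LinearMap.add_apply, LinearMap.smul_apply]
    abel

theorem dBar_smul (f : A) (w : Ω[A⁄K]) :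
    dBar K A R (f • w) = wedgeQ K R A (D K A f) w + f • dBar K A R w := by
  simp [dBar, wedgeQ, extDeriv_smul]

theorem dBar_D (a : A) : dBar K A R (D K A a) = 0 := by
  have h := extDeriv_smul_D K A 1 a
  simp only [one_smul, Derivation.map_one_eq_zero, map_zero, LinearMap.zero_apply] at h
  simp [dBar, h]

theorem dBar_pullback (τ : Ω[R⁄K]) : dBar K A R (pullback K A R τ) = 0 := by
  obtain ⟨x, rfl⟩ := formalSum_surjective K R τ
  induction x using Finsupp.induction_linear with
  | zero => simp
  | add x y hx hy => rw [map_add, map_add, map_add, hx, hy, add_zero]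
  | single b a =>
    have e : formalSum K R (Finsupp.single b a) = a • D K R b := by simp [formalSum]
    have e' : pullback K A R (D K R a) = D K A (algebraMap R A a) :=
      KaehlerDifferential.map_D _ _ _ _ _
    rw [e, map_smul, ← algebraMap_smul A a, dBar_smul, ← e', wedgeQ_pullback, zero_add,
      KaehlerDifferential.map_D, dBar_D, smul_zero]

/-- The kernel of `Ω¹_{A/K} → Ω¹_{A/R}` when `Ω¹_{R/K}` is generated by `τ`. -/
theorem exists_eq_smul_of_map_eq_zero {τ : Ω[R⁄K]} (hτ : ∀ σ : Ω[R⁄K], ∃ r : R, σ = r • τ)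
    {w : Ω[A⁄K]} (hw : KaehlerDifferential.map K R A A w = 0) :
    ∃ a : A, w = a • pullback K A R τ := by
  obtain ⟨t, rfl⟩ := (KaehlerDifferential.exact_mapBaseChange_map K R A w).mp hw
  induction t with
  | zero => exact ⟨0, by simp⟩
  | add s t hs ht =>
    rw [map_add] at hw
    have key : ∀ t, KaehlerDifferential.map K R A A
        (KaehlerDifferential.mapBaseChange K R A t) = 0 := fun t =>
      (KaehlerDifferential.exact_mapBaseChange_map K R A _).mpr ⟨t, rfl⟩
    obtain ⟨a, ha⟩ := hs (key s)
    obtain ⟨b, hb⟩ := ht (key t)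
    exact ⟨a + b, by rw [map_add, ha, hb, add_smul]⟩
  | tmul a σ =>
    obtain ⟨r, rfl⟩ := hτ σ
    refine ⟨a * algebraMap R A r, ?_⟩
    rw [KaehlerDifferential.mapBaseChange_tmul, mul_smul, algebraMap_smul, map_smul]

/-- `τ ∧ ·` is injective on a rank-one module of relative forms `A w` as soon as there are
derivations `∂ₜ`, `∂` of `A` dual to `τ`, `w`: the determinant `∂ₜ ∧ ∂` is then a linear form on
two-forms that kills two-forms of the base. -/
theorem eq_zero_of_smul_wedgeBar_eq_zero {τ : Ω[R⁄K]} (dT : Derivation K A A)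
    (dX : Derivation R A A) {w : Ω[A⁄R]} (hτ : dT.liftKaehlerDifferential (pullback K A R τ) = 1)
    (hw : dX.liftKaehlerDifferential w = 1) {a : A} (h : wedgeBar K A R τ (a • w) = 0) :
    a = 0 := by
  obtain ⟨v, hv⟩ := KaehlerDifferential.map_surjective K R A (a • w)
  let f : Ω[A⁄K] →ₗ[A] A := dT.liftKaehlerDifferential
  let g : Ω[A⁄K] →ₗ[A] A := dX.liftKaehlerDifferential ∘ₗ KaehlerDifferential.map K R A A
  have hg : ∀ σ : Ω[R⁄K], g (pullback K A R σ) = 0 := by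
    intro σ
    have : KaehlerDifferential.map K R A A (pullback K A R σ) = 0 :=
      (KaehlerDifferential.exact_mapBaseChange_map K R A _).mpr ⟨1 ⊗ₜ σ, by simp⟩
    simp [g, this]
  let det : Ω[A⁄K] [⋀^Fin 2]→ₗ[A] A :=
    { toFun := fun m => f (m 0) * g (m 1) - g (m 0) * f (m 1)
      map_update_add' := by
        intro _ m i x y
        fin_cases i <;> simp [Function.update] <;> ring
      map_update_smul' := by
        intro _ m i c x
        fin_cases i <;> simp [Function.update] <;> ring
      map_eq_zero_of_eq' := by
        intro m i j h hij
        fin_cases i <;> fin_cases j <;> simp at hij h ⊢ <;> rw [h] <;> ring }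
  let vol := exteriorPower.alternatingMapLinearEquiv det
  have hvol : ∀ m n, vol (wedge A m n) = f m * g n - g m * f n := fun m n => by
    simp only [vol, wedge, LinearMap.mk₂_apply,
      exteriorPower.alternatingMapLinearEquiv_apply_ιMulti]
    rfl
  have hbase : baseTwoForms K A R ≤ LinearMap.ker vol := by
    rw [baseTwoForms, Submodule.span_le]
    rintro _ ⟨⟨σ, σ'⟩, rfl⟩
    simp [hvol, hg]
  rw [← hv, wedgeBar_map] at h
  have h' : wedge A (pullback K A R τ) v ∈ baseTwoForms K A R := by
    simpa [wedgeQ, Submodule.Quotient.mk_eq_zero] using h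
  have h₂ : vol (wedge A (pullback K A R τ) v) = 0 := hbase h'
  rw [hvol, hg, zero_mul, sub_zero] at h₂
  have e : f (pullback K A R τ) = 1 := hτ
  have e' : g v = a := by
    change dX.liftKaehlerDifferential (KaehlerDifferential.map K R A A v) = a
    rw [hv, map_smul, hw, smul_eq_mul, mul_one]
  rwa [e, one_mul, e'] at h₂

end TwoForms

/-! ### A plane curve `y² = P(x)` over the base -/

section PlaneCurve

variable {K R : Type u} [CommRing K] [CommRing R] [Algebra K R]

/-- A derivation of `R` applied to the coefficients of a polynomial. -/
noncomputable def coeffDer (δ : Derivation K R R) : Derivation K R[X] R[X] :=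
  (PolynomialModule.equivPolynomialSelf (R := R)).compDer δ.mapCoeffs

theorem coeff_coeffDer (δ : Derivation K R R) (p : R[X]) (n : ℕ) :
    (coeffDer δ p).coeff n = δ (p.coeff n) := rfl

theorem coeffDer_C (δ : Derivation K R R) (r : R) :
    coeffDer δ (Polynomial.C r) = Polynomial.C (δ r) := by
  ext n
  rw [coeff_coeffDer, Polynomial.coeff_C, Polynomial.coeff_C]
  split_ifs <;> simp

theorem coeffDer_X (δ : Derivation K R R) : coeffDer δ Polynomial.X = 0 := by
  ext n
  rw [coeff_coeffDer, Polynomial.coeff_X]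
  split_ifs <;> simp

theorem derivative_coeffDer (δ : Derivation K R R) (p : R[X]) :
    Polynomial.derivative (coeffDer δ p) = coeffDer δ (Polynomial.derivative p) := by
  ext n
  simp only [Polynomial.coeff_derivative, coeff_coeffDer, Derivation.leibniz, smul_eq_mul]
  have : δ ((n : R) + 1) = 0 := by
    rw [← Nat.cast_succ]; exact Derivation.map_natCast _ _
  rw [this]; ring

variable {A : Type u} [CommRing A] [Algebra K A] [Algebra R A] [IsScalarTower K R A]

theorem D_aeval {δ : Derivation K R R} {τ : Ω[R⁄K]} (hδ : ∀ r, D K R r = δ r • τ) (x : A)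
    (p : R[X]) :
    D K A (Polynomial.aeval x p) =
      Polynomial.aeval x (Polynomial.derivative p) • D K A x +
        Polynomial.aeval x (coeffDer δ p) • pullback K A R τ := by
  have hr : ∀ r : R, D K A (algebraMap R A r) = algebraMap R A (δ r) • pullback K A R τ := by
    intro r
    rw [← KaehlerDifferential.map_D K K, hδ, map_smul, algebraMap_smul]
  induction p using Polynomial.induction_on with
  | C r => simp [coeffDer_C, hr]
  | add p q hp hq => simp only [map_add, hp, hq]; module
  | monomial n r h =>
    rw [pow_succ, ← mul_assoc, map_mul, Derivation.leibniz, h]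
    simp only [Polynomial.derivative_mul, Derivation.leibniz, coeffDer_X, mul_zero,
      Polynomial.derivative_X, mul_one, zero_add, map_add, smul_eq_mul, map_mul, Polynomial.aeval_X]
    module

variable (K) in
/-- The form `(y a(x)) dx + 2 b(x) dy`; it is `dx/y` on the curve `y² = P(x)` when
`a P + b P' = 1`. -/
noncomputable def curveForm (a b : R[X]) (x y : A) : Ω[A⁄K] :=
  (Polynomial.aeval x a * y) • D K A x + (2 * Polynomial.aeval x b) • D K A y

variable {δ : Derivation K R R} {τ : Ω[R⁄K]} {P a b : R[X]} {c : R} {x y : A}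

theorem two_y_dy_abs (hδ : ∀ r, D K R r = δ r • τ) (hy : y ^ 2 = Polynomial.aeval x P) :
    (2 * y) • D K A y = Polynomial.aeval x (Polynomial.derivative P) • D K A x +
      Polynomial.aeval x (coeffDer δ P) • pullback K A R τ := by
  rw [← D_aeval hδ, ← hy, Derivation.leibniz_pow]
  simp only [Nat.add_one_sub_one, pow_one]
  module

theorem aeval_bezout (hab : a * P + b * Polynomial.derivative P = 1) (x : A) :
    Polynomial.aeval x a * Polynomial.aeval x P +
      Polynomial.aeval x b * Polynomial.aeval x (Polynomial.derivative P) = 1 := by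
  rw [← map_mul, ← map_mul, ← map_add, hab, map_one]

theorem dx_eq (hδ : ∀ r, D K R r = δ r • τ) (hy : y ^ 2 = Polynomial.aeval x P)
    (hab : a * P + b * Polynomial.derivative P = 1) :
    D K A x = y • curveForm K a b x y -
      Polynomial.aeval x (b * coeffDer δ P) • pullback K A R τ := by
  have h := two_y_dy_abs hδ hy
  have e := aeval_bezout hab x
  rw [← hy] at e
  rw [curveForm, map_mul]
  generalize Polynomial.aeval x a = a at *
  generalize Polynomial.aeval x b = b at *
  generalize Polynomial.aeval x (coeffDer δ P) = h at *
  generalize Polynomial.aeval x (Polynomial.derivative P) = f at *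
  linear_combination (norm := module) (-b) • h - congrArg (· • D K A x) e

theorem two_dy_eq (hδ : ∀ r, D K R r = δ r • τ) (hy : y ^ 2 = Polynomial.aeval x P)
    (hab : a * P + b * Polynomial.derivative P = 1) :
    (2 : A) • D K A y = Polynomial.aeval x (Polynomial.derivative P) • curveForm K a b x y +
      (Polynomial.aeval x (a * coeffDer δ P) * y) • pullback K A R τ := by
  have h := two_y_dy_abs hδ hy
  have e := aeval_bezout hab x
  rw [← hy] at e
  rw [curveForm, map_mul]
  generalize Polynomial.aeval x a = a at *
  generalize Polynomial.aeval x b = b at *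
  generalize Polynomial.aeval x (coeffDer δ P) = h at *
  generalize Polynomial.aeval x (Polynomial.derivative P) = f at *
  linear_combination (norm := module) (a * y) • h - congrArg (· • (2 : A) • D K A y) e

theorem dy_eq (hc : c * 2 = 1) (hδ : ∀ r, D K R r = δ r • τ) (hy : y ^ 2 = Polynomial.aeval x P)
    (hab : a * P + b * Polynomial.derivative P = 1) :
    D K A y = (algebraMap R A c * Polynomial.aeval x (Polynomial.derivative P)) •
        curveForm K a b x y +
      (algebraMap R A c * Polynomial.aeval x (a * coeffDer δ P) * y) • pullback K A R τ := by
  have h := two_dy_eq hδ hy hab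
  have e : algebraMap R A c * 2 = 1 := by
    have h := congrArg (algebraMap R A) hc
    simpa only [map_mul, map_ofNat, map_one] using h
  linear_combination (norm := module) algebraMap R A c • h - congrArg (· • D K A y) e

theorem D_aeval_eq (hδ : ∀ r, D K R r = δ r • τ) (hy : y ^ 2 = Polynomial.aeval x P)
    (hab : a * P + b * Polynomial.derivative P = 1) (p : R[X]) :
    D K A (Polynomial.aeval x p) =
      (Polynomial.aeval x (Polynomial.derivative p) * y) • curveForm K a b x y +
      Polynomial.aeval x (coeffDer δ p - Polynomial.derivative p * (b * coeffDer δ P)) •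
        pullback K A R τ := by
  rw [D_aeval hδ, dx_eq hδ hy hab]
  simp only [map_sub, map_mul]
  module

/-- The coefficient `κ` in `dθ = κ τ ∧ θ`, for `θ` the form `dx/y` of `curveForm`. -/
noncomputable def curvature (δ : Derivation K R R) (P a b : R[X]) (c : R) : R[X] :=
  -(Polynomial.C c * (a * coeffDer δ P)) - Polynomial.derivative (b * coeffDer δ P)

theorem wedgeQ_combination_left (θ T : Ω[A⁄K]) (u v : A) :
    wedgeQ K R A (u • θ + v • T) θ = v • wedgeQ K R A T θ := by
  rw [map_add, map_smul, map_smul, LinearMap.add_apply, LinearMap.smul_apply,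
    LinearMap.smul_apply, wedgeQ_self, smul_zero, zero_add]

theorem wedgeQ_combination_right (θ T : Ω[A⁄K]) (u v : A) :
    wedgeQ K R A (u • θ + v • T) T = -(u • wedgeQ K R A T θ) := by
  rw [map_add, map_smul, map_smul, LinearMap.add_apply, LinearMap.smul_apply,
    LinearMap.smul_apply, wedgeQ_self, smul_zero, add_zero, wedgeQ_swap, smul_neg]

theorem curvature_aux {M : Type u} [AddCommGroup M] [Module A M]
    {a b c f' f'' a' b' h h' y : A} {E d : M} (hc : c * 2 = 1) (e : a * y ^ 2 + b * f' = 1)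
    (e' : a' * y ^ 2 + a * f' + (b' * f' + b * f'') = 0)
    (h₁ : 0 = (c * (a * h) * y) • E + y • d - -(((b' * h + b * h') * y) • E))
    (h₂ : 0 = (h' - f'' * (b * h)) • E + f' • d +
      ((a * h) • -((c * f') • E) + y • -(((a' * h + a * h') * y) • E))) :
    d = (-(c * (a * h)) - (b' * h + b * h')) • E := by
  linear_combination (norm := module) (-(a * y)) • h₁ - b • h₂ - e • d
    - ((c * a * h + b' * h) • e) • E + ((b * h) • e') • E + ((a * b * h * f') • hc) • E

/-- `dθ = κ τ ∧ θ`. Differentiating `y θ = dx + b h τ` and `P' θ = 2 dy - a h y τ`, where `h` is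
`P` with its coefficients differentiated, gives `y dθ` and `P' dθ`; the Bézout relation recovers
`dθ`. -/
theorem dBar_curveForm (hc : c * 2 = 1) (hδ : ∀ r, D K R r = δ r • τ)
    (hy : y ^ 2 = Polynomial.aeval x P) (hab : a * P + b * Polynomial.derivative P = 1) :
    dBar K A R (curveForm K a b x y) = Polynomial.aeval x (curvature δ P a b c) •
      wedgeQ K R A (pullback K A R τ) (curveForm K a b x y) := by
  have hx' := dx_eq hδ hy hab
  have hy' := two_dy_eq hδ hy hab
  have hdy := dy_eq hc hδ hy hab
  have hp := D_aeval_eq hδ hy hab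
  generalize curveForm K a b x y = θ at *
  have hT0 := dBar_pullback K R (A := A) τ
  generalize pullback K A R τ = T at *
  have h₁ := congrArg (dBar K A R) hx'
  have h₂ := congrArg (dBar K A R) hy'
  have h0 : D K A 2 = 0 := by
    rw [← map_ofNat (algebraMap K A) 2]; exact Derivation.map_algebraMap _ _
  rw [dBar_D, map_sub, dBar_smul, dBar_smul, hT0, smul_zero, add_zero, hdy, hp,
    wedgeQ_combination_left, wedgeQ_combination_right] at h₁
  rw [dBar_smul, map_add, dBar_smul, dBar_smul, hT0, smul_zero, add_zero, dBar_D, smul_zero,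
    h0, map_zero, LinearMap.zero_apply, add_zero, Derivation.leibniz, map_add, map_smul, map_smul,
    LinearMap.add_apply, LinearMap.smul_apply, LinearMap.smul_apply, hdy, hp, hp,
    wedgeQ_combination_left, wedgeQ_combination_right, wedgeQ_combination_right] at h₂
  have e := aeval_bezout hab x
  have e' := congrArg (fun p => Polynomial.aeval x (Polynomial.derivative p)) hab
  simp only [map_mul, map_add, Polynomial.derivative_mul, Polynomial.derivative_one,
    map_zero] at e'
  rw [← hy] at e e'
  simp only [map_sub, map_add, map_mul, Polynomial.derivative_mul, ← derivative_coeffDer]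
    at h₁ h₂
  simp only [curvature, map_sub, map_neg, map_mul, map_add, Polynomial.derivative_mul,
    Polynomial.aeval_C]
  have ec : algebraMap R A c * 2 = 1 := by
    have h := congrArg (algebraMap R A) hc
    simpa only [map_mul, map_ofNat, map_one] using h
  exact curvature_aux ec e e' h₁ h₂

end PlaneCurve

/-! ### Derivations and relative forms on a chart `y² = P(x)` -/

section Chart

variable {K R : Type u} [CommRing K] [CommRing R] [Algebra K R]

/-- The coordinate ring of the plane curve `y² = P(x)`. -/
abbrev CurveRing (P : R[X]) : Type u :=
  AdjoinRoot (Polynomial.X ^ 2 - Polynomial.C P : R[X][X])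

/-- The coordinate `x` of the plane curve. -/
noncomputable def curveX (P : R[X]) : CurveRing P := AdjoinRoot.of _ Polynomial.X

/-- The coordinate `y` of the plane curve. -/
noncomputable def curveY (P : R[X]) : CurveRing P := AdjoinRoot.root _

variable {P : R[X]}

theorem of_eq_aeval (p : R[X]) :
    AdjoinRoot.of (Polynomial.X ^ 2 - Polynomial.C P : R[X][X]) p =
      Polynomial.aeval (curveX P) p := by
  induction p using Polynomial.induction_on with
  | C r => rw [Polynomial.aeval_C]; rfl
  | add p q hp hq => rw [map_add, map_add, hp, hq]
  | monomial n r h =>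
    rw [pow_succ Polynomial.X n, ← mul_assoc, map_mul, h,
      map_mul (Polynomial.aeval _) _ Polynomial.X, Polynomial.aeval_X]
    rfl

theorem curveY_sq : curveY P ^ 2 = Polynomial.aeval (curveX P) P := by
  have h := AdjoinRoot.eval₂_root (Polynomial.X ^ 2 - Polynomial.C P : R[X][X])
  simp only [Polynomial.eval₂_sub, Polynomial.eval₂_pow, Polynomial.eval₂_X,
    Polynomial.eval₂_C, of_eq_aeval] at h
  exact sub_eq_zero.mp h

/-- Functions on the curve `y² = P(x)` are `p(x) + q(x) y`. -/
theorem exists_eq_aeval_add_aeval_mul (s : CurveRing P) :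
    ∃ p q : R[X], s = Polynomial.aeval (curveX P) p + Polynomial.aeval (curveX P) q * curveY P := by
  induction s using AdjoinRoot.induction_on with
  | ih f =>
    induction f using Polynomial.induction_on with
    | C p => exact ⟨p, 0, by rw [AdjoinRoot.mk_C, of_eq_aeval]; simp⟩
    | add f g hf hg =>
      obtain ⟨p, q, h⟩ := hf
      obtain ⟨p', q', h'⟩ := hg
      exact ⟨p + p', q + q', by rw [map_add, h, h', map_add, map_add]; ring⟩
    | monomial n p h =>
      obtain ⟨p', q', h⟩ := h
      refine ⟨q' * P, p', ?_⟩
      rw [pow_succ Polynomial.X n, ← mul_assoc, map_mul, h, AdjoinRoot.mk_X, map_mul, ← curveY_sq]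
      change _ * curveY P = _
      ring

theorem derivation_ext_curve {M : Type u} [AddCommGroup M] [Module (CurveRing P) M] [Module R M]
    {d d' : Derivation R (CurveRing P) M} (hx : d (curveX P) = d' (curveX P))
    (hy : d (curveY P) = d' (curveY P)) : d = d' := by
  ext s
  obtain ⟨p, q, rfl⟩ := exists_eq_aeval_add_aeval_mul s
  simp only [map_add, Derivation.leibniz, Derivation.map_aeval, hx, hy]

open TrivSqZeroExt in
/-- The ring homomorphism `r ↦ r + δ(r) ε` to the dual numbers attached to a derivation. -/
noncomputable def dualHom (δ : Derivation K R R) (A : Type u) [CommRing A] [Algebra R A] :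
    R →+* TrivSqZeroExt A A where
  toFun r := inl (algebraMap R A r) + inr (algebraMap R A (δ r))
  map_one' := by ext <;> simp
  map_zero' := by ext <;> simp
  map_add' r s := by ext <;> simp [add_smul]
  map_mul' r s := by
    ext
    · simp
    · simp only [map_mul, Derivation.leibniz, smul_eq_mul, map_add, snd_add, snd_inl, snd_inr,
        snd_mul, fst_add, fst_inl, fst_inr, op_smul_eq_smul]
      ring

open TrivSqZeroExt in
theorem eval₂_dualHom (δ : Derivation K R R) {A : Type u} [CommRing A] [Algebra R A] (x ξ : A)
    (p : R[X]) : p.eval₂ (dualHom δ A) (inl x + inr ξ) = inl (Polynomial.aeval x p) +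
      inr (Polynomial.aeval x (Polynomial.derivative p) * ξ +
        Polynomial.aeval x (coeffDer δ p)) := by
  induction p using Polynomial.induction_on with
  | C r => simp [coeffDer_C, dualHom]
  | add p q hp hq =>
    rw [Polynomial.eval₂_add, hp, hq]
    ext
    · simp
    · simp; ring
  | monomial n r h =>
    rw [pow_succ, ← mul_assoc, Polynomial.eval₂_mul, h, Polynomial.eval₂_X]
    simp only [map_mul, Polynomial.derivative_mul, Derivation.leibniz, coeffDer_X, mul_zero,
      zero_add, Polynomial.derivative_X, mul_one, map_add, smul_eq_mul, Polynomial.aeval_X]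
    ext
    · simp
    · simp; ring

open TrivSqZeroExt in
/-- A derivation of the base extends to the curve `y² = P(x)` with prescribed values at `x`, `y`,
provided these are compatible with the equation. -/
theorem exists_derivation (δ : Derivation K R R) (ξ η : CurveRing P)
    (h : 2 * curveY P * η = Polynomial.aeval (curveX P) (Polynomial.derivative P) * ξ +
      Polynomial.aeval (curveX P) (coeffDer δ P)) :
    ∃ d : Derivation K (CurveRing P) (CurveRing P),
      (∀ r, d (algebraMap R _ r) = algebraMap R _ (δ r)) ∧ d (curveX P) = ξ ∧
        d (curveY P) = η := by
  let φ : CurveRing P →+* TrivSqZeroExt (CurveRing P) (CurveRing P) :=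
    AdjoinRoot.lift (Polynomial.eval₂RingHom (dualHom δ _) (inl (curveX P) + inr ξ))
      (inl (curveY P) + inr η) (by
        simp only [Polynomial.eval₂_sub, Polynomial.eval₂_pow, Polynomial.eval₂_X,
          Polynomial.eval₂_C, Polynomial.coe_eval₂RingHom, eval₂_dualHom, ← h, ← curveY_sq,
          sub_eq_zero]
        ext
        · simp
        · simp [pow_two]; ring)
  have hC : ∀ r, φ (algebraMap R _ r) = dualHom δ _ r := fun r => by
    change φ (AdjoinRoot.of _ (Polynomial.C r)) = _
    rw [AdjoinRoot.lift_of]; simp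
  have hX : φ (curveX P) = inl (curveX P) + inr ξ := by
    conv_lhs => rw [curveX, AdjoinRoot.lift_of]
    simp
  have hY : φ (curveY P) = inl (curveY P) + inr η := by
    conv_lhs => rw [curveY, AdjoinRoot.lift_root]
  have hfst : ∀ s, (φ s).fst = s := by
    let ψ : CurveRing P →ₐ[R] CurveRing P :=
      { (fstHom R (CurveRing P) (CurveRing P)).toRingHom.comp φ with
        commutes' := fun r => by
          change (φ (algebraMap R _ r)).fst = _
          rw [hC]; simp [dualHom] }
    have e : ψ = AlgHom.id R _ := by
      have hx : ψ (curveX P) = curveX P := by change (φ _).fst = _; rw [hX]; simp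
      have hy : ψ (curveY P) = curveY P := by change (φ _).fst = _; rw [hY]; simp
      refine AlgHom.ext fun s => ?_
      obtain ⟨p, q, rfl⟩ := exists_eq_aeval_add_aeval_mul s
      simp only [map_add, map_mul, ← Polynomial.aeval_algHom_apply, hx, hy, AlgHom.id_apply]
    exact fun s => DFunLike.congr_fun e s
  have hK : ∀ k : K, φ (algebraMap K _ k) = inl (algebraMap K _ k) := fun k => by
    rw [IsScalarTower.algebraMap_apply K R (CurveRing P), hC]
    simp [dualHom]
  refine ⟨Derivation.mk'
    { toFun := fun s => (φ s).snd
      map_add' := fun s t => by simp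
      map_smul' := fun k s => by
        rw [Algebra.smul_def, map_mul, hK]
        simp [Algebra.smul_def] } (fun s t => by simp [hfst, mul_comm]), ?_, ?_, ?_⟩
  · intro r
    change (φ _).snd = _
    rw [hC]; simp [dualHom, ← Algebra.algebraMap_eq_smul_one]
  · change (φ _).snd = _
    rw [hX]; simp
  · change (φ _).snd = _
    rw [hY]; simp

variable {δ : Derivation K R R} {τ : Ω[R⁄K]} {a b : R[X]} {c : R}

/-- The derivation `y ∂/∂x + ½ P' ∂/∂y` along the fibres, dual to `dx/y`. -/
theorem exists_vertical_derivation (hc : c * 2 = 1)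
    (hab : a * P + b * Polynomial.derivative P = 1) :
    ∃ d : Derivation R (CurveRing P) (CurveRing P), d (curveX P) = curveY P ∧
      d (curveY P) = algebraMap R _ c * Polynomial.aeval (curveX P) (Polynomial.derivative P) ∧
      d.liftKaehlerDifferential (curveForm R a b (curveX P) (curveY P)) = 1 := by
  have ec : algebraMap R (CurveRing P) c * 2 = 1 := by
    have h := congrArg (algebraMap R (CurveRing P)) hc
    simpa only [map_mul, map_ofNat, map_one] using h
  have e := aeval_bezout hab (curveX P)
  obtain ⟨d, -, hx, hy⟩ := exists_derivation (P := P) (0 : Derivation R R R) (curveY P)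
    (algebraMap R _ c * Polynomial.aeval (curveX P) (Polynomial.derivative P)) (by
      have : coeffDer (0 : Derivation R R R) P = 0 := by
        ext n; simp [coeff_coeffDer]
      rw [this, map_zero, add_zero]
      linear_combination
        (curveY P * Polynomial.aeval (curveX P) (Polynomial.derivative P)) * ec)
  refine ⟨d, hx, hy, ?_⟩
  rw [curveForm, map_add, map_smul, map_smul, Derivation.liftKaehlerDifferential_comp_D,
    Derivation.liftKaehlerDifferential_comp_D, hx, hy, smul_eq_mul, smul_eq_mul]
  linear_combination e + (Polynomial.aeval (curveX P) a) * curveY_sq (P := P) +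
    (Polynomial.aeval (curveX P) b *
      Polynomial.aeval (curveX P) (Polynomial.derivative P)) * ec

/-- A derivation of the base lifts to the curve. -/
theorem exists_horizontal_derivation (hc : c * 2 = 1)
    (hab : a * P + b * Polynomial.derivative P = 1) (δ : Derivation K R R) :
    ∃ d : Derivation K (CurveRing P) (CurveRing P), ∀ σ : Ω[R⁄K],
      d.liftKaehlerDifferential (pullback K (CurveRing P) R σ) =
        algebraMap R _ (δ.liftKaehlerDifferential σ) := by
  have ec : algebraMap R (CurveRing P) c * 2 = 1 := by
    have h := congrArg (algebraMap R (CurveRing P)) hc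
    simpa only [map_mul, map_ofNat, map_one] using h
  have e := aeval_bezout hab (curveX P)
  obtain ⟨d, hd, -, -⟩ := exists_derivation (P := P) δ
    (-(Polynomial.aeval (curveX P) b * Polynomial.aeval (curveX P) (coeffDer δ P)))
    (algebraMap R _ c * (Polynomial.aeval (curveX P) a *
      Polynomial.aeval (curveX P) (coeffDer δ P)) * curveY P) (by
      linear_combination Polynomial.aeval (curveX P) (coeffDer δ P) * e +
        (Polynomial.aeval (curveX P) a * Polynomial.aeval (curveX P) (coeffDer δ P)) *
          curveY_sq (P := P) + (curveY P ^ 2 * Polynomial.aeval (curveX P) a *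
            Polynomial.aeval (curveX P) (coeffDer δ P)) * ec)
  refine ⟨d, fun σ => ?_⟩
  obtain ⟨x, rfl⟩ := formalSum_surjective K R σ
  induction x using Finsupp.induction_linear with
  | zero => simp
  | add x y hx hy => simp only [map_add, hx, hy]
  | single s r =>
    have he : formalSum K R (Finsupp.single s r) = r • D K R s := by simp [formalSum]
    rw [he, (pullback K (CurveRing P) R).map_smul,
      ← algebraMap_smul (CurveRing P) r (pullback K (CurveRing P) R (D K R s)),
      LinearMap.map_smul, LinearMap.map_smul,
      Derivation.liftKaehlerDifferential_comp_D, KaehlerDifferential.map_D,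
      Derivation.liftKaehlerDifferential_comp_D, hd, smul_eq_mul, smul_eq_mul, map_mul]

/-- The form `dx/y` generates the relative one-forms of the curve. -/
theorem exists_eq_smul_curveForm (hc : c * 2 = 1)
    (hab : a * P + b * Polynomial.derivative P = 1) (w : Ω[CurveRing P⁄R]) :
    ∃ s : CurveRing P, w = s • curveForm R a b (curveX P) (curveY P) := by
  obtain ⟨d, hx, hy, h1⟩ := exists_vertical_derivation (P := P) hc hab
  have hτ : ∀ r : R, D R R r = (0 : Derivation R R R) r • (0 : Ω[R⁄R]) := fun r => by
    rw [smul_zero]; exact Derivation.map_algebraMap _ r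
  refine ⟨d.liftKaehlerDifferential w, ?_⟩
  have key : LinearMap.id = LinearMap.toSpanSingleton (CurveRing P) Ω[CurveRing P⁄R]
      (curveForm R a b (curveX P) (curveY P)) ∘ₗ d.liftKaehlerDifferential := by
    apply Derivation.liftKaehlerDifferential_unique
    refine derivation_ext_curve ?_ ?_
    · change D R _ (curveX P) = d.liftKaehlerDifferential (D R _ (curveX P)) • curveForm R a b _ _
      rw [Derivation.liftKaehlerDifferential_comp_D, hx, dx_eq hτ curveY_sq hab]
      simp
    · change D R _ (curveY P) = d.liftKaehlerDifferential (D R _ (curveY P)) • curveForm R a b _ _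
      rw [Derivation.liftKaehlerDifferential_comp_D, hy, dy_eq hc hτ curveY_sq hab]
      simp
  exact LinearMap.congr_fun key w

end Chart

/-! ### The connecting relation of a two-chart cover -/

section Connecting

set_option linter.unusedSectionVars false

variable {K R A₀ A₁ B : Type u} [CommRing K] [CommRing R] [CommRing A₀] [CommRing A₁] [CommRing B]
  [Algebra K R] [Algebra K A₀] [Algebra K A₁] [Algebra K B]
  [Algebra R A₀] [Algebra R A₁] [Algebra R B] [Algebra A₀ B] [Algebra A₁ B]
  [IsScalarTower K R A₀] [IsScalarTower K R A₁] [IsScalarTower K R B]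
  [IsScalarTower R A₀ B] [IsScalarTower R A₁ B] [IsScalarTower K A₀ B] [IsScalarTower K A₁ B]

theorem absD1_apply (α : B) (β₀ : Ω[A₀⁄K]) (β₁ : Ω[A₁⁄K]) :
    absD1 K R A₀ A₁ B (α, β₀, β₁) =
      (-D K B α + (KaehlerDifferential.map K K A₀ B β₀ - KaehlerDifferential.map K K A₁ B β₁),
        dBar K A₀ R β₀, dBar K A₁ R β₁) := by
  simp only [absD1, LinearMap.prod_apply, sub_eq_add_neg]
  rfl

theorem absToRel_apply (α : B) (β₀ : Ω[A₀⁄K]) (β₁ : Ω[A₁⁄K]) :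
    absToRel K R A₀ A₁ B (α, β₀, β₁) =
      (α, KaehlerDifferential.map K R A₀ A₀ β₀, KaehlerDifferential.map K R A₁ A₁ β₁) := rfl

theorem relD0_apply (s₀ : A₀) (s₁ : A₁) : relD0 R A₀ A₁ B (s₀, s₁) =
    (algebraMap A₀ B s₀ - algebraMap A₁ B s₁, D R A₀ s₀, D R A₁ s₁) := rfl

theorem relD0_mem_relZ1 (s : A₀ × A₁) : relD0 R A₀ A₁ B s ∈ RelZ1 R A₀ A₁ B := by
  obtain ⟨s₀, s₁⟩ := s
  rw [relD0_apply]
  exact mem_relZ1 _ _ _ _ (by rw [map_sub, KaehlerDifferential.map_D, KaehlerDifferential.map_D])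

theorem classOf_relD0 (s : A₀ × A₁) :
    classOf R A₀ A₁ B ⟨relD0 R A₀ A₁ B s, relD0_mem_relZ1 s⟩ = 0 := by
  rw [classOf, Submodule.mkQ_apply, Submodule.Quotient.mk_eq_zero]
  exact ⟨s, rfl⟩

theorem classOf_eq_zero {c : RelZ1 R A₀ A₁ B} (h : classOf R A₀ A₁ B c = 0) :
    ∃ s : A₀ × A₁, relD0 R A₀ A₁ B s = c := by
  rw [classOf, Submodule.mkQ_apply, Submodule.Quotient.mk_eq_zero] at h
  exact h

theorem baseWedge_tmul (τ : Ω[R⁄K]) (g : B) (w₀ : Ω[A₀⁄R]) (w₁ : Ω[A₁⁄R]) :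
    baseWedge K R A₀ A₁ B (τ ⊗ₜ (g, w₀, w₁)) =
      (-(g • pullback K B R τ), wedgeBar K A₀ R τ w₀, wedgeBar K A₁ R τ w₁) := rfl

theorem map_pullback {A : Type u} [CommRing A] [Algebra K A] [Algebra R A] [Algebra A B]
    [IsScalarTower K R A] [IsScalarTower R A B] [IsScalarTower K A B] (τ : Ω[R⁄K]) :
    KaehlerDifferential.map K K A B (pullback K A R τ) = pullback K B R τ := by
  obtain ⟨x, rfl⟩ := formalSum_surjective K R τ
  induction x using Finsupp.induction_linear with
  | zero => simp
  | add x y hx hy => simp only [map_add, hx, hy]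
  | single b a =>
    have e : formalSum K R (Finsupp.single b a) = a • D K R b := by simp [formalSum]
    rw [e, (pullback K A R).map_smul, (pullback K B R).map_smul,
      ← algebraMap_smul A a (pullback K A R (D K R b)), LinearMap.map_smul,
      ← algebraMap_smul B (algebraMap R A a), ← IsScalarTower.algebraMap_apply R A B,
      algebraMap_smul, KaehlerDifferential.map_D, KaehlerDifferential.map_D,
      KaehlerDifferential.map_D, ← IsScalarTower.algebraMap_apply R A B]

theorem IsConnectingImage.add {ξ ξ' : H1dR R A₀ A₁ B} {η η' : Ω[R⁄K] ⊗[R] H1dR R A₀ A₁ B}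
    (h : IsConnectingImage K R A₀ A₁ B ξ η) (h' : IsConnectingImage K R A₀ A₁ B ξ' η') :
    IsConnectingImage K R A₀ A₁ B (ξ + ξ') (η + η') := by
  obtain ⟨c, β, m, h₁, h₂, h₃, h₄⟩ := h
  obtain ⟨c', β', m', h₁', h₂', h₃', h₄'⟩ := h'
  exact ⟨c + c', β + β', m + m', by rw [map_add, h₁, h₁'],
    by rw [map_add, h₂, h₂', Submodule.coe_add], by rw [map_add, h₃, h₃'],
    by rw [map_add, h₄, h₄', map_add, map_add]⟩

theorem dBar_base_smul {A : Type u} [CommRing A] [Algebra K A] [Algebra R A]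
    [IsScalarTower K R A] (r : R) (w : Ω[A⁄K]) :
    dBar K A R (r • w) = wedgeBar K A R (D K R r) (KaehlerDifferential.map K R A A w) +
      r • dBar K A R w := by
  rw [← algebraMap_smul A r w, dBar_smul, wedgeBar_map, KaehlerDifferential.map_D,
    algebraMap_smul]

/-- The Leibniz rule for the connecting relation. -/
theorem IsConnectingImage.smul {ξ : H1dR R A₀ A₁ B} {η : Ω[R⁄K] ⊗[R] H1dR R A₀ A₁ B}
    (h : IsConnectingImage K R A₀ A₁ B ξ η) (r : R) :
    IsConnectingImage K R A₀ A₁ B (r • ξ) (D K R r ⊗ₜ ξ + r • η) := by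
  obtain ⟨c, ⟨α, β₀, β₁⟩, m, h₁, h₂, h₃, h₄⟩ := h
  refine ⟨r • c, r • (α, β₀, β₁), D K R r ⊗ₜ c + r • m, by rw [map_smul, h₁],
    by rw [map_smul, h₂, Submodule.coe_smul],
    by rw [map_add, map_smul, h₃, LinearMap.lTensor_tmul, h₁], ?_⟩
  rw [map_add, LinearMap.map_smul, map_add, LinearMap.map_smul, ← h₄, LinearMap.lTensor_tmul,
    Submodule.subtype_apply, ← h₂, absToRel_apply, baseWedge_tmul, Prod.smul_mk, Prod.smul_mk,
    absD1_apply, absD1_apply,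
    dBar_base_smul, dBar_base_smul, Prod.smul_mk, Prod.smul_mk, Prod.mk_add_mk, Prod.mk_add_mk]
  congr 1
  have e₀ : KaehlerDifferential.map K K A₀ B (r • β₀) =
      r • KaehlerDifferential.map K K A₀ B β₀ := by
    rw [← algebraMap_smul A₀ r, map_smul, ← algebraMap_smul B (algebraMap R A₀ r),
      ← IsScalarTower.algebraMap_apply R A₀ B, algebraMap_smul]
  have e₁ : KaehlerDifferential.map K K A₁ B (r • β₁) =
      r • KaehlerDifferential.map K K A₁ B β₁ := by
    rw [← algebraMap_smul A₁ r, map_smul, ← algebraMap_smul B (algebraMap R A₁ r),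
      ← IsScalarTower.algebraMap_apply R A₁ B, algebraMap_smul]
  rw [e₀, e₁, KaehlerDifferential.map_D, Algebra.smul_def r α, Derivation.leibniz]
  simp only [← algebraMap_smul B r]
  module

theorem IsConnectingImage.zero :
    IsConnectingImage K R A₀ A₁ B 0 0 :=
  ⟨0, 0, 0, by simp, by simp, by simp, by simp⟩

variable {τ : Ω[R⁄K]}

theorem exists_eq_tmul {M : Type u} [AddCommGroup M] [Module R M]
    (hτ : ∀ σ : Ω[R⁄K], ∃ r : R, σ = r • τ) (t : Ω[R⁄K] ⊗[R] M) : ∃ m : M, t = τ ⊗ₜ m := by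
  induction t with
  | zero => exact ⟨0, by simp⟩
  | add s t hs ht =>
    obtain ⟨m, rfl⟩ := hs
    obtain ⟨n, rfl⟩ := ht
    exact ⟨m + n, by rw [TensorProduct.tmul_add]⟩
  | tmul σ m =>
    obtain ⟨r, rfl⟩ := hτ σ
    exact ⟨r • m, by rw [TensorProduct.smul_tmul]⟩

/-- The only connecting image of `0` is `0`, provided that `Ω¹_S ⊗ C¹(U/S)` embeds in the absolute
complex: a lift of a coboundary differs from an absolute coboundary by forms `aᵢ τ`, which only
contribute the coboundary of `(a₀, a₁)`. -/
theorem IsConnectingImage.eq_zero (hτ : ∀ σ : Ω[R⁄K], ∃ r : R, σ = r • τ)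
    (hB : ∀ b : B, b • pullback K B R τ = 0 → b = 0)
    (h₀ : ∀ w : Ω[A₀⁄R], wedgeBar K A₀ R τ w = 0 → w = 0)
    (h₁ : ∀ w : Ω[A₁⁄R], wedgeBar K A₁ R τ w = 0 → w = 0)
    {η : Ω[R⁄K] ⊗[R] H1dR R A₀ A₁ B} (h : IsConnectingImage K R A₀ A₁ B 0 η) : η = 0 := by
  obtain ⟨c, ⟨α, β₀, β₁⟩, m, e₁, e₂, e₃, e₄⟩ := h
  obtain ⟨⟨s₀, s₁⟩, hs⟩ := classOf_eq_zero e₁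
  obtain ⟨z, rfl⟩ := exists_eq_tmul hτ m
  rw [← hs, relD0_apply, absToRel_apply] at e₂
  simp only [Prod.mk.injEq] at e₂
  obtain ⟨rfl, hβ₀, hβ₁⟩ := e₂
  obtain ⟨a₀, ha₀⟩ := exists_eq_smul_of_map_eq_zero K R hτ (w := β₀ - D K A₀ s₀) (by
    rw [map_sub, hβ₀, KaehlerDifferential.map_D]; exact sub_self _)
  obtain ⟨a₁, ha₁⟩ := exists_eq_smul_of_map_eq_zero K R hτ (w := β₁ - D K A₁ s₁) (by
    rw [map_sub, hβ₁, KaehlerDifferential.map_D]; exact sub_self _)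
  rw [sub_eq_iff_eq_add] at ha₀ ha₁
  subst ha₀ ha₁
  -- On each chart `d(a τ + ds) = -τ ∧ da`.
  have hd : ∀ {A : Type u} [CommRing A] [Algebra K A] [Algebra R A] [IsScalarTower K R A]
      (a s : A), dBar K A R (a • pullback K A R τ + D K A s) =
        -wedgeBar K A R τ (D R A a) := by
    intro A _ _ _ _ a s
    have : D R A a = KaehlerDifferential.map K R A A (D K A a) := by
      rw [KaehlerDifferential.map_D]; rfl
    rw [map_add, dBar_smul, dBar_pullback, dBar_D, this, wedgeBar_map, wedgeQ_swap, smul_zero,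
      add_zero, add_zero]
  obtain ⟨⟨g, w₀, w₁⟩, hz⟩ := z
  rw [LinearMap.lTensor_tmul, Submodule.subtype_apply, baseWedge_tmul, absD1_apply, hd, hd] at e₄
  simp only [Prod.mk.injEq] at e₄
  obtain ⟨f₁, f₂, f₃⟩ := e₄
  have k₀ : w₀ = -D R A₀ a₀ := by
    rw [eq_neg_iff_add_eq_zero]
    exact h₀ _ (by rw [map_add, ← f₂, neg_add_cancel])
  have k₁ : w₁ = -D R A₁ a₁ := by
    rw [eq_neg_iff_add_eq_zero]
    exact h₁ _ (by rw [map_add, ← f₃, neg_add_cancel])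
  have kg : g = -(algebraMap A₀ B a₀ - algebraMap A₁ B a₁) := by
    rw [eq_neg_iff_add_eq_zero]
    refine hB _ ?_
    rw [map_add, map_add, map_smul, map_smul, map_pullback, map_pullback,
      KaehlerDifferential.map_D, KaehlerDifferential.map_D, map_sub,
      ← algebraMap_smul B a₀, ← algebraMap_smul B a₁] at f₁
    linear_combination (norm := module) f₁
  have : (⟨(g, w₀, w₁), hz⟩ : RelZ1 R A₀ A₁ B) =
      -⟨relD0 R A₀ A₁ B (a₀, a₁), relD0_mem_relZ1 _⟩ := by
    apply Subtype.ext
    subst k₀ k₁ kg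
    rfl
  rw [← e₃, LinearMap.lTensor_tmul, this, map_neg, classOf_relD0, neg_zero,
    TensorProduct.tmul_zero]

/-- The connecting relation is the graph of a connection as soon as it is defined on generators. -/
theorem exists_isGaussManin (hτ : ∀ σ : Ω[R⁄K], ∃ r : R, σ = r • τ)
    (hB : ∀ b : B, b • pullback K B R τ = 0 → b = 0)
    (h₀ : ∀ w : Ω[A₀⁄R], wedgeBar K A₀ R τ w = 0 → w = 0)
    (h₁ : ∀ w : Ω[A₁⁄R], wedgeBar K A₁ R τ w = 0 → w = 0)
    {s : Set (H1dR R A₀ A₁ B)} (hs : Submodule.span R s = ⊤)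
    (hex : ∀ ξ ∈ s, ∃ η, IsConnectingImage K R A₀ A₁ B ξ η) :
    ∃ nabla : H1dR R A₀ A₁ B →ₗ[K] Ω[R⁄K] ⊗[R] H1dR R A₀ A₁ B,
      IsGaussManin K R A₀ A₁ B nabla ∧
      ∀ (r : R) (ξ : H1dR R A₀ A₁ B), nabla (r • ξ) = D K R r ⊗ₜ[R] ξ + r • nabla ξ := by
  have huniq : ∀ {ξ η η'}, IsConnectingImage K R A₀ A₁ B ξ η →
      IsConnectingImage K R A₀ A₁ B ξ η' → η = η' := by
    intro ξ η η' h h'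
    have := h.add (h'.smul (-1))
    rw [neg_smul, one_smul, add_neg_cancel, map_neg, Derivation.map_one_eq_zero, neg_zero,
      TensorProduct.zero_tmul, zero_add, neg_smul, one_smul] at this
    exact sub_eq_zero.mp (by rw [sub_eq_add_neg]; exact this.eq_zero hτ hB h₀ h₁)
  have hall : ∀ ξ, ∃ η, IsConnectingImage K R A₀ A₁ B ξ η := by
    intro ξ
    have hξ : ξ ∈ Submodule.span R s := hs ▸ Submodule.mem_top
    induction hξ using Submodule.span_induction with
    | mem ξ h => exact hex ξ h
    | zero => exact ⟨0, .zero⟩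
    | add ξ ξ' _ _ h h' =>
      obtain ⟨η, h⟩ := h
      obtain ⟨η', h'⟩ := h'
      exact ⟨_, h.add h'⟩
    | smul r ξ _ h =>
      obtain ⟨η, h⟩ := h
      exact ⟨_, h.smul r⟩
  choose f hf using hall
  refine ⟨{ toFun := f, map_add' := fun ξ ξ' => huniq (hf _) ((hf ξ).add (hf ξ')),
            map_smul' := fun k ξ => huniq (hf _) ?_ }, fun ξ η => ⟨fun h => huniq (hf ξ) h, ?_⟩,
          fun r ξ => huniq (hf _) ((hf ξ).smul r)⟩
  · have := (hf ξ).smul (algebraMap K R k)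
    rwa [Derivation.map_algebraMap, TensorProduct.zero_tmul, zero_add, algebraMap_smul,
      algebraMap_smul] at this
  · rintro rfl
    exact hf ξ

end Connecting

/-! ### Injectivity on the charts and on the overlap -/

section Injectivity

/-- A torsion-free one-form stays torsion-free on a localization. -/
theorem eq_zero_of_smul_map_eq_zero {k A B : Type u} [CommRing k] [CommRing A] [CommRing B]
    [Algebra k A] [Algebra k B] [Algebra A B] [IsScalarTower k A B] (M : Submonoid A)
    [IsLocalization M B] {e : Ω[A⁄k]} (he : ∀ a : A, a • e = 0 → a = 0) {b : B}
    (hb : b • KaehlerDifferential.map k k A B e = 0) : b = 0 := by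
  obtain ⟨⟨a, s⟩, hs⟩ := IsLocalization.surj M b
  have h : KaehlerDifferential.map k k A B (a • e) = 0 := by
    rw [map_smul, ← algebraMap_smul B a, ← hs, mul_comm, mul_smul, hb, smul_zero]
  obtain ⟨m, hm⟩ := (IsLocalizedModule.eq_zero_iff M (KaehlerDifferential.map k k A B)).mp h
  have h' : (m : A) * a = 0 := he _ (by rw [mul_smul]; exact hm)
  have h'' : algebraMap A B a = 0 := by
    rw [← (IsLocalization.map_units B m).mul_right_eq_zero, ← map_mul, h', map_zero]
  rw [h''] at hs
  exact (IsLocalization.map_units B s).mul_left_eq_zero.mp hs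

variable {K R : Type u} [CommRing K] [CommRing R] [Algebra K R]

theorem exists_eq_smul_basis (dt : Module.Basis Unit R Ω[R⁄K]) (σ : Ω[R⁄K]) :
    ∃ r : R, σ = r • dt () :=
  ⟨dt.repr σ (), by simpa using (dt.sum_repr σ).symm⟩

/-- The derivation `d/dt` of the base. -/
noncomputable def baseDer (dt : Module.Basis Unit R Ω[R⁄K]) : Derivation K R R :=
  (dt.coord ()).compDer (D K R)

theorem D_eq_baseDer (dt : Module.Basis Unit R Ω[R⁄K]) (r : R) :
    D K R r = baseDer dt r • dt () :=
  D_eq_derivAlong dt r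

theorem liftKaehlerDifferential_baseDer (dt : Module.Basis Unit R Ω[R⁄K]) :
    (baseDer dt).liftKaehlerDifferential (dt ()) = 1 := by
  have h : (baseDer dt).liftKaehlerDifferential = dt.coord () :=
    Derivation.liftKaehlerDifferential_unique _ _ (by
      ext r; exact (baseDer dt).liftKaehlerDifferential_comp_D r)
  rw [h]; simp

variable {P a b : R[X]} {c : R}

theorem eq_zero_of_smul_pullback_eq_zero (dt : Module.Basis Unit R Ω[R⁄K]) (hc : c * 2 = 1)
    (hab : a * P + b * Polynomial.derivative P = 1) (s : CurveRing P)
    (h : s • pullback K (CurveRing P) R (dt ()) = 0) : s = 0 := by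
  obtain ⟨d, hd⟩ := exists_horizontal_derivation (P := P) hc hab (baseDer dt)
  have := congrArg d.liftKaehlerDifferential h
  rwa [map_smul, hd, liftKaehlerDifferential_baseDer, map_one, smul_eq_mul, mul_one,
    map_zero] at this

theorem eq_zero_of_smul_curveForm_eq_zero (hc : c * 2 = 1)
    (hab : a * P + b * Polynomial.derivative P = 1) (s : CurveRing P)
    (h : s • curveForm R a b (curveX P) (curveY P) = 0) : s = 0 := by
  obtain ⟨d, -, -, hd⟩ := exists_vertical_derivation (P := P) hc hab
  have := congrArg d.liftKaehlerDifferential h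
  rwa [map_smul, hd, smul_eq_mul, mul_one, map_zero] at this

theorem eq_zero_of_wedgeBar_eq_zero (dt : Module.Basis Unit R Ω[R⁄K]) (hc : c * 2 = 1)
    (hab : a * P + b * Polynomial.derivative P = 1) (w : Ω[CurveRing P⁄R])
    (h : wedgeBar K (CurveRing P) R (dt ()) w = 0) : w = 0 := by
  obtain ⟨s, rfl⟩ := exists_eq_smul_curveForm hc hab w
  obtain ⟨d, hd⟩ := exists_horizontal_derivation (P := P) hc hab (baseDer dt)
  obtain ⟨d', -, -, hd'⟩ := exists_vertical_derivation (P := P) hc hab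
  rw [eq_zero_of_smul_wedgeBar_eq_zero K R d d'
    (by rw [hd, liftKaehlerDifferential_baseDer, map_one]) hd' h, zero_smul]

end Injectivity

/-! ### The Bézout relations of the two charts -/

section Bezout

open Polynomial

variable {R : Type u} [CommRing R] (g₂ g₃ : R)

/-- The cofactor of `4x³ - g₂x - g₃` in the Bézout relation with its derivative. -/
noncomputable def bezoutA₀ : R[X] :=
  C (Ring.inverse (disc g₂ g₃)) * (-9 * (2 * C g₂ * X - 3 * C g₃))

/-- The cofactor of the derivative of `4x³ - g₂x - g₃`. -/
noncomputable def bezoutB₀ : R[X] :=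
  C (Ring.inverse (disc g₂ g₃)) * (6 * C g₂ * X ^ 2 - 9 * C g₃ * X - C g₂ ^ 2)

/-- The cofactor of `4z - g₂z³ - g₃z⁴` in the Bézout relation with its derivative. -/
noncomputable def bezoutAInf : R[X] :=
  C (Ring.inverse (32 * disc g₂ g₃)) * (-2 * C g₂ ^ 2 * C g₃ +
    (9 * C g₂ ^ 4 - 240 * C g₂ * C g₃ ^ 2) * X + (12 * C g₂ ^ 3 * C g₃ - 288 * C g₃ ^ 3) * X ^ 2)

/-- The cofactor of the derivative of `4z - g₂z³ - g₃z⁴`. -/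
noncomputable def bezoutBInf : R[X] :=
  C (Ring.inverse (32 * disc g₂ g₃)) * (8 * (C g₂ ^ 3 - 27 * C g₃ ^ 2) +
    2 * C g₂ ^ 2 * C g₃ * X + (-3 * C g₂ ^ 4 + 78 * C g₂ * C g₃ ^ 2) * X ^ 2 +
    (-3 * C g₂ ^ 3 * C g₃ + 72 * C g₃ ^ 3) * X ^ 3)

theorem derivative_cubic : derivative (cubic g₂ g₃) = 12 * X ^ 2 - C g₂ := by
  simp only [cubic, derivative_sub, derivative_mul, derivative_X_pow, derivative_C,
    derivative_ofNat, derivative_X]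
  simp only [Nat.cast_ofNat, map_ofNat]
  ring

theorem derivative_quartic :
    derivative (quartic g₂ g₃) = 4 - 3 * C g₂ * X ^ 2 - 4 * C g₃ * X ^ 3 := by
  simp only [quartic, derivative_sub, derivative_mul, derivative_X_pow, derivative_C,
    derivative_ofNat, derivative_X]
  simp only [Nat.cast_ofNat, map_ofNat]
  ring

variable {g₂ g₃}

theorem bezout_cubic (hΔ : IsUnit (disc g₂ g₃)) :
    bezoutA₀ g₂ g₃ * cubic g₂ g₃ + bezoutB₀ g₂ g₃ * derivative (cubic g₂ g₃) = 1 := by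
  have h := congrArg C (Ring.inverse_mul_cancel _ hΔ)
  rw [derivative_cubic, bezoutA₀, bezoutB₀, cubic]
  generalize Ring.inverse (disc g₂ g₃) = i at *
  simp only [disc, map_mul, map_sub, map_pow, map_ofNat, map_one] at h
  linear_combination h

theorem bezout_quartic (hΔ : IsUnit (32 * disc g₂ g₃)) :
    bezoutAInf g₂ g₃ * quartic g₂ g₃ + bezoutBInf g₂ g₃ * derivative (quartic g₂ g₃) = 1 := by
  have h := congrArg C (Ring.inverse_mul_cancel _ hΔ)
  rw [derivative_quartic, bezoutAInf, bezoutBInf, quartic]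
  generalize Ring.inverse (32 * disc g₂ g₃) = i at *
  simp only [disc, map_mul, map_sub, map_pow, map_ofNat, map_one] at h
  linear_combination h

theorem dxOverY_eq : dxOverY g₂ g₃ =
    curveForm R (bezoutA₀ g₂ g₃) (bezoutB₀ g₂ g₃) (x₀ g₂ g₃) (y₀ g₂ g₃) := by
  rw [dxOverY, curveForm, bezoutA₀, bezoutB₀,
    ← algebraMap_smul (Chart0 g₂ g₃) (Ring.inverse (disc g₂ g₃))]
  simp only [map_mul, map_sub, map_neg, map_pow, map_ofNat, aeval_C, aeval_X]
  module

theorem dzOverU_eq : dzOverU g₂ g₃ =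
    curveForm R (bezoutAInf g₂ g₃) (bezoutBInf g₂ g₃) (zInf g₂ g₃) (uInf g₂ g₃) := by
  rw [dzOverU, curveForm, bezoutAInf, bezoutBInf,
    ← algebraMap_smul (ChartInf g₂ g₃) (Ring.inverse (32 * disc g₂ g₃))]
  simp only [disc, map_mul, map_sub, map_add, map_neg, map_pow, map_ofNat, aeval_C, aeval_X]
  module

end Bezout

/-! ### Functions on the overlap -/

section OverlapFunctions

open Polynomial

variable {R : Type u} [CommRing R] {g₂ g₃ : R}

theorem coeff_toLaurent_natCast (p : R[X]) (n : ℕ) : (toLaurent p).coeff (n : ℤ) = p.coeff n := by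
  rw [LaurentPolynomial.coeff_toLaurent]
  exact Finsupp.mapDomain_apply Nat.cast_injective _ _

theorem coeff_toLaurent_of_neg (p : R[X]) {n : ℤ} (hn : n < 0) : (toLaurent p).coeff n = 0 := by
  rw [LaurentPolynomial.coeff_toLaurent]
  refine Finsupp.mapDomain_of_notMem_range _ _ ?_
  rintro ⟨m, rfl⟩
  exact absurd hn (not_lt.mpr (Int.natCast_nonneg m))

/-- The overlap maps to the free module with basis `1, y` over Laurent polynomials in `x`. -/
theorem exists_overlap_algHom : ∃ Φ : Overlap g₂ g₃ →ₐ[R]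
    QuadraticAlgebra (LaurentPolynomial R) (toLaurent (cubic g₂ g₃)) 0,
      Φ (xB g₂ g₃) = ⟨LaurentPolynomial.T 1, 0⟩ ∧ Φ (yB g₂ g₃) = ⟨0, 1⟩ ∧
      Φ (xInvB g₂ g₃) = ⟨LaurentPolynomial.T (-1), 0⟩ := by
  let Q := QuadraticAlgebra (LaurentPolynomial R) (toLaurent (cubic g₂ g₃)) 0
  let φ : Chart0 g₂ g₃ →+* Q :=
    AdjoinRoot.lift ((algebraMap (LaurentPolynomial R) Q).comp toLaurent) ⟨0, 1⟩ (by
      simp only [eval₂_sub, eval₂_pow, eval₂_X, eval₂_C, RingHom.comp_apply, sub_eq_zero]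
      rw [pow_two, QuadraticAlgebra.mk_mul_mk, QuadraticAlgebra.algebraMap_eq]
      simp)
  have hX : φ (x₀ g₂ g₃) = ⟨LaurentPolynomial.T 1, 0⟩ := by
    rw [x₀, AdjoinRoot.lift_of, RingHom.comp_apply, toLaurent_X]; rfl
  have hY : φ (y₀ g₂ g₃) = ⟨0, 1⟩ := by rw [y₀, AdjoinRoot.lift_root]
  have hinv : (⟨LaurentPolynomial.T 1, 0⟩ : Q) * ⟨LaurentPolynomial.T (-1), 0⟩ = 1 := by
    rw [QuadraticAlgebra.mk_mul_mk, ← LaurentPolynomial.T_add]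
    simp only [mul_zero, zero_mul, add_zero, add_neg_cancel, LaurentPolynomial.T_zero]
    rfl
  have hu : IsUnit (φ (x₀ g₂ g₃)) := by
    rw [hX]; exact IsUnit.of_mul_eq_one _ hinv
  let Φ : Overlap g₂ g₃ →+* Q := IsLocalization.Away.lift (x₀ g₂ g₃) hu
  have hΦ : ∀ s, Φ (algebraMap _ _ s) = φ s := IsLocalization.Away.lift_eq _ hu
  have hΦX : Φ (xB g₂ g₃) = ⟨LaurentPolynomial.T 1, 0⟩ := (hΦ _).trans hX
  refine ⟨{ Φ with commutes' := fun r => ?_ }, hΦX, (hΦ _).trans hY, ?_⟩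
  · change Φ (algebraMap R _ r) = _
    rw [IsScalarTower.algebraMap_apply R (Chart0 g₂ g₃) (Overlap g₂ g₃), hΦ]
    change φ (AdjoinRoot.of _ (C r)) = _
    rw [AdjoinRoot.lift_of, RingHom.comp_apply, toLaurent_C]; rfl
  · change Φ _ = _
    have h := congrArg Φ (xB_mul_xInvB g₂ g₃)
    rw [map_mul, hΦX, map_one] at h
    calc Φ (xInvB g₂ g₃) = (⟨LaurentPolynomial.T 1, 0⟩ * ⟨LaurentPolynomial.T (-1), 0⟩) *
          Φ (xInvB g₂ g₃) := by rw [hinv, one_mul]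
      _ = ⟨LaurentPolynomial.T (-1), 0⟩ * (⟨LaurentPolynomial.T 1, 0⟩ * Φ (xInvB g₂ g₃)) := by
          ring
      _ = _ := by rw [h, mul_one]

theorem aeval_T_one (p : R[X]) :
    aeval (LaurentPolynomial.T 1 : LaurentPolynomial R) p = toLaurent p := by
  induction p using Polynomial.induction_on' with
  | add p q hp hq => rw [map_add, map_add, hp, hq]
  | monomial n r =>
    rw [aeval_monomial, ← C_mul_X_pow_eq_monomial, toLaurent_C_mul_X_pow,
      LaurentPolynomial.T_pow, mul_one]
    rfl

theorem aeval_T_neg_one (p : R[X]) : aeval (LaurentPolynomial.T (-1) : LaurentPolynomial R) p =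
    LaurentPolynomial.invert (toLaurent p) := by
  rw [← aeval_T_one, ← LaurentPolynomial.invert_T]
  exact Polynomial.aeval_algHom_apply LaurentPolynomial.invert.toAlgHom _ p

theorem eq_C_of_toLaurent_eq_invert {p q : R[X]}
    (h : toLaurent p = LaurentPolynomial.invert (toLaurent q)) :
    p = C (p.coeff 0) ∧ q = C (p.coeff 0) := by
  have hc : ∀ n : ℤ, (toLaurent p).coeff n = (toLaurent q).coeff (-n) := fun n => by
    rw [h, LaurentPolynomial.invert_apply]
  have h0 : p.coeff 0 = q.coeff 0 := by
    have := hc (0 : ℕ)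
    rw [Nat.cast_zero, neg_zero, ← Nat.cast_zero] at this
    rwa [coeff_toLaurent_natCast, coeff_toLaurent_natCast] at this
  constructor
  · ext n
    rw [coeff_C]
    split_ifs with hn
    · rw [hn]
    · rw [← coeff_toLaurent_natCast, hc, coeff_toLaurent_of_neg _ (by omega)]
  · ext n
    rw [coeff_C]
    split_ifs with hn
    · rw [hn, h0]
    · rw [← coeff_toLaurent_natCast, ← neg_neg (n : ℤ), ← hc, coeff_toLaurent_of_neg _ (by omega)]

/-- The functions on `U₀` and on `U_∞` meet in the constants, and their sum does not meet the line
of `y/x`. -/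
theorem eq_zero_and_exists_algebraMap_eq {s₀ : Chart0 g₂ g₃} {s₁ : ChartInf g₂ g₃} {r : R}
    (h : algebraMap _ (Overlap g₂ g₃) s₀ - algebraMap _ (Overlap g₂ g₃) s₁ =
      r • (yB g₂ g₃ * xInvB g₂ g₃)) :
    r = 0 ∧ ∃ k : R, s₀ = algebraMap R _ k ∧ s₁ = algebraMap R _ k := by
  obtain ⟨Φ, hX, hY, hV⟩ := exists_overlap_algHom (g₂ := g₂) (g₃ := g₃)
  obtain ⟨p, q, rfl⟩ := exists_eq_aeval_add_aeval_mul s₀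
  obtain ⟨p', q', rfl⟩ := exists_eq_aeval_add_aeval_mul s₁
  have ha : ∀ (f : LaurentPolynomial R) (p : R[X]),
      aeval (⟨f, 0⟩ : QuadraticAlgebra (LaurentPolynomial R) (toLaurent (cubic g₂ g₃)) 0) p =
        ⟨aeval f p, 0⟩ := fun f p =>
    Polynomial.aeval_algebraMap_apply _ f p
  have e₀ : algebraMap _ (Overlap g₂ g₃) (aeval (curveX (cubic g₂ g₃)) p +
      aeval (curveX (cubic g₂ g₃)) q * curveY (cubic g₂ g₃)) =
      aeval (xB g₂ g₃) p + aeval (xB g₂ g₃) q * yB g₂ g₃ := by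
    rw [map_add, map_mul, ← Polynomial.aeval_algebraMap_apply,
      ← Polynomial.aeval_algebraMap_apply]
    rfl
  have e₁ : algebraMap _ (Overlap g₂ g₃) (aeval (curveX (quartic g₂ g₃)) p' +
      aeval (curveX (quartic g₂ g₃)) q' * curveY (quartic g₂ g₃)) =
      aeval (xInvB g₂ g₃) p' + aeval (xInvB g₂ g₃) q' * (yB g₂ g₃ * xInvB g₂ g₃ ^ 2) := by
    rw [map_add, map_mul, ← Polynomial.aeval_algebraMap_apply,
      ← Polynomial.aeval_algebraMap_apply, ← algebraMap_uInf, ← algebraMap_zInf]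
    rfl
  rw [e₀, e₁] at h
  replace h := congrArg Φ h
  simp only [map_sub, map_add, map_mul, map_smul, ← Polynomial.aeval_algHom_apply, hX, hY,
    hV, ha, aeval_T_one, aeval_T_neg_one, pow_two, QuadraticAlgebra.mk_mul_mk,
    QuadraticAlgebra.smul_mk, mul_zero, zero_mul, add_zero, zero_add, mul_one, one_mul,
    smul_zero] at h
  have hre : toLaurent p - LaurentPolynomial.invert (toLaurent p') = 0 := by
    simpa using congrArg QuadraticAlgebra.re h
  have him : toLaurent q - LaurentPolynomial.invert (toLaurent q') *
      (LaurentPolynomial.T (-1) * LaurentPolynomial.T (-1)) = r • LaurentPolynomial.T (-1) := by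
    simpa using congrArg QuadraticAlgebra.im h
  have hs : LaurentPolynomial.invert (toLaurent q') *
      (LaurentPolynomial.T (-1) * LaurentPolynomial.T (-1)) =
      LaurentPolynomial.invert (toLaurent (q' * X ^ 2)) := by
    rw [map_mul, map_mul, toLaurent_X_pow, LaurentPolynomial.invert_T, ← LaurentPolynomial.T_add]
    rfl
  rw [hs] at him
  have hr : r = 0 := by
    have := congrArg (fun f : LaurentPolynomial R => f.coeff (-1)) him
    have e : (toLaurent (q' * X ^ 2)).coeff 1 = 0 := by
      rw [← Nat.cast_one, coeff_toLaurent_natCast, coeff_mul_X_pow']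
      simp
    simp only [AddMonoidAlgebra.coeff_sub, AddMonoidAlgebra.coeff_smul, Finsupp.sub_apply,
      Finsupp.smul_apply, LaurentPolynomial.invert_apply, neg_neg, e,
      coeff_toLaurent_of_neg q (show (-1 : ℤ) < 0 by norm_num), LaurentPolynomial.T_apply,
      if_true, smul_eq_mul, mul_one, sub_zero] at this
    exact this.symm
  rw [hr, zero_smul] at him
  obtain ⟨hp, hp'⟩ := eq_C_of_toLaurent_eq_invert (sub_eq_zero.mp hre)
  obtain ⟨hq, hq'⟩ := eq_C_of_toLaurent_eq_invert (sub_eq_zero.mp him)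
  have h0 : q.coeff 0 = 0 := by
    have := congrArg (fun f : R[X] => f.coeff 0) hq'
    simpa [coeff_mul_X_pow'] using this.symm
  rw [h0, C_0] at hq hq'
  replace hq' : q' = 0 := by
    ext n
    rw [← coeff_mul_X_pow q' 2 n, hq']; simp
  refine ⟨hr, p.coeff 0, ?_, ?_⟩
  · rw [hq, map_zero, zero_mul, add_zero]
    conv_lhs => rw [hp]
    exact aeval_C _ _
  · rw [hq', map_zero, zero_mul, add_zero, hp']
    exact aeval_C _ _

/-- Every function on the overlap is the difference of functions on the two charts, up to a multiple
of `y/x`. -/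
theorem exists_eq_sub_add_smul (α : Overlap g₂ g₃) : ∃ (s₀ : Chart0 g₂ g₃) (s₁ : ChartInf g₂ g₃)
    (r : R), α = algebraMap _ _ s₀ - algebraMap _ _ s₁ + r • (yB g₂ g₃ * xInvB g₂ g₃) := by
  let W : Submodule R (Overlap g₂ g₃) :=
    LinearMap.range ((Algebra.linearMap (Chart0 g₂ g₃) (Overlap g₂ g₃)).restrictScalars R) ⊔
      LinearMap.range ((Algebra.linearMap (ChartInf g₂ g₃) (Overlap g₂ g₃)).restrictScalars R) ⊔
      Submodule.span R {yB g₂ g₃ * xInvB g₂ g₃}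
  have hv := xB_mul_xInvB g₂ g₃
  have h₀ : ∀ s : Chart0 g₂ g₃, algebraMap _ _ s ∈ W := fun s =>
    Submodule.mem_sup_left (Submodule.mem_sup_left ⟨s, rfl⟩)
  have h₁ : ∀ s : ChartInf g₂ g₃, algebraMap _ _ s ∈ W := fun s =>
    Submodule.mem_sup_left (Submodule.mem_sup_right ⟨s, rfl⟩)
  have key : ∀ i n : ℕ, xB g₂ g₃ ^ i * xInvB g₂ g₃ ^ n ∈ W ∧
      xB g₂ g₃ ^ i * xInvB g₂ g₃ ^ n * yB g₂ g₃ ∈ W := by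
    intro i n
    induction n generalizing i with
    | zero =>
      refine ⟨?_, ?_⟩
      · have := h₀ (x₀ g₂ g₃ ^ i)
        rwa [map_pow, ← mul_one (_ ^ i)] at this
      · have := h₀ (x₀ g₂ g₃ ^ i * y₀ g₂ g₃)
        rwa [map_mul, map_pow, ← mul_one (_ ^ i)] at this
    | succ n ih =>
      cases i with
      | succ i =>
        have e : xB g₂ g₃ ^ (i + 1) * xInvB g₂ g₃ ^ (n + 1) = xB g₂ g₃ ^ i * xInvB g₂ g₃ ^ n := by
          rw [pow_succ (xB g₂ g₃), pow_succ (xInvB g₂ g₃)]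
          linear_combination (xB g₂ g₃ ^ i * xInvB g₂ g₃ ^ n) * hv
        rw [e]; exact ih i
      | zero =>
        rw [pow_zero, one_mul]
        refine ⟨?_, ?_⟩
        · have := h₁ (zInf g₂ g₃ ^ (n + 1))
          rwa [map_pow, algebraMap_zInf] at this
        · cases n with
          | zero =>
            rw [zero_add, pow_one, mul_comm]
            exact Submodule.mem_sup_right (Submodule.mem_span_singleton_self _)
          | succ n =>
            have := h₁ (zInf g₂ g₃ ^ n * uInf g₂ g₃)
            rw [map_mul, map_pow, algebraMap_zInf, algebraMap_uInf] at this
            convert this using 1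
            ring
  have hα : α ∈ W := by
    obtain ⟨⟨s, ⟨_, n, rfl⟩⟩, hs⟩ := IsLocalization.surj (Submonoid.powers (x₀ g₂ g₃)) α
    have hα : α = algebraMap _ _ s * xInvB g₂ g₃ ^ n := by
      simp only [map_pow] at hs
      change α * xB g₂ g₃ ^ n = _ at hs
      rw [← hs, mul_assoc, ← mul_pow, hv, one_pow, mul_one]
    obtain ⟨p, q, rfl⟩ := exists_eq_aeval_add_aeval_mul s
    have e₀ : algebraMap _ (Overlap g₂ g₃) (aeval (curveX (cubic g₂ g₃)) p +
        aeval (curveX (cubic g₂ g₃)) q * curveY (cubic g₂ g₃)) =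
        aeval (xB g₂ g₃) p + aeval (xB g₂ g₃) q * yB g₂ g₃ := by
      rw [map_add, map_mul, ← Polynomial.aeval_algebraMap_apply,
        ← Polynomial.aeval_algebraMap_apply]
      rfl
    have hp : ∀ p : R[X], aeval (xB g₂ g₃) p * xInvB g₂ g₃ ^ n ∈ W ∧
        aeval (xB g₂ g₃) p * xInvB g₂ g₃ ^ n * yB g₂ g₃ ∈ W := by
      intro p
      induction p using Polynomial.induction_on' with
      | add p q hp hq =>
        rw [map_add, add_mul, add_mul]
        exact ⟨W.add_mem hp.1 hq.1, W.add_mem hp.2 hq.2⟩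
      | monomial i r =>
        rw [aeval_monomial, ← Algebra.smul_def, smul_mul_assoc, smul_mul_assoc]
        exact ⟨W.smul_mem _ (key i n).1, W.smul_mem _ (key i n).2⟩
    rw [hα, e₀, add_mul, mul_right_comm _ (yB g₂ g₃)]
    exact W.add_mem (hp p).1 (hp q).2
  obtain ⟨_, h, _, h', rfl⟩ := Submodule.mem_sup.mp hα
  obtain ⟨_, ⟨s₀, rfl⟩, _, ⟨s₁, rfl⟩, rfl⟩ := Submodule.mem_sup.mp h
  obtain ⟨r, rfl⟩ := Submodule.mem_span_singleton.mp h'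
  exact ⟨s₀, -s₁, r, by rw [map_neg, sub_neg_eq_add]; rfl⟩

end OverlapFunctions

/-! ### The basis of `H¹_dR` -/

section Basis

variable {R : Type u} [CommRing R] {g₂ g₃ : R}

theorem isUnit_thirtyTwo_mul_disc (h2 : IsUnit (2 : R)) (hΔ : IsUnit (disc g₂ g₃)) :
    IsUnit (32 * disc g₂ g₃) := by
  have : (32 : R) = 2 ^ 5 := by norm_num
  rw [this]; exact (h2.pow 5).mul hΔ

theorem relD1_apply {A₀ A₁ B : Type u} [CommRing A₀] [CommRing A₁] [CommRing B] [Algebra R A₀]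
    [Algebra R A₁] [Algebra R B] [Algebra A₀ B] [Algebra A₁ B] [IsScalarTower R A₀ B]
    [IsScalarTower R A₁ B] (α : B) (w₀ : Ω[A₀⁄R]) (w₁ : Ω[A₁⁄R]) :
    relD1 R A₀ A₁ B (α, w₀, w₁) = -D R B α +
      (KaehlerDifferential.map R R A₀ B w₀ - KaehlerDifferential.map R R A₁ B w₁) := by
  rw [sub_eq_add_neg]; rfl

theorem eq_zero_of_smul_map_dxOverY_eq_zero (h2 : IsUnit (2 : R)) (hΔ : IsUnit (disc g₂ g₃))
    {b : Overlap g₂ g₃}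
    (h : b • KaehlerDifferential.map R R (Chart0 g₂ g₃) (Overlap g₂ g₃) (dxOverY g₂ g₃) = 0) :
    b = 0 := by
  refine eq_zero_of_smul_map_eq_zero (Submonoid.powers (x₀ g₂ g₃)) (fun a ha => ?_) h
  rw [dxOverY_eq] at ha
  exact eq_zero_of_smul_curveForm_eq_zero (Ring.inverse_mul_cancel _ h2) (bezout_cubic hΔ) a ha

/-- Two classes `(0) × (θ₀, -θ₁)` and `(β) × (w₀, w₁)` generate `H¹_dR` when `θ₀`, `θ₁` generate the
relative one-forms of the charts, `β` generates `H¹(U, 𝒪_U)` and `H⁰(U, 𝒪_U) = R`. -/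
theorem span_pair_eq_top {A₀ A₁ B : Type u} [CommRing A₀] [CommRing A₁] [CommRing B] [Algebra R A₀]
    [Algebra R A₁] [Algebra R B] [Algebra A₀ B] [Algebra A₁ B] [IsScalarTower R A₀ B]
    [IsScalarTower R A₁ B] {β : B} {θ₀ w₀ : Ω[A₀⁄R]} {θ₁ w₁ : Ω[A₁⁄R]}
    (hω : (0, θ₀, -θ₁) ∈ RelZ1 R A₀ A₁ B) (hs : (β, w₀, w₁) ∈ RelZ1 R A₀ A₁ B)
    (hθ₀ : ∀ w : Ω[A₀⁄R], ∃ a : A₀, w = a • θ₀) (hθ₁ : ∀ w : Ω[A₁⁄R], ∃ a : A₁, w = a • θ₁)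
    (hinj : ∀ b : B, b • KaehlerDifferential.map R R A₀ B θ₀ = 0 → b = 0)
    (hβ : ∀ α : B, ∃ (s₀ : A₀) (s₁ : A₁) (r : R),
      α = algebraMap A₀ B s₀ - algebraMap A₁ B s₁ + r • β)
    (hconst : ∀ (a : A₀) (b : A₁), algebraMap A₀ B a = algebraMap A₁ B b →
      ∃ k : R, a = algebraMap R A₀ k ∧ b = algebraMap R A₁ k) :
    Submodule.span R {classOf R A₀ A₁ B ⟨_, hω⟩, classOf R A₀ A₁ B ⟨_, hs⟩} = ⊤ := by
  rw [eq_top_iff]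
  rintro ξ -
  rw [Submodule.mem_span_pair]
  obtain ⟨⟨⟨α, v₀, v₁⟩, hz⟩, rfl⟩ := Submodule.mkQ_surjective _ ξ
  obtain ⟨s₀, s₁, r, hα⟩ := hβ α
  obtain ⟨a, ha⟩ := hθ₀ (v₀ - (D R A₀ s₀ + r • w₀))
  obtain ⟨b, hb⟩ := hθ₁ (v₁ - (D R A₁ s₁ + r • w₁))
  rw [sub_eq_iff_eq_add] at ha hb
  subst hα ha hb
  -- After subtracting a coboundary and a multiple of the second class, a cocycle
  -- `(0) × (a θ₀, b θ₁)` remains, and `a = -b` on the overlap forces `a` and `b` to be constant.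
  have hz' : (0, a • θ₀, b • θ₁) ∈ RelZ1 R A₀ A₁ B := by
    have e := (RelZ1 R A₀ A₁ B).sub_mem (Submodule.sub_mem _ hz (relD0_mem_relZ1 (s₀, s₁)))
      (Submodule.smul_mem _ r hs)
    rw [relD0_apply] at e
    simp only [Prod.smul_mk, Prod.mk_sub_mk] at e
    convert e using 2
    · abel
    · congr 1 <;> abel
  rw [LinearMap.mem_ker, relD1_apply, map_zero, neg_zero, zero_add] at hω hz'
  rw [map_neg, sub_neg_eq_add] at hω
  rw [map_smul, map_smul, ← algebraMap_smul B a, ← algebraMap_smul B b,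
    (neg_eq_of_add_eq_zero_right hω).symm, smul_neg, sub_neg_eq_add, ← add_smul] at hz'
  obtain ⟨k, rfl, hk⟩ := hconst a (-b) (by
    rw [map_neg]; exact eq_neg_of_add_eq_zero_left (hinj _ hz'))
  obtain rfl := neg_eq_iff_eq_neg.mp hk
  refine ⟨k, r, ?_⟩
  rw [← map_smul, ← map_smul, ← map_add, ← add_zero (classOf _ _ _ _ _),
    ← classOf_relD0 (s₀, s₁), ← map_add]
  refine congrArg (classOf R _ _ _) (Subtype.ext ?_)
  simp only [Submodule.coe_add, Submodule.coe_smul, Prod.smul_mk, Prod.mk_add_mk, relD0_apply,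
    Prod.mk.injEq, smul_zero, zero_add, algebraMap_smul, neg_smul, smul_neg]
  refine ⟨by abel, by abel, by abel⟩

theorem span_omega_omegaStar (h2 : IsUnit (2 : R)) (hΔ : IsUnit (disc g₂ g₃)) :
    Submodule.span R {omega h2 hΔ, omegaStar h2 hΔ} = ⊤ := by
  refine span_pair_eq_top _ _ (fun w => ?_) (fun w => ?_)
    (fun b => eq_zero_of_smul_map_dxOverY_eq_zero h2 hΔ) exists_eq_sub_add_smul
    (fun a b h => (eq_zero_and_exists_algebraMap_eq (r := 0) (by rw [h, sub_self, zero_smul])).2)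
  · rw [dxOverY_eq]
    exact exists_eq_smul_curveForm (Ring.inverse_mul_cancel _ h2) (bezout_cubic hΔ) w
  · rw [dzOverU_eq]
    exact exists_eq_smul_curveForm (Ring.inverse_mul_cancel _ h2)
      (bezout_quartic (isUnit_thirtyTwo_mul_disc h2 hΔ)) w

theorem linearIndependent_omega_omegaStar (h2 : IsUnit (2 : R)) (hΔ : IsUnit (disc g₂ g₃)) :
    LinearIndependent R ![omega h2 hΔ, omegaStar h2 hΔ] := by
  rw [LinearIndependent.pair_iff]
  intro s r h
  rw [omega, omegaStar, ← map_smul, ← map_smul, ← map_add] at h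
  obtain ⟨⟨s₀, s₁⟩, hs⟩ := classOf_eq_zero h
  rw [relD0_apply] at hs
  simp only [Submodule.coe_add, Submodule.coe_smul, Prod.smul_mk, Prod.mk_add_mk,
    Prod.mk.injEq, smul_zero, zero_add] at hs
  obtain ⟨e₁, e₂, -⟩ := hs
  obtain ⟨rfl, k, rfl, -⟩ := eq_zero_and_exists_algebraMap_eq e₁
  refine ⟨?_, rfl⟩
  rw [Derivation.map_algebraMap, zero_smul, add_zero, ← algebraMap_smul (Chart0 g₂ g₃) s,
    dxOverY_eq] at e₂
  have hs := eq_zero_of_smul_curveForm_eq_zero (Ring.inverse_mul_cancel _ h2) (bezout_cubic hΔ) _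
    e₂.symm
  exact (eq_zero_and_exists_algebraMap_eq (g₂ := g₂) (g₃ := g₃) (s₀ := 0) (s₁ := 0)
    (by rw [← algebraMap_smul (Chart0 g₂ g₃) s, hs]; simp)).1

end Basis

/-! ### The lifts of `dx/y` and `dz/u` on the overlap -/

section Gluing

open Polynomial

variable {K R : Type u} [CommRing K] [CommRing R] [Algebra K R] {g₂ g₃ : R}
  {δ : Derivation K R R} {τ : Ω[R⁄K]}

theorem map_curveForm_overlap {k A B : Type u} [CommRing k] [CommRing A] [CommRing B] [Algebra k A]
    [Algebra k B] [Algebra R A] [Algebra R B] [Algebra A B] [IsScalarTower k A B]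
    [IsScalarTower R A B] (a b : R[X]) (x y : A) :
    KaehlerDifferential.map k k A B (curveForm k a b x y) =
      curveForm k a b (algebraMap A B x) (algebraMap A B y) := by
  simp only [curveForm, map_add, map_smul, KaehlerDifferential.map_D, aeval_algebraMap_apply]
  simp only [← algebraMap_smul B (_ : A), map_mul, map_ofNat]

theorem map_curveForm_relative {A : Type u} [CommRing A] [Algebra K A] [Algebra R A]
    [IsScalarTower K R A] (a b : R[X]) (x y : A) :
    KaehlerDifferential.map K R A A (curveForm K a b x y) = curveForm R a b x y := by
  simp only [curveForm, map_add, map_smul, KaehlerDifferential.map_D]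
  rfl

theorem coeffDer_four (δ : Derivation K R R) : coeffDer δ (4 : R[X]) = 0 := by
  rw [← map_ofNat (algebraMap K R[X]) 4]; exact Derivation.map_algebraMap _ _

theorem coeffDer_cubic (δ : Derivation K R R) :
    coeffDer δ (cubic g₂ g₃) = -(C (δ g₂) * X) - C (δ g₃) := by
  simp only [cubic, map_sub, Derivation.leibniz, Derivation.leibniz_pow, coeffDer_X, coeffDer_C,
    coeffDer_four, smul_eq_mul]
  ring

theorem coeffDer_quartic (δ : Derivation K R R) :
    coeffDer δ (quartic g₂ g₃) = -(C (δ g₂) * X ^ 3) - C (δ g₃) * X ^ 4 := by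
  simp only [quartic, map_sub, Derivation.leibniz, Derivation.leibniz_pow, coeffDer_X, coeffDer_C,
    coeffDer_four, smul_eq_mul]
  ring

theorem inverse_disc_eq (h : IsUnit (32 * disc g₂ g₃)) :
    Ring.inverse (disc g₂ g₃) = 32 * Ring.inverse (32 * disc g₂ g₃) := by
  have h' : IsUnit (disc g₂ g₃) := isUnit_of_mul_isUnit_right h
  have e₁ := Ring.inverse_mul_cancel _ h
  have e₂ := Ring.inverse_mul_cancel _ h'
  linear_combination (32 * Ring.inverse (32 * disc g₂ g₃)) * e₂ - Ring.inverse (disc g₂ g₃) * e₁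

/-- Polynomial `e` with `θ₀ + θ_∞ = h y e(1/x) τ` on the overlap, where `θ₀`, `θ_∞` are the lifts of
`dx/y`, `dz/u` to absolute forms and `h` is the cubic with its coefficients differentiated. -/
noncomputable def gluePoly (g₂ g₃ : R) : R[X] :=
  C (Ring.inverse (32 * disc g₂ g₃)) * (48 * C g₂ * X - 72 * C g₃ * X ^ 2 + 4 * C g₂ ^ 2 * X ^ 3 -
    6 * C g₂ * C g₃ * X ^ 4 + (3 * C g₂ ^ 3 - 72 * C g₃ ^ 2) * X ^ 5)

/-- The relation `T₀ + T₁ = h y e τ` holds after multiplication by `y` and by `f' = P'(x)`, which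
generate the unit ideal. -/
theorem add_eq_of_gluing {A M : Type u} [CommRing A] [AddCommGroup M] [Module A M]
    {a b c d f' φ' h k e x y v : A} {X Y T₀ T₁ τ : M} (hv : x * v = 1)
    (hX : X = y • T₀ - (b * h) • τ) (hY : (2 : A) • Y = f' • T₀ + (a * h * y) • τ)
    (hZ : -(v ^ 2 • X) = (y * v ^ 2) • T₁ - (d * k) • τ)
    (hU : (2 : A) • (v ^ 2 • Y - (2 * y * v ^ 3) • X) = φ' • T₁ + (c * k * (y * v ^ 2)) • τ)
    (hk : k = v ^ 4 * h) (r₁ : b + v ^ 2 * d = y ^ 2 * e)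
    (r₂ : -a + c * v ^ 4 + 4 * v ^ 3 * d = f' * e) (r₃ : φ' = 4 * v ^ 3 * y ^ 2 - v ^ 2 * f')
    (bez : a * y ^ 2 + b * f' = 1) : T₀ + T₁ = (h * y * e) • τ := by
  have e₂ : x ^ 2 * v ^ 2 = 1 := by rw [← mul_pow, hv, one_pow]
  have s₁ : y • (T₀ + T₁) = y • (h * y * e) • τ := by
    linear_combination (norm := module) -hX - x ^ 2 • hZ - e₂ • (X + y • T₁) +
      ((x ^ 2 * d) • hk) • τ + ((v ^ 2 * d * h) • e₂) • τ + (h • r₁) • τ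
  have s₂ : f' • (T₀ + T₁) = f' • (h * y * e) • τ := by
    linear_combination (norm := module) -hY + x ^ 2 • hU - (4 * x ^ 2 * y * v) • hZ -
      e₂ • ((2 : A) • Y + f' • T₁) + ((x ^ 2 * c * y * v ^ 2 + 4 * x ^ 2 * y * v * d) • hk) • τ +
      ((c * y * v ^ 4 * h + 4 * v ^ 3 * y * d * h) • e₂) • τ + ((h * y) • r₂) • τ +
      (x ^ 2 • r₃) • T₁
  linear_combination (norm := module) (a * y) • s₁ + b • s₂ - bez • (T₀ + T₁) +
    bez • ((h * y * e) • τ)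

variable {B : Type u} [CommRing B] [Algebra K B] [Algebra R B] [IsScalarTower K R B]

/-- The relative forms `dx/y` and `-dz/u` agree on the overlap, so the sum of their lifts is a
multiple of `τ`. -/
theorem curveForm_add_curveForm (h32 : IsUnit (32 * disc g₂ g₃)) (hδ : ∀ r, D K R r = δ r • τ)
    {x y v : B} (hv : x * v = 1) (hy : y ^ 2 = aeval x (cubic g₂ g₃))
    (hu : (y * v ^ 2) ^ 2 = aeval v (quartic g₂ g₃)) :
    curveForm K (bezoutA₀ g₂ g₃) (bezoutB₀ g₂ g₃) x y +
      curveForm K (bezoutAInf g₂ g₃) (bezoutBInf g₂ g₃) v (y * v ^ 2) =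
      (aeval x (coeffDer δ (cubic g₂ g₃)) * y * aeval v (gluePoly g₂ g₃)) • pullback K B R τ := by
  have hab := bezout_cubic (isUnit_of_mul_isUnit_right h32)
  have hX := dx_eq hδ hy hab
  have hY := two_dy_eq hδ hy hab
  have hZ := dx_eq hδ hu (bezout_quartic h32)
  have hU := two_dy_eq hδ hu (bezout_quartic h32)
  have bez := aeval_bezout hab x
  have hdv := dx_inv (R := K) hv
  rw [hdv] at hZ
  rw [Derivation.leibniz, Derivation.leibniz_pow, hdv] at hU
  rw [map_mul] at hX hY hZ hU
  rw [← hy] at bez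
  refine add_eq_of_gluing hv hX hY hZ (Eq.trans ?_ hU) ?_ ?_ ?_ ?_ bez
  · simp only [Nat.add_one_sub_one, pow_one]
    module
  all_goals
    simp only [coeffDer_cubic, coeffDer_quartic, derivative_cubic, derivative_quartic, hy]
    simp only [bezoutA₀, bezoutB₀, bezoutAInf, bezoutBInf, gluePoly, cubic, inverse_disc_eq h32,
      map_mul, map_sub, map_add, map_neg, map_pow, map_ofNat, aeval_C, aeval_X]
    generalize algebraMap R B g₂ = p
    generalize algebraMap R B g₃ = q
    generalize algebraMap R B (Ring.inverse (32 * disc g₂ g₃)) = i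
    clear hX hY hZ hU bez hdv hu hy
  -- The coefficients are the quotients on division of polynomials in `x` and `v` by `x v - 1`.
  · linear_combination (v ^ 3 * algebraMap R B (δ g₂)) * hv
  · linear_combination (-12 * x ^ 2 * v ^ 4 * p ^ 3 * i + 288 * x ^ 2 * v ^ 4 * q ^ 2 * i + 24 *
      x ^ 2 * v ^ 3 * p * q * i - 16 * x ^ 2 * v ^ 2 * p ^ 2 * i + 288 * x ^ 2 * v * q * i - 192 *
      x ^ 2 * p * i - 12 * x * v ^ 3 * p ^ 3 * i + 288 * x * v ^ 3 * q ^ 2 * i + 24 * x * v ^ 2 *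
      p * q * i - 16 * x * v * p ^ 2 * i + 288 * x * q * i + 3 * v ^ 4 * p ^ 4 * i - 72 * v ^ 4 *
      p * q ^ 2 * i - 6 * v ^ 3 * p ^ 2 * q * i - 8 * v ^ 2 * p ^ 3 * i + 288 * v ^ 2 * q ^ 2 * i -
      48 * v * p * q * i + 32 * p ^ 2 * i) * hv
  · linear_combination (-36 * x * v ^ 4 * p ^ 3 * i + 864 * x * v ^ 4 * q ^ 2 * i + 72 * x *
      v ^ 3 * p * q * i - 48 * x * v ^ 2 * p ^ 2 * i + 864 * x * v * q * i - 576 * x * p * i - 36 *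
      v ^ 3 * p ^ 3 * i + 864 * v ^ 3 * q ^ 2 * i + 72 * v ^ 2 * p * q * i - 48 * v * p ^ 2 * i +
      864 * q * i) * hv
  · linear_combination (-16 * x ^ 2 * v ^ 2 - 4 * x * v + 4 * v ^ 2 * p - 4) * hv

end Gluing

/-! ### Connecting images of explicit cocycles -/

section ConnectingImages

open Polynomial

variable {K R : Type u} [CommRing K] [CommRing R] [Algebra K R] {δ : Derivation K R R}
  {τ : Ω[R⁄K]}

section Chart

variable {P a b : R[X]} {c : R}

/-- The differential `d(p(x) θ)` in terms of `τ ∧ θ`, for `θ` the lift of `dx/y`. -/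
theorem dBar_aeval_smul_curveForm {A : Type u} [CommRing A] [Algebra K A] [Algebra R A]
    [IsScalarTower K R A] {x y : A} (hc : c * 2 = 1) (hδ : ∀ r, D K R r = δ r • τ)
    (hy : y ^ 2 = aeval x P) (hab : a * P + b * derivative P = 1) (p : R[X]) :
    dBar K A R (aeval x p • curveForm K a b x y) =
      wedgeBar K A R τ (aeval x (coeffDer δ p - derivative p * (b * coeffDer δ P) +
        p * curvature δ P a b c) • curveForm R a b x y) := by
  rw [wedgeBar_smul, ← map_curveForm_relative (K := K), wedgeBar_map, dBar_smul,
    D_aeval_eq hδ hy hab, wedgeQ_combination_left, dBar_curveForm hc hδ hy hab, smul_smul,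
    ← add_smul, map_add, map_mul _ p]

/-- The relative differential of `p(x) y`. -/
theorem D_aeval_mul_y {A : Type u} [CommRing A] [Algebra R A] {x y : A} (hc : c * 2 = 1)
    (hy : y ^ 2 = aeval x P) (hab : a * P + b * derivative P = 1) (p : R[X]) :
    D R A (aeval x p * y) =
      aeval x (derivative p * P + C c * (p * derivative P)) • curveForm R a b x y := by
  have hτ : ∀ r : R, D R R r = (0 : Derivation R R R) r • (0 : Ω[R⁄R]) := fun r => by
    rw [smul_zero]; exact Derivation.map_algebraMap _ r
  rw [Derivation.leibniz, D_aeval_eq hτ hy hab, dy_eq hc hτ hy hab]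
  simp only [map_zero, smul_zero, add_zero, map_add, map_mul, aeval_C, ← hy]
  module

end Chart

variable {A₀ A₁ B : Type u} [CommRing A₀] [CommRing A₁] [CommRing B]
  [Algebra K A₀] [Algebra K A₁] [Algebra K B]
  [Algebra R A₀] [Algebra R A₁] [Algebra R B] [Algebra A₀ B] [Algebra A₁ B]
  [IsScalarTower K R A₀] [IsScalarTower K R A₁] [IsScalarTower K R B]
  [IsScalarTower R A₀ B] [IsScalarTower R A₁ B] [IsScalarTower K A₀ B] [IsScalarTower K A₁ B]

/-- The connecting image can be read off from a lift whose differential is `τ ∧ ·` of a combination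
of two cocycles and a coboundary. -/
theorem isConnectingImage_of_lift {α g g' : B} {β₀ : Ω[A₀⁄K]} {β₁ : Ω[A₁⁄K]}
    {v₀ w₀ w₀' : Ω[A₀⁄R]} {v₁ w₁ w₁' : Ω[A₁⁄R]} {a b : R} (s₀ : A₀) (s₁ : A₁)
    (hz : (α, v₀, v₁) ∈ RelZ1 R A₀ A₁ B) (hw : (g, w₀, w₁) ∈ RelZ1 R A₀ A₁ B)
    (hw' : (g', w₀', w₁') ∈ RelZ1 R A₀ A₁ B)
    (hv₀ : KaehlerDifferential.map K R A₀ A₀ β₀ = v₀)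
    (hv₁ : KaehlerDifferential.map K R A₁ A₁ β₁ = v₁)
    (h₀ : dBar K A₀ R β₀ = wedgeBar K A₀ R τ (a • w₀ + b • w₀' + D R A₀ s₀))
    (h₁ : dBar K A₁ R β₁ = wedgeBar K A₁ R τ (a • w₁ + b • w₁' + D R A₁ s₁))
    (hB : -D K B α + (KaehlerDifferential.map K K A₀ B β₀ - KaehlerDifferential.map K K A₁ B β₁) =
      -((a • g + b • g' + (algebraMap A₀ B s₀ - algebraMap A₁ B s₁)) • pullback K B R τ)) :
    IsConnectingImage K R A₀ A₁ B (classOf R A₀ A₁ B ⟨_, hz⟩)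
      (τ ⊗ₜ (a • classOf R A₀ A₁ B ⟨_, hw⟩ + b • classOf R A₀ A₁ B ⟨_, hw'⟩)) := by
  subst hv₀ hv₁
  refine ⟨⟨_, hz⟩, (α, β₀, β₁), τ ⊗ₜ (a • ⟨_, hw⟩ + b • ⟨_, hw'⟩ +
    ⟨relD0 R A₀ A₁ B (s₀, s₁), relD0_mem_relZ1 _⟩), rfl, rfl, ?_, ?_⟩
  · rw [LinearMap.lTensor_tmul, map_add, map_add, map_smul, map_smul, classOf_relD0, add_zero]
  · rw [LinearMap.lTensor_tmul, Submodule.subtype_apply]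
    simp only [Submodule.coe_add, Submodule.coe_smul, relD0_apply, Prod.smul_mk, Prod.mk_add_mk]
    rw [baseWedge_tmul, absD1_apply, h₀, h₁, hB]

/-- On two charts `y² = P₀(x)` and `u² = P₁(z)`, whose forms `dx/y`, `dz/u` are `θ₀`, `θ₁`, the
conditions on the charts for a connecting image are polynomial identities. -/
theorem isConnectingImage_of_identities {P₀ P₁ a₀ b₀ a₁ b₁ p₀ p₁ q₀ q₁ σ₀ σ₁ : R[X]} {a b c : R}
    {x y : A₀} {z u : A₁} {θ₀ v₀ w₀ : Ω[A₀⁄R]} {θ₁ v₁ w₁ : Ω[A₁⁄R]} {α g : B}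
    (hc : c * 2 = 1) (hδ : ∀ r, D K R r = δ r • τ)
    (hy : y ^ 2 = aeval x P₀) (hab₀ : a₀ * P₀ + b₀ * derivative P₀ = 1)
    (hu : u ^ 2 = aeval z P₁) (hab₁ : a₁ * P₁ + b₁ * derivative P₁ = 1)
    (hθ₀ : θ₀ = curveForm R a₀ b₀ x y) (hθ₁ : θ₁ = curveForm R a₁ b₁ z u)
    (hz : (α, v₀, v₁) ∈ RelZ1 R A₀ A₁ B) (hw : (g, w₀, w₁) ∈ RelZ1 R A₀ A₁ B)
    (hθ : (0, θ₀, -θ₁) ∈ RelZ1 R A₀ A₁ B)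
    (hv₀ : v₀ = aeval x p₀ • θ₀) (hv₁ : v₁ = aeval z p₁ • θ₁)
    (hw₀ : w₀ = aeval x q₀ • θ₀) (hw₁ : w₁ = aeval z q₁ • θ₁)
    (id₀ : coeffDer δ p₀ - derivative p₀ * (b₀ * coeffDer δ P₀) + p₀ * curvature δ P₀ a₀ b₀ c =
      C a * q₀ + C b + (derivative σ₀ * P₀ + C c * (σ₀ * derivative P₀)))
    (id₁ : coeffDer δ p₁ - derivative p₁ * (b₁ * coeffDer δ P₁) + p₁ * curvature δ P₁ a₁ b₁ c =
      C a * q₁ - C b + (derivative σ₁ * P₁ + C c * (σ₁ * derivative P₁)))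
    (idB : -D K B α + (aeval (algebraMap A₀ B x) p₀ •
          curveForm K a₀ b₀ (algebraMap A₀ B x) (algebraMap A₀ B y) -
        aeval (algebraMap A₁ B z) p₁ •
          curveForm K a₁ b₁ (algebraMap A₁ B z) (algebraMap A₁ B u)) =
      -((a • g + (aeval (algebraMap A₀ B x) σ₀ * algebraMap A₀ B y -
        aeval (algebraMap A₁ B z) σ₁ * algebraMap A₁ B u)) • pullback K B R τ)) :
    IsConnectingImage K R A₀ A₁ B (classOf R A₀ A₁ B ⟨_, hz⟩)
      (τ ⊗ₜ (a • classOf R A₀ A₁ B ⟨_, hw⟩ + b • classOf R A₀ A₁ B ⟨_, hθ⟩)) := by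
  subst hv₀ hv₁ hw₀ hw₁
  refine isConnectingImage_of_lift (β₀ := aeval x p₀ • curveForm K a₀ b₀ x y)
    (β₁ := aeval z p₁ • curveForm K a₁ b₁ z u) (aeval x σ₀ * y) (aeval z σ₁ * u) hz hw hθ
    ?_ ?_ ?_ ?_ ?_
  · rw [map_smul, map_curveForm_relative, hθ₀]
  · rw [map_smul, map_curveForm_relative, hθ₁]
  · rw [dBar_aeval_smul_curveForm hc hδ hy hab₀, id₀, D_aeval_mul_y hc hy hab₀, ← hθ₀, map_add,
      map_add, map_mul, aeval_C, aeval_C, add_smul, add_smul, mul_smul, algebraMap_smul,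
      algebraMap_smul]
  · rw [dBar_aeval_smul_curveForm hc hδ hu hab₁, id₁, D_aeval_mul_y hc hu hab₁, ← hθ₁, map_add,
      map_sub, map_mul, aeval_C, aeval_C, add_smul, sub_smul, mul_smul, algebraMap_smul,
      algebraMap_smul, smul_neg, sub_eq_add_neg]
  · rw [map_smul, map_smul, map_curveForm_overlap, map_curveForm_overlap,
      ← algebraMap_smul B (aeval x p₀), ← algebraMap_smul B (aeval z p₁),
      ← aeval_algebraMap_apply, ← aeval_algebraMap_apply, idB, smul_zero, add_zero, map_mul,
      map_mul, ← aeval_algebraMap_apply, ← aeval_algebraMap_apply]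

end ConnectingImages

/-! ### The explicit coboundaries -/

section Coboundaries

open Polynomial

variable {K R : Type u} [CommRing K] [CommRing R] [Algebra K R] (g₂ g₃ : R)
  (δ : Derivation K R R)

/-- The coefficient of `τ ⊗ ω*` in the connecting image of `ω`. -/
noncomputable def omegaCoeffStar : R :=
  24 * Ring.inverse (32 * disc g₂ g₃) * (2 * g₂ * δ g₃ - 3 * δ g₂ * g₃)

/-- The coefficient `Δ'/(12Δ)` of `τ ⊗ ω*` in the connecting image of `ω*`; its negative is the
coefficient of `τ ⊗ ω` in the connecting image of `ω`. -/
noncomputable def starCoeffStar : R :=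
  8 * Ring.inverse (32 * disc g₂ g₃) * (g₂ ^ 2 * δ g₂ - 18 * g₃ * δ g₃)

/-- The coefficient of `τ ⊗ ω` in the connecting image of `ω*`. -/
noncomputable def starCoeff : R :=
  -(8 * Ring.inverse (32 * disc g₂ g₃) * (g₂ * (2 * g₂ * δ g₃ - 3 * δ g₂ * g₃)))

/-- With `omegaSigmaInf`, the coboundary `(σ₀(x) y, σ_∞(z) u)` by which the connecting image of the
cocycle `ω` differs from a combination of the cocycles `ω*` and `ω`. -/
noncomputable def omegaSigma₀ : R[X] :=
  C (Ring.inverse (32 * disc g₂ g₃)) * (48 * C g₂ * C (δ g₂))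

/-- The component at infinity of the coboundary of `omegaSigma₀`. -/
noncomputable def omegaSigmaInf : R[X] :=
  C (Ring.inverse (32 * disc g₂ g₃)) *
    ((-3 * C g₂ ^ 3 * C (δ g₃) + 72 * C g₃ ^ 2 * C (δ g₃)) * X ^ 3 +
      (-3 * C g₂ ^ 3 * C (δ g₂) + 6 * C g₂ * C g₃ * C (δ g₃) + 72 * C g₃ ^ 2 * C (δ g₂)) * X ^ 2 +
      (-4 * C g₂ ^ 2 * C (δ g₃) + 6 * C g₂ * C g₃ * C (δ g₂)) * X +
      (-4 * C g₂ ^ 2 * C (δ g₂) + 72 * C g₃ * C (δ g₃)))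

/-- With `starSigmaInf`, the coboundary `(σ₀(x) y, σ_∞(z) u)` by which the connecting image of the
cocycle `ω*` differs from a combination of the cocycles `ω*` and `ω`. -/
noncomputable def starSigma₀ : R[X] :=
  C (Ring.inverse (32 * disc g₂ g₃)) *
    (96 * C g₂ * C (δ g₃) - 144 * C g₃ * C (δ g₂) + 96 * C g₂ * C (δ g₂) * X)

/-- The component at infinity of the coboundary of `starSigma₀`. -/
noncomputable def starSigmaInf : R[X] :=
  C (Ring.inverse (32 * disc g₂ g₃)) *
    ((3 * C g₂ ^ 3 * C g₃ * C (δ g₃) - 72 * C g₃ ^ 3 * C (δ g₃)) * X ^ 5 +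
      (3 * C (Ring.inverse 2) * C g₂ ^ 4 * C (δ g₃) + 3 * C g₂ ^ 3 * C g₃ * C (δ g₂) -
        42 * C g₂ * C g₃ ^ 2 * C (δ g₃) - 72 * C g₃ ^ 3 * C (δ g₂)) * X ^ 4 +
      (3 * C (Ring.inverse 2) * C g₂ ^ 4 * C (δ g₂) + C g₂ ^ 2 * C g₃ * C (δ g₃) -
        42 * C g₂ * C g₃ ^ 2 * C (δ g₂)) * X ^ 3 +
      (2 * C g₂ ^ 3 * C (δ g₃) + C g₂ ^ 2 * C g₃ * C (δ g₂) - 72 * C g₃ ^ 2 * C (δ g₃)) * X ^ 2 +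
      (2 * C g₂ ^ 3 * C (δ g₂) + 12 * C g₂ * C g₃ * C (δ g₃) - 72 * C g₃ ^ 2 * C (δ g₂)) * X +
      (-8 * C g₂ ^ 2 * C (δ g₃) + 12 * C g₂ * C g₃ * C (δ g₂)))

/-- The polynomial `½ (g₂z + 2g₃z²)`. -/
noncomputable def starPoly : R[X] :=
  C (Ring.inverse (2 : R)) * (C g₂ * X + 2 * C g₃ * X ^ 2)

variable {g₂ g₃ δ}

theorem C_inverse_two (h2 : IsUnit (2 : R)) : C (Ring.inverse (2 : R)) * 2 = 1 := by
  rw [← map_ofNat C 2, ← C_mul, Ring.inverse_mul_cancel _ h2, C_1]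

theorem coeffDer_two (δ : Derivation K R R) : coeffDer δ (2 : R[X]) = 0 := by
  rw [← map_ofNat (algebraMap K R[X]) 2]; exact Derivation.map_algebraMap _ _

theorem apply_inverse_two (h2 : IsUnit (2 : R)) (δ : Derivation K R R) :
    δ (Ring.inverse 2) = 0 := by
  have h := congrArg δ (Ring.inverse_mul_cancel _ h2)
  have h' : δ 2 = 0 := by
    rw [← map_ofNat (algebraMap K R) 2]; exact Derivation.map_algebraMap _ _
  rw [Derivation.leibniz, h', smul_zero, zero_add, Derivation.map_one_eq_zero, smul_eq_mul] at h
  exact h2.mul_right_eq_zero.mp h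

theorem coeffDer_starPoly (h2 : IsUnit (2 : R)) : coeffDer δ (starPoly g₂ g₃) =
    C (Ring.inverse 2) * (C (δ g₂) * X + 2 * C (δ g₃) * X ^ 2) := by
  simp only [starPoly, map_add, Derivation.leibniz, Derivation.leibniz_pow, coeffDer_X, coeffDer_C,
    coeffDer_two, apply_inverse_two h2, C_0, smul_eq_mul]
  ring

/-- The condition on `U₀` for `ω`. -/
theorem omega_identity_zero (h2 : IsUnit (2 : R)) (h32 : IsUnit (32 * disc g₂ g₃)) :
    curvature δ (cubic g₂ g₃) (bezoutA₀ g₂ g₃) (bezoutB₀ g₂ g₃) (Ring.inverse 2) =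
      C (omegaCoeffStar g₂ g₃ δ) * (2 * X) + C (-starCoeffStar g₂ g₃ δ) +
        (derivative (omegaSigma₀ g₂ g₃ δ) * cubic g₂ g₃ +
          C (Ring.inverse 2) * (omegaSigma₀ g₂ g₃ δ * derivative (cubic g₂ g₃))) := by
  have hc := C_inverse_two h2
  rw [curvature, coeffDer_cubic, derivative_cubic]
  simp only [cubic, bezoutA₀, bezoutB₀, omegaCoeffStar, starCoeffStar, omegaSigma₀,
    inverse_disc_eq h32, derivative_mul, derivative_sub, derivative_neg,
    derivative_X, derivative_C, derivative_ofNat, derivative_pow]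
  generalize Ring.inverse (32 * disc g₂ g₃) = i at *
  generalize Ring.inverse (2 : R) = c at *
  simp only [map_mul, map_sub, map_neg, map_pow, map_ofNat, Nat.cast_ofNat]
  generalize C i = i at *
  generalize C c = c at *
  generalize C g₂ = p at *
  generalize C g₃ = q at *
  generalize C (δ g₂) = P at *
  generalize C (δ g₃) = Q at *
  generalize (X : R[X]) = x at *
  -- After reduction by `2 c = 1` both sides agree; the coefficient is the quotient by `2 c - 1`.
  linear_combination (-576 * x ^ 2 * p * P * i - 288 * x * p * Q * i + 432 * x * q * P * i + 24 *
      p ^ 2 * P * i + 432 * q * Q * i) * hc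

/-- The condition on `U₀` for `ω*`. -/
theorem omegaStar_identity_zero (h2 : IsUnit (2 : R)) (h32 : IsUnit (32 * disc g₂ g₃)) :
    coeffDer δ (2 * X) - derivative (2 * X) * (bezoutB₀ g₂ g₃ * coeffDer δ (cubic g₂ g₃)) +
        2 * X * curvature δ (cubic g₂ g₃) (bezoutA₀ g₂ g₃) (bezoutB₀ g₂ g₃) (Ring.inverse 2) =
      C (starCoeffStar g₂ g₃ δ) * (2 * X) + C (starCoeff g₂ g₃ δ) +
        (derivative (starSigma₀ g₂ g₃ δ) * cubic g₂ g₃ +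
          C (Ring.inverse 2) * (starSigma₀ g₂ g₃ δ * derivative (cubic g₂ g₃))) := by
  have hc := C_inverse_two h2
  rw [curvature, coeffDer_cubic, derivative_cubic, Derivation.leibniz, coeffDer_X, coeffDer_two]
  simp only [cubic, bezoutA₀, bezoutB₀, starCoeff, starCoeffStar, starSigma₀,
    inverse_disc_eq h32, derivative_mul, derivative_add, derivative_sub, derivative_neg,
    derivative_X, derivative_C, derivative_ofNat, derivative_pow, smul_zero]
  generalize Ring.inverse (32 * disc g₂ g₃) = i at *
  generalize Ring.inverse (2 : R) = c at *
  simp only [map_mul, map_sub, map_neg, map_pow, map_ofNat, Nat.cast_ofNat]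
  generalize C i = i at *
  generalize C c = c at *
  generalize C g₂ = p at *
  generalize C g₃ = q at *
  generalize C (δ g₂) = P at *
  generalize C (δ g₃) = Q at *
  generalize (X : R[X]) = x at *
  linear_combination (-1152 * x ^ 3 * p * P * i - 1152 * x ^ 2 * p * Q * i + 1728 * x ^ 2 * q * P *
      i + 48 * x * p ^ 2 * P * i + 864 * x * q * Q * i + 48 * p ^ 2 * Q * i - 72 * p * q * P * i) *
      hc

/-- The condition on `U_∞` for `ω`. -/
theorem omega_identity_infinity (h2 : IsUnit (2 : R)) :
    -curvature δ (quartic g₂ g₃) (bezoutAInf g₂ g₃) (bezoutBInf g₂ g₃) (Ring.inverse 2) =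
      C (omegaCoeffStar g₂ g₃ δ) * starPoly g₂ g₃ - C (-starCoeffStar g₂ g₃ δ) +
        (derivative (omegaSigmaInf g₂ g₃ δ) * quartic g₂ g₃ +
          C (Ring.inverse 2) * (omegaSigmaInf g₂ g₃ δ * derivative (quartic g₂ g₃))) := by
  have hc := C_inverse_two h2
  rw [curvature, coeffDer_quartic, derivative_quartic]
  simp only [quartic, bezoutAInf, bezoutBInf, omegaCoeffStar, starCoeffStar, omegaSigmaInf,
    starPoly, derivative_mul, derivative_add, derivative_sub, derivative_neg,
    derivative_X, derivative_C, derivative_ofNat, derivative_pow]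
  generalize Ring.inverse (32 * disc g₂ g₃) = i at *
  generalize Ring.inverse (2 : R) = c at *
  simp only [map_mul, map_sub, map_neg, map_pow, map_ofNat, Nat.cast_ofNat]
  generalize C i = i at *
  generalize C c = c at *
  generalize C g₂ = p at *
  generalize C g₃ = q at *
  generalize C (δ g₂) = P at *
  generalize C (δ g₃) = Q at *
  generalize (X : R[X]) = x at *
  linear_combination (-12 * x ^ 6 * p ^ 3 * q * Q * i + 288 * x ^ 6 * q ^ 3 * Q * i - 9 * x ^ 5 *
      p ^ 4 * Q * i - 12 * x ^ 5 * p ^ 3 * q * P * i + 240 * x ^ 5 * p * q ^ 2 * Q * i + 288 *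
      x ^ 5 * q ^ 3 * P * i - 9 * x ^ 4 * p ^ 4 * P * i + 2 * x ^ 4 * p ^ 2 * q * Q * i + 240 *
      x ^ 4 * p * q ^ 2 * P * i + 2 * x ^ 3 * p ^ 2 * q * P * i + 48 * x ^ 2 * p * q * Q * i - 72 *
      x ^ 2 * q ^ 2 * P * i - 16 * x * p ^ 2 * Q * i + 24 * x * p * q * P * i + 8 * p ^ 2 * P * i -
      144 * q * Q * i) * hc

/-- The condition on `U_∞` for `ω*`. -/
theorem omegaStar_identity_infinity (h2 : IsUnit (2 : R)) (h32 : IsUnit (32 * disc g₂ g₃)) :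
    coeffDer δ (starPoly g₂ g₃) -
        derivative (starPoly g₂ g₃) * (bezoutBInf g₂ g₃ * coeffDer δ (quartic g₂ g₃)) +
        starPoly g₂ g₃ * curvature δ (quartic g₂ g₃) (bezoutAInf g₂ g₃) (bezoutBInf g₂ g₃)
          (Ring.inverse 2) =
      C (starCoeffStar g₂ g₃ δ) * starPoly g₂ g₃ - C (starCoeff g₂ g₃ δ) +
        (derivative (starSigmaInf g₂ g₃ δ) * quartic g₂ g₃ +
          C (Ring.inverse 2) * (starSigmaInf g₂ g₃ δ * derivative (quartic g₂ g₃))) := by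
  have hc := C_inverse_two h2
  have hi := congrArg C (Ring.inverse_mul_cancel _ h32)
  rw [curvature, coeffDer_quartic, coeffDer_starPoly h2, derivative_quartic]
  simp only [quartic, bezoutAInf, bezoutBInf, starCoeff, starCoeffStar, starSigmaInf,
    starPoly, derivative_mul, derivative_add, derivative_sub, derivative_neg,
    derivative_X, derivative_C, derivative_ofNat, derivative_pow]
  generalize Ring.inverse (32 * disc g₂ g₃) = i at *
  generalize Ring.inverse (2 : R) = c at *
  simp only [disc, map_mul, map_sub, map_neg, map_pow, map_ofNat, map_one,
    Nat.cast_ofNat] at hi ⊢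
  generalize C i = i at *
  generalize C c = c at *
  generalize C g₂ = p at *
  generalize C g₃ = q at *
  generalize C (δ g₂) = P at *
  generalize C (δ g₃) = Q at *
  generalize (X : R[X]) = x at *
  -- The relation `hi` enters through the term `½ (g₂' z + 2 g₃' z²)` from `coeffDer δ starPoly`,
  -- which has no factor `1/(32Δ)`.
  linear_combination (12 * x ^ 8 * p ^ 3 * q ^ 2 * Q * c * i - 15 * x ^ 8 * p ^ 3 * q ^ 2 * Q * i -
      288 * x ^ 8 * q ^ 4 * Q * c * i + 360 * x ^ 8 * q ^ 4 * Q * i + 21 * x ^ 7 * p ^ 4 * q * Q *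
      c * i - 15 * x ^ 7 * p ^ 4 * q * Q * i + 12 * x ^ 7 * p ^ 3 * q ^ 2 * P * c * i - 12 *
      x ^ 7 * p ^ 3 * q ^ 2 * P * i - 384 * x ^ 7 * p * q ^ 3 * Q * c * i + 528 * x ^ 7 * p *
      q ^ 3 * Q * i - 288 * x ^ 7 * q ^ 4 * P * c * i + 288 * x ^ 7 * q ^ 4 * P * i + 9 * x ^ 6 *
      p ^ 5 * Q * c * i + 21 * x ^ 6 * p ^ 4 * q * P * c * i - 12 * x ^ 6 * p ^ 4 * q * P * i -
      122 * x ^ 6 * p ^ 2 * q ^ 2 * Q * c * i + 165 * x ^ 6 * p ^ 2 * q ^ 2 * Q * i - 384 * x ^ 6 *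
      p * q ^ 3 * P * c * i + 414 * x ^ 6 * p * q ^ 3 * P * i + 9 * x ^ 5 * p ^ 5 * P * c * i -
      x ^ 5 * p ^ 3 * q * Q * c * i + 53 * x ^ 5 * p ^ 3 * q * Q * i - 122 * x ^ 5 * p ^ 2 *
      q ^ 2 * P * c * i + 124 * x ^ 5 * p ^ 2 * q ^ 2 * P * i - 1296 * x ^ 5 * q ^ 3 * Q * i - 6 *
      x ^ 4 * p ^ 4 * Q * c * i - 4 * x ^ 4 * p ^ 4 * Q * i - x ^ 4 * p ^ 3 * q * P * c * i + 44 *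
      x ^ 4 * p ^ 3 * q * P * i - 540 * x ^ 4 * p * q ^ 2 * Q * i - 1080 * x ^ 4 * q ^ 3 * P * i -
      6 * x ^ 3 * p ^ 4 * P * c * i - 2 * x ^ 3 * p ^ 4 * P * i - 432 * x ^ 3 * p * q ^ 2 * P * i +
      16 * x ^ 2 * p ^ 3 * Q * i + 8 * x ^ 2 * p ^ 2 * q * P * i - 576 * x ^ 2 * q ^ 2 * Q * i +
      8 * x * p ^ 3 * P * i + 48 * x * p * q * Q * i - 288 * x * q ^ 2 * P * i + 16 * p ^ 2 * Q * i
      - 24 * p * q * P * i) * hc - c * (P * x + 2 * Q * x ^ 2) * hi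

section Overlap

variable {τ : Ω[R⁄K]} {B : Type u} [CommRing B] [Algebra K B] [Algebra R B] [IsScalarTower K R B]
  {x y v : B}

/-- The condition on the overlap for `ω`. -/
theorem omega_identity_overlap (h32 : IsUnit (32 * disc g₂ g₃)) (hδ : ∀ r, D K R r = δ r • τ)
    (hv : x * v = 1) (hy : y ^ 2 = aeval x (cubic g₂ g₃))
    (hu : (y * v ^ 2) ^ 2 = aeval v (quartic g₂ g₃)) :
    -D K B 0 + (aeval x (1 : R[X]) • curveForm K (bezoutA₀ g₂ g₃) (bezoutB₀ g₂ g₃) x y -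
        aeval v (-1 : R[X]) •
          curveForm K (bezoutAInf g₂ g₃) (bezoutBInf g₂ g₃) v (y * v ^ 2)) =
      -((omegaCoeffStar g₂ g₃ δ • (y * v) + (aeval x (omegaSigma₀ g₂ g₃ δ) * y -
        aeval v (omegaSigmaInf g₂ g₃ δ) * (y * v ^ 2))) • pullback K B R τ) := by
  have hT := curveForm_add_curveForm h32 hδ hv hy hu
  have key : aeval x (coeffDer δ (cubic g₂ g₃)) * y * aeval v (gluePoly g₂ g₃) =
      -(omegaCoeffStar g₂ g₃ δ • (y * v) + (aeval x (omegaSigma₀ g₂ g₃ δ) * y -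
        aeval v (omegaSigmaInf g₂ g₃ δ) * (y * v ^ 2))) := by
    rw [← algebraMap_smul B, coeffDer_cubic]
    simp only [gluePoly, omegaCoeffStar, omegaSigma₀, omegaSigmaInf, smul_eq_mul,
      map_mul, map_sub, map_add, map_neg, map_pow, map_ofNat, aeval_C, aeval_X]
    generalize algebraMap R B g₂ = p
    generalize algebraMap R B g₃ = q
    generalize algebraMap R B (δ g₂) = P
    generalize algebraMap R B (δ g₃) = Q
    generalize algebraMap R B (Ring.inverse (32 * disc g₂ g₃)) = i
    linear_combination (y * (-3 * v ^ 4 * p ^ 3 * P * i + 72 * v ^ 4 * q ^ 2 * P * i + 6 * v ^ 3 *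
        p * q * P * i - 4 * v ^ 2 * p ^ 2 * P * i + 72 * v * q * P * i - 48 * p * P * i)) * hv
  rw [← neg_smul, ← key, ← hT, map_zero, map_neg, map_one, map_one, neg_zero, zero_add, one_smul,
    neg_smul, one_smul, sub_neg_eq_add]

/-- The condition on the overlap, for `X = dx`, `Y = dy` and the cocycle with components `y v`,
`2 x T₀`, `s T₁`: the coefficients of `T₀` and of `τ` are compared. -/
theorem overlap_combination {A M : Type u} [CommRing A] [AddCommGroup M] [Module A M]
    {a b c f' h e x y v s m : A} {X Y T₀ T₁ τ : M}
    (hX : X = y • T₀ - (b * h) • τ) (hY : Y = (c * f') • T₀ + (c * (a * h) * y) • τ)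
    (hT : T₀ + T₁ = (h * y * e) • τ) (k₁ : -(c * v * f') + y ^ 2 * v ^ 2 + 2 * x + s = 0)
    (k₂ : -(c * a * h * v) - v ^ 2 * b * h - s * h * e + m = 0) :
    -(y • -(v ^ 2 • X) + v • Y) + ((2 * x) • T₀ - s • T₁) = -((m * y) • τ) := by
  obtain rfl := eq_sub_of_add_eq' hT
  rw [hX, hY]
  linear_combination (norm := module) k₁ • T₀ + (y * k₂) • τ

/-- The condition on the overlap for `ω*`. -/
theorem omegaStar_identity_overlap (h2 : IsUnit (2 : R)) (h32 : IsUnit (32 * disc g₂ g₃))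
    (hδ : ∀ r, D K R r = δ r • τ) (hv : x * v = 1) (hy : y ^ 2 = aeval x (cubic g₂ g₃))
    (hu : (y * v ^ 2) ^ 2 = aeval v (quartic g₂ g₃)) :
    -D K B (y * v) +
        (aeval x (2 * X : R[X]) • curveForm K (bezoutA₀ g₂ g₃) (bezoutB₀ g₂ g₃) x y -
          aeval v (starPoly g₂ g₃) •
            curveForm K (bezoutAInf g₂ g₃) (bezoutBInf g₂ g₃) v (y * v ^ 2)) =
      -((starCoeffStar g₂ g₃ δ • (y * v) + (aeval x (starSigma₀ g₂ g₃ δ) * y -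
        aeval v (starSigmaInf g₂ g₃ δ) * (y * v ^ 2))) • pullback K B R τ) := by
  have hc := Ring.inverse_mul_cancel _ h2
  have hab := bezout_cubic (isUnit_of_mul_isUnit_right h32)
  have hX := dx_eq hδ hy hab
  have hY := dy_eq hc hδ hy hab
  have hT := curveForm_add_curveForm h32 hδ hv hy hu
  have hc' : algebraMap R B (Ring.inverse 2) * 2 = 1 := by
    rw [← map_ofNat (algebraMap R B) 2, ← map_mul, hc, map_one]
  rw [map_mul] at hX hY
  rw [Derivation.leibniz, dx_inv (R := K) hv]
  have k := overlap_combination (x := x) (v := v) (s := aeval v (starPoly g₂ g₃))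
    (m := algebraMap R B (starCoeffStar g₂ g₃ δ) * v + (aeval x (starSigma₀ g₂ g₃ δ) -
        aeval v (starSigmaInf g₂ g₃ δ) * v ^ 2)) hX hY hT ?_ ?_
  · rw [map_mul, aeval_X, map_ofNat, k, ← algebraMap_smul B (starCoeffStar g₂ g₃ δ), smul_eq_mul]
    congr 2
    ring
  all_goals
    simp only [coeffDer_cubic, derivative_cubic, hy]
    simp only [cubic, bezoutA₀, bezoutB₀, starPoly, gluePoly, starCoeffStar, starSigma₀,
      starSigmaInf, inverse_disc_eq h32, map_mul, map_sub, map_add, map_neg, map_pow, map_ofNat,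
      aeval_C, aeval_X]
    generalize algebraMap R B g₂ = p
    generalize algebraMap R B g₃ = q
    generalize algebraMap R B (δ g₂) = P
    generalize algebraMap R B (δ g₃) = Q
    generalize algebraMap R B (Ring.inverse (32 * disc g₂ g₃)) = i
    generalize algebraMap R B (Ring.inverse 2) = c at *
    clear hX hY hT hy hu hab
  -- The coefficients are quotients on division by `x v - 1` and `2 c - 1`.
  · linear_combination (4 * x ^ 2 * v - 12 * x * c + 4 * x - v * p) * hv + (-6 * x + v ^ 2 * q +
      v * p) * hc'
  · linear_combination (192 * x ^ 2 * v * p * P * i + 192 * x * v * p * Q * i - 288 * x * v * q *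
      P * i - 576 * x * p * P * c * i + 192 * x * p * P * i + 6 * v ^ 6 * p ^ 3 * q * P * c * i -
      144 * v ^ 6 * q ^ 3 * P * c * i + 3 * v ^ 5 * p ^ 4 * P * c * i - 84 * v ^ 5 * p * q ^ 2 *
      P * c * i + 2 * v ^ 4 * p ^ 2 * q * P * c * i + 4 * v ^ 3 * p ^ 3 * P * c * i - 144 * v ^ 3 *
      q ^ 2 * P * c * i + 24 * v ^ 2 * p * q * P * c * i + 48 * v * p ^ 2 * P * c * i - 32 * v *
      p ^ 2 * P * i - 288 * v * q * Q * i - 576 * p * Q * c * i + 192 * p * Q * i + 864 * q * P *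
      c * i - 288 * q * P * i) * hv + (-288 * x * p * P * i + 3 * v ^ 7 * p ^ 3 * q * Q * i - 72 *
      v ^ 7 * q ^ 3 * Q * i + 3 * v ^ 6 * p ^ 3 * q * P * i - 42 * v ^ 6 * p * q ^ 2 * Q * i - 72 *
      v ^ 6 * q ^ 3 * P * i + v ^ 5 * p ^ 2 * q * Q * i - 42 * v ^ 5 * p * q ^ 2 * P * i + 2 *
      v ^ 4 * p ^ 3 * Q * i + v ^ 4 * p ^ 2 * q * P * i - 72 * v ^ 4 * q ^ 2 * Q * i + 2 * v ^ 3 *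
      p ^ 3 * P * i + 12 * v ^ 3 * p * q * Q * i - 72 * v ^ 3 * q ^ 2 * P * i + 24 * v ^ 2 *
      p ^ 2 * Q * i + 12 * v ^ 2 * p * q * P * i + 24 * v * p ^ 2 * P * i + 432 * v * q * Q * i -
      288 * p * Q * i + 432 * q * P * i) * hc'

end Overlap

end Coboundaries

/-! ### The connection on the basis -/

section Weierstrass

open Polynomial

variable {K R : Type u} [CommRing K] [CommRing R] [Algebra K R] {g₂ g₃ : R}
  {δ : Derivation K R R} {τ : Ω[R⁄K]}

theorem y₀_sq_eq_aeval : y₀ g₂ g₃ ^ 2 = aeval (x₀ g₂ g₃) (cubic g₂ g₃) :=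
  curveY_sq (P := cubic g₂ g₃)

theorem uInf_sq_eq_aeval : uInf g₂ g₃ ^ 2 = aeval (zInf g₂ g₃) (quartic g₂ g₃) :=
  curveY_sq (P := quartic g₂ g₃)

theorem yB_sq_eq_aeval : yB g₂ g₃ ^ 2 = aeval (xB g₂ g₃) (cubic g₂ g₃) := by
  rw [xB, aeval_algebraMap_apply, ← y₀_sq_eq_aeval, map_pow, yB]

theorem uInf_sq_eq_aeval_overlap :
    (yB g₂ g₃ * xInvB g₂ g₃ ^ 2) ^ 2 = aeval (xInvB g₂ g₃) (quartic g₂ g₃) := by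
  rw [← algebraMap_zInf, aeval_algebraMap_apply, ← uInf_sq_eq_aeval, map_pow, algebraMap_uInf,
    algebraMap_zInf]

theorem smul_dzOverU_eq : Ring.inverse (2 : R) •
    (algebraMap R _ g₂ * zInf g₂ g₃ + 2 * algebraMap R _ g₃ * zInf g₂ g₃ ^ 2) • dzOverU g₂ g₃ =
      aeval (zInf g₂ g₃) (starPoly g₂ g₃) • dzOverU g₂ g₃ := by
  rw [← algebraMap_smul (ChartInf g₂ g₃) (Ring.inverse (2 : R)), smul_smul, starPoly]
  simp only [map_mul, map_add, map_pow, map_ofNat, aeval_C, aeval_X]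

theorem isConnectingImage_omega (h2 : IsUnit (2 : R)) (hΔ : IsUnit (disc g₂ g₃))
    (hδ : ∀ r, D K R r = δ r • τ) :
    IsConnectingImage K R (Chart0 g₂ g₃) (ChartInf g₂ g₃) (Overlap g₂ g₃) (omega h2 hΔ)
      (τ ⊗ₜ (omegaCoeffStar g₂ g₃ δ • omegaStar h2 hΔ +
        -starCoeffStar g₂ g₃ δ • omega h2 hΔ)) := by
  have h32 := isUnit_thirtyTwo_mul_disc h2 hΔ
  refine isConnectingImage_of_identities (p₀ := 1) (p₁ := -1) (q₀ := 2 * X)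
    (q₁ := starPoly g₂ g₃) (σ₀ := omegaSigma₀ g₂ g₃ δ) (σ₁ := omegaSigmaInf g₂ g₃ δ)
    (Ring.inverse_mul_cancel _ h2) hδ y₀_sq_eq_aeval (bezout_cubic hΔ) uInf_sq_eq_aeval
    (bezout_quartic h32) dxOverY_eq dzOverU_eq _ _ _ ?_ ?_ ?_ smul_dzOverU_eq ?_ ?_ ?_
  · rw [map_one, one_smul]
  · rw [map_neg, map_one, neg_smul, one_smul]
  · rw [map_mul, map_ofNat, aeval_X]
  · rw [Derivation.map_one_eq_zero, derivative_one, zero_mul, sub_zero, zero_add, one_mul]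
    exact omega_identity_zero h2 h32
  · rw [map_neg, Derivation.map_one_eq_zero, derivative_neg, derivative_one, neg_zero, zero_mul,
      sub_zero, zero_add, neg_one_mul]
    exact omega_identity_infinity h2
  · rw [algebraMap_zInf, algebraMap_uInf]
    exact omega_identity_overlap h32 hδ (xB_mul_xInvB g₂ g₃) yB_sq_eq_aeval
      uInf_sq_eq_aeval_overlap

theorem isConnectingImage_omegaStar (h2 : IsUnit (2 : R)) (hΔ : IsUnit (disc g₂ g₃))
    (hδ : ∀ r, D K R r = δ r • τ) :
    IsConnectingImage K R (Chart0 g₂ g₃) (ChartInf g₂ g₃) (Overlap g₂ g₃) (omegaStar h2 hΔ)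
      (τ ⊗ₜ (starCoeffStar g₂ g₃ δ • omegaStar h2 hΔ +
        starCoeff g₂ g₃ δ • omega h2 hΔ)) := by
  have h32 := isUnit_thirtyTwo_mul_disc h2 hΔ
  have hX : (2 * x₀ g₂ g₃) • dxOverY g₂ g₃ =
      aeval (x₀ g₂ g₃) (2 * X : R[X]) • dxOverY g₂ g₃ := by
    rw [map_mul, map_ofNat, aeval_X]
  refine isConnectingImage_of_identities (p₀ := 2 * X) (p₁ := starPoly g₂ g₃) (q₀ := 2 * X)
    (q₁ := starPoly g₂ g₃) (σ₀ := starSigma₀ g₂ g₃ δ) (σ₁ := starSigmaInf g₂ g₃ δ)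
    (Ring.inverse_mul_cancel _ h2) hδ y₀_sq_eq_aeval (bezout_cubic hΔ) uInf_sq_eq_aeval
    (bezout_quartic h32) dxOverY_eq dzOverU_eq _ _ _ hX smul_dzOverU_eq hX smul_dzOverU_eq
    (omegaStar_identity_zero h2 h32) (omegaStar_identity_infinity h2 h32) ?_
  rw [algebraMap_zInf, algebraMap_uInf]
  exact omegaStar_identity_overlap h2 h32 hδ (xB_mul_xInvB g₂ g₃) yB_sq_eq_aeval
    uInf_sq_eq_aeval_overlap

end Weierstrass

section Coefficients

variable {K R : Type u} [CommRing K] [CommRing R] [Algebra K R] {g₂ g₃ : R}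

theorem inverse_mul_disc {n : R} (hn : IsUnit n) (h32 : IsUnit (32 * disc g₂ g₃)) :
    n * Ring.inverse (n * disc g₂ g₃) = 32 * Ring.inverse (32 * disc g₂ g₃) := by
  have e₁ := Ring.inverse_mul_cancel _ h32
  have e₂ := Ring.inverse_mul_cancel _ (hn.mul (isUnit_of_mul_isUnit_right h32))
  linear_combination (32 * Ring.inverse (32 * disc g₂ g₃)) * e₂ -
    (n * Ring.inverse (n * disc g₂ g₃)) * e₁

theorem derivation_disc (δ : Derivation K R R) :
    δ (disc g₂ g₃) = 3 * (g₂ ^ 2 * δ g₂ - 18 * g₃ * δ g₃) := by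
  have h : δ 27 = 0 := by
    rw [← map_ofNat (algebraMap K R) 27]; exact Derivation.map_algebraMap _ _
  simp only [disc, map_sub, Derivation.leibniz, Derivation.leibniz_pow, h, smul_eq_mul]
  ring

theorem isUnit_ofNat (K R : Type u) [Field K] [CharZero K] [CommRing R] [Algebra K R] (n : ℕ)
    [n.AtLeastTwo] : IsUnit (OfNat.ofNat n : R) := by
  rw [← map_ofNat (algebraMap K R) n]
  exact (isUnit_iff_ne_zero.mpr (OfNat.ofNat_ne_zero n)).map _

theorem omegaCoeffStar_eq (h4 : IsUnit (4 : R)) (h32 : IsUnit (32 * disc g₂ g₃))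
    (δ : Derivation K R R) : omegaCoeffStar g₂ g₃ δ =
      3 * (2 * g₂ * δ g₃ - 3 * δ g₂ * g₃) * Ring.inverse (4 * disc g₂ g₃) := by
  obtain ⟨i, hi⟩ := h4.exists_left_inv
  rw [omegaCoeffStar]
  linear_combination (-(i * 3 * (2 * g₂ * δ g₃ - 3 * δ g₂ * g₃))) * inverse_mul_disc h4 h32 + (3 *
      (2 * g₂ * δ g₃ - 3 * δ g₂ * g₃) * (Ring.inverse (4 * disc g₂ g₃) - 8 * Ring.inverse (32 *
      disc g₂ g₃))) * hi

theorem starCoeff_eq (h4 : IsUnit (4 : R)) (h32 : IsUnit (32 * disc g₂ g₃))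
    (δ : Derivation K R R) : starCoeff g₂ g₃ δ =
      -(g₂ * (2 * g₂ * δ g₃ - 3 * δ g₂ * g₃) * Ring.inverse (4 * disc g₂ g₃)) := by
  obtain ⟨i, hi⟩ := h4.exists_left_inv
  rw [starCoeff]
  linear_combination (i * g₂ * (2 * g₂ * δ g₃ - 3 * δ g₂ * g₃)) * inverse_mul_disc h4 h32 - (g₂ *
      (2 * g₂ * δ g₃ - 3 * δ g₂ * g₃) * (Ring.inverse (4 * disc g₂ g₃) - 8 * Ring.inverse (32 *
      disc g₂ g₃))) * hi

theorem starCoeffStar_eq (h4 : IsUnit (4 : R)) (h12 : IsUnit (12 : R))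
    (h32 : IsUnit (32 * disc g₂ g₃)) (δ : Derivation K R R) :
    starCoeffStar g₂ g₃ δ = δ (disc g₂ g₃) * Ring.inverse (12 * disc g₂ g₃) := by
  obtain ⟨i, hi⟩ := h4.exists_left_inv
  rw [starCoeffStar, derivation_disc]
  linear_combination (-(i * (g₂ ^ 2 * δ g₂ - 18 * g₃ * δ g₃))) * inverse_mul_disc h12 h32 +
      ((g₂ ^ 2 * δ g₂ - 18 * g₃ * δ g₃) * (3 * Ring.inverse (12 * disc g₂ g₃) - 8 * Ring.inverse
      (32 * disc g₂ g₃))) * hi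

end Coefficients

/-- The connection on a pair of generators whose connecting images are known. -/
theorem exists_isGaussManin_of_pair {K R A₀ A₁ B : Type u} [CommRing K] [CommRing R] [CommRing A₀]
    [CommRing A₁] [CommRing B] [Algebra K R] [Algebra K A₀] [Algebra K A₁] [Algebra K B]
    [Algebra R A₀] [Algebra R A₁] [Algebra R B] [Algebra A₀ B] [Algebra A₁ B]
    [IsScalarTower K R A₀] [IsScalarTower K R A₁] [IsScalarTower K R B]
    [IsScalarTower R A₀ B] [IsScalarTower R A₁ B] [IsScalarTower K A₀ B] [IsScalarTower K A₁ B]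
    {τ : Ω[R⁄K]} (hτ : ∀ σ : Ω[R⁄K], ∃ r : R, σ = r • τ)
    (hB : ∀ b : B, b • pullback K B R τ = 0 → b = 0)
    (h₀ : ∀ w : Ω[A₀⁄R], wedgeBar K A₀ R τ w = 0 → w = 0)
    (h₁ : ∀ w : Ω[A₁⁄R], wedgeBar K A₁ R τ w = 0 → w = 0)
    {ξ ζ : H1dR R A₀ A₁ B} (hs : Submodule.span R {ξ, ζ} = ⊤) {a b c d : R}
    (hξ : IsConnectingImage K R A₀ A₁ B ξ (τ ⊗ₜ (a • ζ + -b • ξ)))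
    (hζ : IsConnectingImage K R A₀ A₁ B ζ (τ ⊗ₜ (c • ζ + -d • ξ))) :
    ∃ nabla : H1dR R A₀ A₁ B →ₗ[K] Ω[R⁄K] ⊗[R] H1dR R A₀ A₁ B,
      IsGaussManin K R A₀ A₁ B nabla ∧
      (∀ (r : R) (ξ : H1dR R A₀ A₁ B), nabla (r • ξ) = D K R r ⊗ₜ[R] ξ + r • nabla ξ) ∧
      nabla ξ = a • (τ ⊗ₜ[R] ζ) - b • (τ ⊗ₜ[R] ξ) ∧
      nabla ζ = c • (τ ⊗ₜ[R] ζ) - d • (τ ⊗ₜ[R] ξ) := by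
  obtain ⟨nabla, h, h'⟩ := exists_isGaussManin hτ hB h₀ h₁ hs
    (by rintro _ (rfl | rfl); exacts [⟨_, hξ⟩, ⟨_, hζ⟩])
  refine ⟨nabla, h, h', ?_, ?_⟩
  · rw [(h _ _).mp hξ, TensorProduct.tmul_add, TensorProduct.tmul_smul, TensorProduct.tmul_smul,
      neg_smul, ← sub_eq_add_neg]
  · rw [(h _ _).mp hζ, TensorProduct.tmul_add, TensorProduct.tmul_smul, TensorProduct.tmul_smul,
      neg_smul, ← sub_eq_add_neg]

theorem exists_isGaussManin_and_apply {K R : Type u} [CommRing K] [CommRing R] [Algebra K R]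
    {g₂ g₃ : R} (dt : Module.Basis Unit R Ω[R⁄K]) (h2 : IsUnit (2 : R)) (h4 : IsUnit (4 : R))
    (h12 : IsUnit (12 : R)) (hΔ : IsUnit (disc g₂ g₃)) :
    ∃ nabla : WH1 g₂ g₃ →ₗ[K] Ω[R⁄K] ⊗[R] WH1 g₂ g₃,
      IsGaussManin K R (Chart0 g₂ g₃) (ChartInf g₂ g₃) (Overlap g₂ g₃) nabla ∧
      (∀ (r : R) (ξ : WH1 g₂ g₃), nabla (r • ξ) = D K R r ⊗ₜ[R] ξ + r • nabla ξ) ∧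
      nabla (omega h2 hΔ) =
        (3 * (2 * g₂ * derivAlong dt g₃ - 3 * derivAlong dt g₂ * g₃) *
          Ring.inverse (4 * disc g₂ g₃)) • (dt () ⊗ₜ[R] omegaStar h2 hΔ) -
        (derivAlong dt (disc g₂ g₃) * Ring.inverse (12 * disc g₂ g₃)) •
          (dt () ⊗ₜ[R] omega h2 hΔ) ∧
      nabla (omegaStar h2 hΔ) =
        (derivAlong dt (disc g₂ g₃) * Ring.inverse (12 * disc g₂ g₃)) •
          (dt () ⊗ₜ[R] omegaStar h2 hΔ) -
        (g₂ * (2 * g₂ * derivAlong dt g₃ - 3 * derivAlong dt g₂ * g₃) *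
          Ring.inverse (4 * disc g₂ g₃)) • (dt () ⊗ₜ[R] omega h2 hΔ) := by
  have h32 := isUnit_thirtyTwo_mul_disc h2 hΔ
  have hc := Ring.inverse_mul_cancel _ h2
  have hB : ∀ b : Overlap g₂ g₃, b • pullback K (Overlap g₂ g₃) R (dt ()) = 0 → b = 0 := by
    intro b hb
    rw [← map_pullback (A := Chart0 g₂ g₃)] at hb
    exact eq_zero_of_smul_map_eq_zero (Submonoid.powers (x₀ g₂ g₃))
      (eq_zero_of_smul_pullback_eq_zero dt hc (bezout_cubic hΔ)) hb
  have hω := isConnectingImage_omega (K := K) h2 hΔ (D_eq_baseDer dt)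
  have hωs := isConnectingImage_omegaStar (K := K) h2 hΔ (D_eq_baseDer dt)
  rw [omegaCoeffStar_eq h4 h32, starCoeffStar_eq h4 h12 h32] at hω
  rw [starCoeff_eq h4 h32, starCoeffStar_eq h4 h12 h32] at hωs
  exact exists_isGaussManin_of_pair (exists_eq_smul_basis dt) hB
    (eq_zero_of_wedgeBar_eq_zero dt hc (bezout_cubic hΔ))
    (eq_zero_of_wedgeBar_eq_zero dt hc (bezout_quartic h32)) (span_omega_omegaStar h2 hΔ) hω hωs

end EllipticGM

theorem theorem6p4 (K R : Type u) [Field K] [CharZero K] [CommRing R] [Algebra K R]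
    [Algebra.Smooth K R] (g₂ g₃ : R) (hΔ : IsUnit (EllipticGM.disc g₂ g₃))
    (dt : Module.Basis Unit R Ω[R⁄K]) :
    let Δ := EllipticGM.disc g₂ g₃
    let g₂' := EllipticGM.derivAlong dt g₂
    let g₃' := EllipticGM.derivAlong dt g₃
    let Δ' := EllipticGM.derivAlong dt Δ
    let ω : EllipticGM.WH1 g₂ g₃ := EllipticGM.omega (EllipticGM.isUnit_two K R) hΔ
    let ωs : EllipticGM.WH1 g₂ g₃ := EllipticGM.omegaStar (EllipticGM.isUnit_two K R) hΔ
    (LinearIndependent R ![ω, ωs] ∧ Submodule.span R {ω, ωs} = ⊤) ∧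
    ∃ nabla : EllipticGM.WH1 g₂ g₃ →ₗ[K] Ω[R⁄K] ⊗[R] EllipticGM.WH1 g₂ g₃,
      EllipticGM.IsGaussManin K R (EllipticGM.Chart0 g₂ g₃) (EllipticGM.ChartInf g₂ g₃)
        (EllipticGM.Overlap g₂ g₃) nabla ∧
      (∀ (r : R) (ξ : EllipticGM.WH1 g₂ g₃),
        nabla (r • ξ) = KaehlerDifferential.D K R r ⊗ₜ[R] ξ + r • nabla ξ) ∧
      nabla ω =
        (3 * (2 * g₂ * g₃' - 3 * g₂' * g₃) * Ring.inverse (4 * Δ)) • (dt () ⊗ₜ[R] ωs) -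
          (Δ' * Ring.inverse (12 * Δ)) • (dt () ⊗ₜ[R] ω) ∧
      nabla ωs =
        (Δ' * Ring.inverse (12 * Δ)) • (dt () ⊗ₜ[R] ωs) -
          (g₂ * (2 * g₂ * g₃' - 3 * g₂' * g₃) * Ring.inverse (4 * Δ)) • (dt () ⊗ₜ[R] ω) := by
  have h2 := EllipticGM.isUnit_two K R
  exact ⟨⟨EllipticGM.linearIndependent_omega_omegaStar h2 hΔ,
    EllipticGM.span_omega_omegaStar h2 hΔ⟩,
    EllipticGM.exists_isGaussManin_and_apply dt h2 (EllipticGM.isUnit_ofNat K R 4)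
      (EllipticGM.isUnit_ofNat K R 12) hΔ⟩
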